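/- Corollary 14. Let $G$ be a finite connected pseudograph (multiple edges and loops allowed) with $n$ nodes and with at least one loop. *Tubings.* A tube of a connected pseudograph $H$ is a proper connected (nonempty) subgraph of $H$ that contains at least one edge between any two distinct nodes of it that are adjacent in $H$. Two tubes are compatible if one properly contains the other, or if they are disjoint and no edge of $H$ joins them. A tubing of $H$ is a set of pairwise compatible tubes. Let $r(H)$ be the minimal number of edges whose removal makes $H$ simple. A convex polyhedron $P$ is a realization of the pseudograph associahedron $\mathcal K H$ if the poset of its nonempty faces is isomorphic to the set of tubings of $H$ ordered by reverse containment, where tubings with $k$ tubes correspond to faces of codimension $k$, and $\dim P=|V(H)|-1+r(H)$. *Loop-free version.* Let $G_m$ be obtained from $G$ by replacing, for each node $v$ that carries a loop, the loops at $v$ by edges between $v$ and a new node $v'$ (a ghost node). For a tube $t$ of $G$ let $\phi(t)$ be the subgraph $t_m$ of $G_m$ (each loop of $t$ is replaced by its edge, with the ghost node), and $\phi(T)=\{\phi(t): t\in T\}$. *The hull realization.* Let $B_1,\dots,B_k$ be the bundles of $G_m$ (classes of edges with the same endpoints), $b_i=|B_i|$, let $c=(|V(G_m)|+|E(G_m)|)^2$,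 let $|G_m-t|$ be the number of nodes and edges of $G_m$ not in $t$, and $$\Lambda(t)=c^{|V(t)|}+\sum_{i:\,B_i\cap E(t)\ne\emptyset}c^{|B_i\cap E(t)|}+|G_m-t|^2 .$$ For a maximal tubing $T$ of $G_m$ let $e(i,1),\dots,e(i,b_i)$ be the edges of $B_i$ ordered (strictly) by the number of tubes of $T$ not containing them, and let $G_{e(i,j)}$, $j<b_i$, be the largest tube of $T$ containing $e(i,j)$ but not $e(i,j+1)$. Define $$f_T(e(i,1))=c+\sum_{x=1}^{b_i-1}\bigl(2|G_m-G_{e(i,x)}|-1\bigr),\qquad f_T(e(i,j))=c^{j-1}(c-1)-\bigl(2|G_m-G_{e(i,j-1)}|-1\bigr)\quad(j\ge 2),$$ and define $f_T$ on the nodes by $\sum_{x\in t}f_T(x)=\Lambda(t)$ for all $t\in T$ and for $t=G_m$ (sums over nodes and edges). Let $\mathrm{conv}(G_m)\subset\mathbb R^{V(G_m)\sqcup E(G_m)}$ be the convex hull of the points $f_T$, for $T$ ranging over the maximal tubings of $G_m$. *Claim.* The points $f_T$ are well defined (each $f_T$ exists and is unique), and $\mathrm{conv}(G_m)$ is the set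 of all $p$ with $$\sum_{v}p(v)=c^{|V(G_m)|},\qquad \sum_{e\in B_i}p(e)=c^{b_i}\ \ (1\le i\le k),\qquad h_t^+:\ \sum_{x\in t}p(x)\ge\Lambda(t)\ \text{ for every tube } t \text{ of } G_m ;$$ it is a realization of $\mathcal K G_m$ in which a tubing $U$ corresponds to the face of $\mathrm{conv}(G_m)$ where equality holds in $h_t^+$ for all $t\in U$. The singletons $\{v'\}$ of the ghost nodes are tubes of $G_m$. Let $P$ be the polyhedron defined by the same equations and by the halfspaces $h_t^+$ of all tubes $t$ of $G_m$ except the singletons $\{v'\}$ of the ghost nodes. Then $P$ is an unbounded polyhedron and a realization of the cone $\mathcal K G$, of dimension $n-1+r(G)$; a tubing $T$ of $G$ corresponds to the face $F_T$ of $P$ where equality holds in $h_{\phi(t)}^+$ for all $t\in T$. Moreover, the sets $\phi(T)$, for $T$ a tubing of $G$, are exactly the tubings of $G_m$ that contain no singleton $\{v'\}$ of a ghost node, and the intersection of $F_T$ with all the removed halfspaces $h_{\{v'\}}^+$ is the face of $\mathrm{conv}(G_m)$ that corresponds to $\phi(T)$. -/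

import Mathlib

open scoped Graph

namespace Graph

/-! ### Tubes and tubings of a pseudograph

Pseudographs (loops and multiple edges allowed) are Mathlib's `Graph α β`; subgraphs are ordered by
`≤`. -/

section Tubings

variable {α β : Type*}

/-- A tube of `G`: a proper connected subgraph which contains at least one edge between any two of
its (distinct) nodes that are joined by an edge of `G`. -/
def IsTube (G t : Graph α β) : Prop :=
  t < G ∧ t.toSimpleGraph.Connected ∧
    ∀ x ∈ V(t), ∀ y ∈ V(t), x ≠ y → G.Adj x y → t.Adj x y

/-- Two tubes are compatible if one properly contains the other, or if they are disjoint and cannot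
be connected by a single edge of `G`. -/
def TubeCompatible (G s t : Graph α β) : Prop :=
  s < t ∨ t < s ∨ (Disjoint V(s) V(t) ∧ ∀ x ∈ V(s), ∀ y ∈ V(t), ¬ G.Adj x y)

/-- The connected components of `G`, as subgraphs. -/
def IsComponent (G H : Graph α β) : Prop :=
  H ≤c G ∧ H.toSimpleGraph.Connected

/-- A tubing of `G`: a set of pairwise compatible tubes which does not contain all the
connected components of `G`. -/
def IsTubing (G : Graph α β) (T : Set (Graph α β)) : Prop :=
  (∀ t ∈ T, G.IsTube t) ∧ T.Pairwise G.TubeCompatible ∧ ¬ {H | G.IsComponent H} ⊆ T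

/-- The number of redundant edges: the minimal number of edges one can remove to get a simple
graph. -/
noncomputable def redundancy (G : Graph α β) : ℕ :=
  sInf {k | ∃ F ⊆ E(G), F.ncard = k ∧ (G.deleteEdges F).Simple}

end Tubings

/-! ### The loop-free pseudograph -/

section LoopFree

variable {α β : Type*}

/-- The loop-free pseudograph `G_m`: the loops at a node `v` become edges between `v` (that is
`Sum.inl v`) and a new node, the ghost node `Sum.inr v`. There is one ghost node for each node
that carries a loop. -/
def loopFree (G : Graph α β) : Graph (α ⊕ α) β where
  vertexSet := Sum.inl '' V(G) ∪ Sum.inr '' {v | ∃ e, G.IsLoopAt e v}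
  edgeSet := E(G)
  IsLink e x y :=
    (∃ u v, u ≠ v ∧ G.IsLink e u v ∧ x = Sum.inl u ∧ y = Sum.inl v) ∨
      ∃ v, G.IsLoopAt e v ∧
        ((x = Sum.inl v ∧ y = Sum.inr v) ∨ (x = Sum.inr v ∧ y = Sum.inl v))
  isLink_symm := by
    intro e _
    constructor
    rintro x y (⟨u, v, h, hl, rfl, rfl⟩ | ⟨v, hl, h⟩)
    · exact Or.inl ⟨v, u, h.symm, hl.symm, rfl, rfl⟩
    · exact Or.inr ⟨v, hl, by tauto⟩
  eq_or_eq_of_isLink_of_isLink := by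
    rintro e x y z w (⟨u, v, h, hl, rfl, rfl⟩ | ⟨v, hl, h⟩)
      (⟨u', v', h', hl', rfl, rfl⟩ | ⟨v', hl', h'⟩)
    · rcases hl.left_eq_or_eq hl' with rfl | rfl <;> simp
    · exact absurd ((hl'.eq_of_inc hl.inc_left).symm.trans (hl'.eq_of_inc hl.inc_right)) h
    · exact absurd ((hl.eq_of_inc hl'.inc_left).symm.trans (hl.eq_of_inc hl'.inc_right)) h'
    · obtain rfl := hl.eq_of_inc hl'.inc
      rcases h with ⟨rfl, rfl⟩ | ⟨rfl, rfl⟩ <;> rcases h' with ⟨rfl, rfl⟩ | ⟨rfl, rfl⟩ <;> simp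
  edge_mem_iff_exists_isLink := by
    intro e
    constructor
    · intro he
      obtain ⟨u, v, h⟩ := exists_isLink_of_mem_edgeSet he
      by_cases huv : u = v
      · subst huv
        exact ⟨_, _, Or.inr ⟨u, h, Or.inl ⟨rfl, rfl⟩⟩⟩
      · exact ⟨_, _, Or.inl ⟨u, v, huv, h, rfl, rfl⟩⟩
    · rintro ⟨x, y, ⟨u, v, _, h, _⟩ | ⟨v, h, _⟩⟩
      · exact h.edge_mem
      · exact h.edge_mem
  left_mem_of_isLink := by
    rintro e x y (⟨u, v, h, hl, rfl, rfl⟩ | ⟨v, hl, ⟨rfl, rfl⟩ | ⟨rfl, rfl⟩⟩)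
    · exact Or.inl ⟨u, hl.left_mem, rfl⟩
    · exact Or.inl ⟨v, hl.vertex_mem, rfl⟩
    · exact Or.inr ⟨v, ⟨e, hl⟩, rfl⟩

/-- The singleton tubes of the ghost nodes of `G.loopFree`. -/
def ghostTubes (G : Graph α β) : Set (Graph (α ⊕ α) β) :=
  {g | ∃ v, (∃ e, G.IsLoopAt e v) ∧ g = noEdge {Sum.inr v} β}

end LoopFree

/-! ### The realization of a loop-free pseudograph `H` -/

section Realization

variable {α β : Type*} (H : Graph α β)

/-- The space `ℝ^{n+k}` with one coordinate for each node and one for each edge of `H`. -/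
abbrev Coords : Type _ := ↥V(H) ⊕ ↥E(H) → ℝ

/-- The bundles of `H`: the classes of non-loop edges with the same pair of endpoints. -/
def bundles : Set (Set β) :=
  {B | ∃ x y, x ≠ y ∧ H.Adj x y ∧ B = {e | H.IsLink e x y}}

/-- `|H - t|`: the number of nodes and edges of `H` that are not in `t`. -/
noncomputable def codeg (t : Graph α β) : ℕ :=
  (V(H) \ V(t)).ncard + (E(H) \ E(t)).ncard

/-- The constant `c = |H|²`, where `|H|` is the number of nodes and edges of `H`. -/
noncomputable def coordConst : ℝ := ((V(H).ncard + E(H).ncard : ℕ) : ℝ) ^ 2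

/-- `Λ(t) = c^{|V(t)|} + ∑ c^{|B ∩ E(t)|} + |H - t|²`, where the sum is over the bundles `B` that
meet `t`. -/
noncomputable def tubeBound (t : Graph α β) : ℝ :=
  H.coordConst ^ V(t).ncard
    + (∑ᶠ B ∈ {B ∈ H.bundles | (B ∩ E(t)).Nonempty}, H.coordConst ^ (B ∩ E(t)).ncard)
    + (H.codeg t : ℝ) ^ 2

/-- The sum of the coordinates of all nodes and edges of the subgraph `t`. -/
noncomputable def tubeSum (t : Graph α β) (p : H.Coords) : ℝ :=
  (∑ᶠ (v : V(H)) (_ : (v : α) ∈ V(t)), p (Sum.inl v))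
    + ∑ᶠ (e : E(H)) (_ : (e : β) ∈ E(t)), p (Sum.inr e)

/-- The number of tubes of `T` that do not contain the edge `e`. -/
noncomputable def avoidCount (T : Set (Graph α β)) (e : β) : ℕ :=
  {t ∈ T | e ∉ E(t)}.ncard

/-- `|H - s|`, where `s` is the largest tube of `T` that contains the edge `e` but not `e'`
(equivalently, the least value of `|H - t|` over all such tubes `t`). -/
noncomputable def gap (T : Set (Graph α β)) (e e' : β) : ℕ :=
  sInf (H.codeg '' {t ∈ T | e ∈ E(t) ∧ e' ∉ E(t)})

/-- The point `p` has the coordinates `f_T` prescribed by the maximal tubing `T`.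
* In each bundle `B` with `b` edges, let `e 1, …, e b` be the edges of `B` in increasing order of
  the number of tubes of `T` that do not contain them; then the coordinates of these edges are
  given by the explicit formulas.
* The coordinates of the nodes are such that the coordinates of the nodes and edges of `t` have
  the sum `Λ(t)`, for each tube `t` in `T` and for `t = H`. -/
def IsVertexPoint (T : Set (Graph α β)) (p : H.Coords) : Prop :=
  (∀ B ∈ H.bundles, ∃ e : ℕ → E(H),
    Set.BijOn (fun j ↦ (e j : β)) (Set.Icc 1 B.ncard) B ∧
    StrictMonoOn (fun j ↦ avoidCount T (e j : β)) (Set.Icc 1 B.ncard) ∧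
    p (Sum.inr (e 1)) = H.coordConst +
      ∑ k ∈ Finset.Ico 1 B.ncard, (2 * (H.gap T (e k) (e (k + 1)) : ℝ) - 1) ∧
    ∀ j ∈ Finset.Icc 2 B.ncard, p (Sum.inr (e j)) =
      H.coordConst ^ (j - 1) * (H.coordConst - 1)
        - (2 * (H.gap T (e (j - 1)) (e j) : ℝ) - 1)) ∧
  (∀ t ∈ T, H.tubeSum t p = H.tubeBound t) ∧ H.tubeSum H p = H.tubeBound H

/-- The convex hull of the points `f_T`, for all maximal tubings `T` of `H`. -/
def hullRealization : Set H.Coords :=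
  convexHull ℝ {p | ∃ T, Maximal H.IsTubing T ∧ H.IsVertexPoint T p}

/-- The polyhedron cut out, in the affine subspace given by the equations `h_V` and `h_B` (one for
each bundle `B`), by the halfspaces `h_t⁺ : ∑_{x ∈ t} p(x) ≥ Λ(t)` of the tubes `t` in `S`. -/
def region (S : Set (Graph α β)) : Set H.Coords :=
  {p | (∑ᶠ v : V(H), p (Sum.inl v)) = H.coordConst ^ V(H).ncard ∧
    (∀ B ∈ H.bundles,
      (∑ᶠ (e : E(H)) (_ : (e : β) ∈ B), p (Sum.inr e)) = H.coordConst ^ B.ncard) ∧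
    ∀ t ∈ S, H.tubeBound t ≤ H.tubeSum t p}

/-- The part of `P` on the hyperplanes `h_t : ∑_{x ∈ t} p(x) = Λ(t)`, for all `t` in `U`. -/
def tubingFace (P : Set H.Coords) (U : Set (Graph α β)) : Set H.Coords :=
  {p ∈ P | ∀ t ∈ U, H.tubeSum t p = H.tubeBound t}

end Realization

/-- `P` is a realization of the pseudograph associahedron of `G`, where the tubing `T` corresponds
to the face `face T`: this is an isomorphism from the tubings of `G`, ordered by reverse
containment, to the nonempty faces of `P`, the dimension of `P` is `n - 1 + r` for `n` nodes
and `r` redundant edges, and the tubings with `k` tubes correspond to the faces of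
codimension `k`. -/
structure IsRealization {α β ι : Type*} (G : Graph α β) (P : Set (ι → ℝ))
    (face : Set (Graph α β) → Set (ι → ℝ)) : Prop where
  isFace : ∀ T, G.IsTubing T → IsExposed ℝ P (face T) ∧ (face T).Nonempty
  surj : ∀ F, IsExposed ℝ P F → F.Nonempty → ∃ T, G.IsTubing T ∧ face T = F
  le_iff : ∀ T U, G.IsTubing T → G.IsTubing U → (face T ⊆ face U ↔ U ⊆ T)
  dim : ∀ T, G.IsTubing T →
    Module.finrank ℝ (vectorSpan ℝ (face T)) + T.ncard + 1 = V(G).ncard + G.redundancy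

end Graph

set_option linter.unusedSectionVars false

/-! The loop-free graph is encoded as a `BundledGraph`, whose tubes are finite sets of nodes and
edges. For a set `D` of nodes, `region D` is the polyhedron in which the halfspaces of the
singletons of nodes of `D` are left out: the empty `D` gives the hull realization, the set of ghost
nodes gives the cone. Both cases rest on the same two facts: the tubes that are tight at a point of
the region are pairwise compatible, and every tubing made of kept tubes is exactly the set of tight
tubes of some point. They turn the faces into tubings and inclusion of faces into reverse inclusion
of tubings.

For the first fact (`compat_of_tight`), a tight tube has node and strand sums that exceed the
corresponding powers of `c` by less than `c`. If two tight tubes that meet or are joined by an edge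
had crossing node sets or crossing strands, the sum over the union would be smaller than the next
power of `c`, against its lower bound. If everything is nested, intersection and union are tubes or
the whole graph, and the square term makes the bounds strictly supermodular (`bound_add_bound_lt`),
so both tubes cannot be tight. Omitting the singletons of nodes with at most one neighbour, such as
ghost nodes, does not disturb this.

For the second fact, let `M` be a maximal tubing. Its tube sums, together with the total node sum
and the bundle sums, form a basis of the dual space: they determine a vector
(`eq_zero_of_sums_eq_zero`), and there are not too many of them (`ncard_insert_univ_add_card_le`).
So `M` has a unique vertex, and the dimension of a face is given by rank-nullity. At this vertex all
other inequalities are strict (`IsVertex.bound_lt_sum`): either a power of `c` dominates, or an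
induction on the number of incompatible tubes applies, using supermodularity again. Moving slightly
off the tubes of `M` outside a tubing `U` makes exactly `U` tight (`exists_tight_eq`).

With all halfspaces present the region is compact and its extreme points are these vertices, so it
is their convex hull. Their edge coordinates are the explicit ones (`isVertex_iff`), because erasing
an edge that is not first in its bundle from its least tube gives another tube of `M`.

The tubes of `G` correspond under `loopFree` to the tubes of the loop-free graph other than ghost
singletons (`exists_loopFree_eq`). Each ghost node adds one node and one bundle, which cancel in the
dimension count. Without the ghost halfspaces, weight can be shifted from a ghost node to its
neighbour forever, so the cone is unbounded. -/

/-- The incidence data of a finite loopless pseudograph: every edge lies in a bundle, and every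
bundle has a pair of end nodes. -/
structure BundledGraph (V E K : Type*) where
  /-- the bundle of an edge -/
  bundle : E → K
  /-- the two end nodes of a bundle -/
  ends : K → Finset V
  exists_ends : ∀ k, ∃ x y, x ≠ y ∧ ∀ z, z ∈ ends k ↔ z = x ∨ z = y

namespace BundledGraph

open Finset

/-! ### Connected node sets, described by cuts -/

section Connectivity

variable {V E K : Type*} (Γ : BundledGraph V E K)

/-- Two distinct nodes are adjacent if they are the ends of a bundle. -/
def Adj (x y : V) : Prop := x ≠ y ∧ ∃ k, x ∈ Γ.ends k ∧ y ∈ Γ.ends k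

/-- A set of nodes is connected if it is nonempty and every proper cut is crossed. -/
def ConnSet (A : Finset V) : Prop :=
  A.Nonempty ∧ ∀ S ⊆ A, S.Nonempty → S ≠ A → ∃ x ∈ S, ∃ y ∈ A, y ∉ S ∧ Γ.Adj x y

variable {Γ}

lemma Adj.symm {x y : V} (h : Γ.Adj x y) : Γ.Adj y x :=
  ⟨h.1.symm, h.2.imp fun _ hk ↦ hk.symm⟩

lemma ends_subset {k : K} {x y : V} {A : Finset V} (hxy : x ≠ y) (hx : x ∈ Γ.ends k)
    (hy : y ∈ Γ.ends k) (hxA : x ∈ A) (hyA : y ∈ A) : Γ.ends k ⊆ A := by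
  obtain ⟨a, b, hab, h⟩ := Γ.exists_ends k
  rw [h] at hx hy
  intro z hz
  rw [h] at hz
  rcases hx with rfl | rfl <;> rcases hy with rfl | rfl <;> rcases hz with rfl | rfl <;>
    first | exact hxA | exact hyA | exact absurd rfl hxy

lemma exists_adj_ends (k : K) : ∃ x y, x ∈ Γ.ends k ∧ y ∈ Γ.ends k ∧ Γ.Adj x y := by
  obtain ⟨a, b, hab, h⟩ := Γ.exists_ends k
  have ha : a ∈ Γ.ends k := (h a).2 (Or.inl rfl)
  have hb : b ∈ Γ.ends k := (h b).2 (Or.inr rfl)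
  exact ⟨a, b, ha, hb, hab, k, ha, hb⟩

lemma connSet_singleton (v : V) : Γ.ConnSet {v} := by
  refine ⟨singleton_nonempty v, fun S hS hne hS' ↦ ?_⟩
  rcases subset_singleton_iff.1 hS with rfl | rfl
  · simp at hne
  · exact absurd rfl hS'

lemma ConnSet.union [DecidableEq V] {A B : Finset V} (hA : Γ.ConnSet A) (hB : Γ.ConnSet B)
    {x y : V} (hx : x ∈ A) (hy : y ∈ B) (hxy : x = y ∨ Γ.Adj x y) : Γ.ConnSet (A ∪ B) := by
  refine ⟨hA.1.mono subset_union_left, fun S hS hne hS' ↦ ?_⟩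
  by_cases h1 : (S ∩ A).Nonempty ∧ S ∩ A ≠ A
  · obtain ⟨a, ha, b, hb, hbS, hab⟩ := hA.2 _ inter_subset_right h1.1 h1.2
    rw [mem_inter] at ha hbS
    exact ⟨a, ha.1, b, mem_union_left _ hb, fun h ↦ hbS ⟨h, hb⟩, hab⟩
  by_cases h2 : (S ∩ B).Nonempty ∧ S ∩ B ≠ B
  · obtain ⟨a, ha, b, hb, hbS, hab⟩ := hB.2 _ inter_subset_right h2.1 h2.2
    rw [mem_inter] at ha hbS
    exact ⟨a, ha.1, b, mem_union_right _ hb, fun h ↦ hbS ⟨h, hb⟩, hab⟩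
  have key : ∀ C : Finset V, ¬((S ∩ C).Nonempty ∧ S ∩ C ≠ C) →
      (∀ z ∈ C, z ∉ S) ∨ C ⊆ S := by
    intro C h
    by_cases hC : (S ∩ C).Nonempty
    · right
      rw [← inter_eq_right]
      by_contra h'
      exact h ⟨hC, h'⟩
    · left
      intro z hz hzS
      exact hC ⟨z, mem_inter.2 ⟨hzS, hz⟩⟩
  rcases key A h1 with hAS | hAS <;> rcases key B h2 with hBS | hBS
  · obtain ⟨z, hz⟩ := hne
    rcases mem_union.1 (hS hz) with h | h
    · exact absurd hz (hAS z h)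
    · exact absurd hz (hBS z h)
  · rcases hxy with rfl | hxy
    · exact absurd (hBS hy) (hAS x hx)
    · exact ⟨y, hBS hy, x, mem_union_left _ hx, hAS x hx, hxy.symm⟩
  · rcases hxy with rfl | hxy
    · exact absurd (hAS hx) (hBS x hy)
    · exact ⟨x, hAS hx, y, mem_union_right _ hy, hBS y hy, hxy⟩
  · exact absurd (subset_antisymm hS (union_subset hAS hBS)) hS'

/-- A connected subset of `D` through `w` of greatest size works: a neighbour in `D` outside it
could be added. -/
lemma exists_component [DecidableEq V] (D : Finset V) {w : V} (hw : w ∈ D) :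
    ∃ C ⊆ D, w ∈ C ∧ Γ.ConnSet C ∧ ∀ x ∈ C, ∀ y ∈ D, Γ.Adj x y → y ∈ C := by
  classical
  obtain ⟨C, hC, hmax⟩ := (D.powerset.filter fun C ↦ w ∈ C ∧ Γ.ConnSet C).exists_max_image card
    ⟨{w}, by simp [hw, connSet_singleton]⟩
  simp only [mem_filter, mem_powerset] at hC hmax
  refine ⟨C, hC.1, hC.2.1, hC.2.2, fun x hx y hy hxy ↦ ?_⟩
  by_contra hyC
  have h1 := hC.2.2.union (connSet_singleton y) hx (mem_singleton_self y) (Or.inr hxy)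
  have h2 := hmax (C ∪ {y}) ⟨union_subset hC.1 (by simpa using hy), mem_union_left _ hC.2.1, h1⟩
  rw [card_union_of_disjoint (by simpa using hyC), card_singleton] at h2
  omega

lemma ConnSet.subset_of_closed [DecidableEq V] {A C D : Finset V} (hA : Γ.ConnSet A) (hAD : A ⊆ D)
    (hC : ∀ x ∈ C, ∀ y ∈ D, Γ.Adj x y → y ∈ C) {z : V} (hzA : z ∈ A) (hzC : z ∈ C) : A ⊆ C := by
  rw [← inter_eq_left]
  by_contra h
  obtain ⟨x, hx, y, hy, hyS, hxy⟩ := hA.2 (A ∩ C) inter_subset_left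
    ⟨z, mem_inter.2 ⟨hzA, hzC⟩⟩ h
  exact hyS (mem_inter.2 ⟨hy, hC x (mem_inter.1 hx).2 y (hAD hy) hxy⟩)

end Connectivity

/-! ### Tubes and tubings as families of finite sets -/

section Tubes

variable {V E K : Type*} (Γ : BundledGraph V E K)

/-- A piece is a connected set of nodes and edges that contains the ends of its edges, and an edge
of each bundle that joins two of its nodes. -/
structure IsPiece (t : Finset (V ⊕ E)) : Prop where
  conn : Γ.ConnSet t.toLeft
  ends_subset : ∀ e, Sum.inr e ∈ t → Γ.ends (Γ.bundle e) ⊆ t.toLeft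
  exists_edge : ∀ k, Γ.ends k ⊆ t.toLeft → ∃ e, Γ.bundle e = k ∧ Sum.inr e ∈ t

/-- A tube is a proper piece. -/
def IsTube [Fintype V] [Fintype E] (t : Finset (V ⊕ E)) : Prop := Γ.IsPiece t ∧ t ≠ univ

/-- Two sets of nodes and edges are far if they share no node and no edge joins them. -/
def Far (s t : Finset (V ⊕ E)) : Prop :=
  ∀ x y, Sum.inl x ∈ s → Sum.inl y ∈ t → x ≠ y ∧ ¬ Γ.Adj x y

/-- Compatibility of tubes. -/
def Compat (s t : Finset (V ⊕ E)) : Prop := s ⊂ t ∨ t ⊂ s ∨ Γ.Far s t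

/-- A tubing is a set of pairwise compatible tubes. -/
def IsTubing [Fintype V] [Fintype E] (T : Set (Finset (V ⊕ E))) : Prop :=
  (∀ t ∈ T, Γ.IsTube t) ∧ T.Pairwise Γ.Compat

variable {Γ}

lemma Far.symm {s t : Finset (V ⊕ E)} (h : Γ.Far s t) : Γ.Far t s :=
  fun x y hx hy ↦ ⟨(h y x hy hx).1.symm, fun ha ↦ (h y x hy hx).2 ha.symm⟩

lemma Compat.symm {s t : Finset (V ⊕ E)} (h : Γ.Compat s t) : Γ.Compat t s := by
  rcases h with h | h | h
  · exact Or.inr (Or.inl h)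
  · exact Or.inl h
  · exact Or.inr (Or.inr h.symm)

lemma compat_of_subset {s t : Finset (V ⊕ E)} (h : s ⊆ t) : s = t ∨ Γ.Compat s t := by
  by_cases hst : s = t
  · exact Or.inl hst
  · exact Or.inr (Or.inl (h.ssubset_of_ne hst))

lemma IsPiece.nonempty {t : Finset (V ⊕ E)} (h : Γ.IsPiece t) : ∃ v, Sum.inl v ∈ t := by
  obtain ⟨v, hv⟩ := h.conn.1
  exact ⟨v, mem_toLeft.1 hv⟩

lemma Compat.nested {s t : Finset (V ⊕ E)} (h : Γ.Compat s t) {x y : V} (hx : Sum.inl x ∈ s)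
    (hy : Sum.inl y ∈ t) (hxy : x = y ∨ Γ.Adj x y) : s ⊆ t ∨ t ⊆ s := by
  rcases h with h | h | h
  · exact Or.inl h.subset
  · exact Or.inr h.subset
  · exact absurd hxy (not_or.2 (h x y hx hy))

lemma IsTubing.exists_maximal [Fintype V] [Fintype E] {U : Set (Finset (V ⊕ E))}
    (h : Γ.IsTubing U) : ∃ M, U ⊆ M ∧ Maximal Γ.IsTubing M := by
  obtain ⟨M, hUM, hM⟩ := (Set.toFinite {T | Γ.IsTubing T}).exists_le_maximal h
  exact ⟨M, hUM, hM⟩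

end Tubes

/-! ### The least tube through a node or an edge -/

section MaximalTubing

variable {V E K : Type*} {Γ : BundledGraph V E K} [Fintype V] [Fintype E]
  {M : Set (Finset (V ⊕ E))}

/-- Maximality in the form in which it is used. The whole graph is adjoined because a piece need not
be proper, and it then serves as a largest member. -/
lemma mem_insert_univ_of_compat (hM : Maximal Γ.IsTubing M) {t : Finset (V ⊕ E)}
    (ht : Γ.IsPiece t) (h : ∀ s ∈ M, t = s ∨ Γ.Compat t s) : t ∈ insert univ M := by
  by_cases hu : t = univ
  · exact Or.inl hu
  right
  refine hM.mem_of_prop_insert ⟨?_, ?_⟩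
  · rintro s (rfl | hs)
    · exact ⟨ht, hu⟩
    · exact hM.prop.1 s hs
  · rw [Set.pairwise_insert]
    refine ⟨hM.prop.2, fun s hs hne ↦ ?_⟩
    have := (h s hs).resolve_left hne
    exact ⟨this, this.symm⟩

lemma isPiece_of_mem (hΓ : Γ.IsPiece univ) (hM : Γ.IsTubing M)
    {t : Finset (V ⊕ E)} (ht : t ∈ insert univ M) : Γ.IsPiece t := by
  rcases ht with rfl | ht
  · exact hΓ
  · exact (hM.1 t ht).1

lemma compat_of_mem (hM : Γ.IsTubing M) {s t : Finset (V ⊕ E)} (hs : s ∈ insert univ M)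
    (ht : t ∈ insert univ M) : s = t ∨ Γ.Compat s t := by
  rcases ht with rfl | ht
  · exact compat_of_subset (subset_univ s)
  rcases hs with rfl | hs
  · exact (compat_of_subset (Γ := Γ) (subset_univ t)).imp Eq.symm Compat.symm
  by_cases h : s = t
  · exact Or.inl h
  · exact Or.inr (hM.2 hs ht h)

lemma nested_of_adj (hM : Γ.IsTubing M) {s t : Finset (V ⊕ E)} (hs : s ∈ insert univ M)
    (ht : t ∈ insert univ M) {x y : V} (hx : Sum.inl x ∈ s)
    (hy : Sum.inl y ∈ t) (hxy : x = y ∨ Γ.Adj x y) : s ⊆ t ∨ t ⊆ s := by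
  rcases compat_of_mem hM hs ht with rfl | h
  · exact Or.inl subset_rfl
  · exact h.nested hx hy hxy

lemma nested_of_mem (hΓ : Γ.IsPiece univ) (hM : Γ.IsTubing M)
    {s t : Finset (V ⊕ E)} (hs : s ∈ insert univ M)
    (ht : t ∈ insert univ M) {x : V ⊕ E} (hx : x ∈ s) (hy : x ∈ t) : s ⊆ t ∨ t ⊆ s := by
  rcases x with v | e
  · exact nested_of_adj hM hs ht hx hy (Or.inl rfl)
  · obtain ⟨x, y, hxk, -, -⟩ := Γ.exists_adj_ends (Γ.bundle e)
    exact nested_of_adj hM hs ht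
      (mem_toLeft.1 ((isPiece_of_mem hΓ hM hs).ends_subset e hx hxk))
      (mem_toLeft.1 ((isPiece_of_mem hΓ hM ht).ends_subset e hy hxk)) (Or.inl rfl)

/-- Parallel edges have the same ends, so the two members share a node and cannot be far. -/
lemma nested_of_bundle_eq (hΓ : Γ.IsPiece univ) (hM : Γ.IsTubing M)
    {s t : Finset (V ⊕ E)} (hs : s ∈ insert univ M)
    (ht : t ∈ insert univ M) {e e' : E} (he : Sum.inr e ∈ s) (he' : Sum.inr e' ∈ t)
    (h : Γ.bundle e = Γ.bundle e') : s ⊆ t ∨ t ⊆ s := by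
  obtain ⟨x, y, hxk, -, -⟩ := Γ.exists_adj_ends (Γ.bundle e)
  exact nested_of_adj hM hs ht
    (mem_toLeft.1 ((isPiece_of_mem hΓ hM hs).ends_subset e he hxk))
    (mem_toLeft.1 ((isPiece_of_mem hΓ hM ht).ends_subset e' he' (h ▸ hxk))) (Or.inl rfl)

open Classical in
/-- The least element of `insert univ M` that contains `x`. -/
noncomputable def least (M : Set (Finset (V ⊕ E))) (x : V ⊕ E) : Finset (V ⊕ E) :=
  univ.filter fun y ↦ ∀ t ∈ insert univ M, x ∈ t → y ∈ t

lemma mem_least (x : V ⊕ E) : x ∈ least M x := by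
  simp [least]

lemma least_subset {x : V ⊕ E} {t : Finset (V ⊕ E)} (ht : t ∈ insert univ M) (hx : x ∈ t) :
    least M x ⊆ t := by
  intro y hy
  simp only [least, mem_filter] at hy
  exact hy.2 t ht hx

/-- The members through `x` form a chain, so their intersection is the smallest of them. -/
lemma least_mem (hΓ : Γ.IsPiece univ) (hM : Γ.IsTubing M) (x : V ⊕ E) :
    least M x ∈ insert univ M := by
  classical
  obtain ⟨s, hs, hmin⟩ := Set.exists_min_image {t ∈ insert univ M | x ∈ t} card
    (Set.toFinite _) ⟨univ, Or.inl rfl, mem_univ x⟩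
  have : least M x = s := by
    refine subset_antisymm (least_subset hs.1 hs.2) fun y hy ↦ ?_
    simp only [least, mem_filter, mem_univ, true_and]
    intro t ht hxt
    rcases nested_of_mem hΓ hM hs.1 ht hs.2 hxt with h | h
    · exact h hy
    · rw [eq_of_subset_of_card_le h (hmin t ⟨ht, hxt⟩)]
      exact hy
  rw [this]
  exact hs.1

end MaximalTubing

end BundledGraph

namespace BundledGraph

open Finset

/-! ### Members of a maximal tubing as least tubes -/

section MaximalStructure

variable {V E K : Type*} {Γ : BundledGraph V E K} [Fintype V] [Fintype E] [DecidableEq V]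
  [DecidableEq E] {M : Set (Finset (V ⊕ E))}

/-- Suppose σ is the least tube of both nodes. Delete `v` from σ and take the component of `w`, with
all edges of σ inside it. Every smaller tube meeting σ avoids `v`, hence lies in this component or
is far from it; so the component belongs to the maximal tubing and separates `w` from `v`. -/
lemma least_inl_ne (hΓ : Γ.IsPiece univ) (hM : Maximal Γ.IsTubing M) {v w : V} (hvw : v ≠ w) :
    least M (Sum.inl v) ≠ least M (Sum.inl w) := by
  classical
  intro heq
  have hσ := least_mem hΓ hM.prop (Sum.inl v)
  have hvσ : Sum.inl v ∈ least M (Sum.inl v) := mem_least _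
  have hwσ : Sum.inl w ∈ least M (Sum.inl v) := heq ▸ mem_least _
  have hmin : ∀ s ∈ insert univ M, Sum.inl w ∈ s → least M (Sum.inl v) ⊆ s :=
    fun s hs hws ↦ heq ▸ least_subset hs hws
  have hmin' : ∀ s ∈ insert univ M, Sum.inl v ∈ s → least M (Sum.inl v) ⊆ s :=
    fun s hs hvs ↦ least_subset hs hvs
  generalize least M (Sum.inl v) = σ at *
  have hσp := isPiece_of_mem hΓ hM.prop hσ
  obtain ⟨C, hCD, hwC, hC, hcl⟩ := Γ.exists_component (σ.toLeft.erase v)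
    (mem_erase.2 ⟨hvw.symm, mem_toLeft.2 hwσ⟩)
  have hCσ : C ⊆ σ.toLeft := hCD.trans (erase_subset _ _)
  have hvC : v ∉ C := fun h ↦ (mem_erase.1 (hCD h)).1 rfl
  -- Keeping all edges of σ between nodes of `C` ensures that every smaller tube with nodes in `C`
  -- is contained in `t`.
  set t := C.disjSum (σ.toRight.filter fun e ↦ Γ.ends (Γ.bundle e) ⊆ C) with ht
  have htσ : t ⊆ σ := disjSum_subset.2 ⟨hCσ, filter_subset _ _⟩
  have htp : Γ.IsPiece t := by
    refine ⟨by rwa [ht, toLeft_disjSum], fun e he ↦ ?_, fun k hk ↦ ?_⟩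
    · rw [ht, inr_mem_disjSum, mem_filter] at he
      rw [ht, toLeft_disjSum]
      exact he.2
    · rw [ht, toLeft_disjSum] at hk
      obtain ⟨e, rfl, he⟩ := hσp.exists_edge k (hk.trans hCσ)
      exact ⟨e, rfl, by rw [ht, inr_mem_disjSum, mem_filter]; exact ⟨mem_toRight.2 he, hk⟩⟩
  have htM : t ∈ insert univ M := by
    refine mem_insert_univ_of_compat hM htp fun s hs ↦ ?_
    have hs' : s ∈ insert univ M := Or.inr hs
    have hsp := isPiece_of_mem hΓ hM.prop hs'
    have hcase : σ ⊆ s ∨ s ⊂ σ ∨ Γ.Far σ s := by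
      rcases compat_of_mem hM.prop hσ hs' with rfl | h | h | h
      · exact Or.inl subset_rfl
      · exact Or.inl h.subset
      · exact Or.inr (Or.inl h)
      · exact Or.inr (Or.inr h)
    rcases hcase with h | h | h
    · exact compat_of_subset (htσ.trans h)
    · have hvs : Sum.inl v ∉ s := fun hvs ↦ h.not_subset (hmin' s hs' hvs)
      have hsD : s.toLeft ⊆ σ.toLeft.erase v := by
        intro x hx
        refine mem_erase.2 ⟨?_, toLeft_subset_toLeft h.subset hx⟩
        rintro rfl
        exact hvs (mem_toLeft.1 hx)
      by_cases hz : ∃ z ∈ s.toLeft, z ∈ C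
      · obtain ⟨z, hzs, hzC⟩ := hz
        have hsC := hsp.conn.subset_of_closed hsD hcl hzs hzC
        have hst : s ⊆ t := subset_disjSum.2 ⟨hsC, fun e he ↦ mem_filter.2
          ⟨toRight_subset_toRight h.subset he,
            (hsp.ends_subset e (mem_toRight.1 he)).trans hsC⟩⟩
        exact (compat_of_subset (Γ := Γ) hst).imp Eq.symm Compat.symm
      · right; right; right
        intro x y hx hy
        rw [ht, inl_mem_disjSum] at hx
        refine ⟨?_, fun hxy ↦ ?_⟩
        · rintro rfl
          exact hz ⟨x, mem_toLeft.2 hy, hx⟩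
        · exact hz ⟨y, mem_toLeft.2 hy, hcl x hx y (hsD (mem_toLeft.2 hy)) hxy⟩
    · right; right; right
      exact fun x y hx hy ↦ h x y (htσ hx) hy
  have := hmin t htM (by rw [ht, inl_mem_disjSum]; exact hwC) hvσ
  rw [ht, inl_mem_disjSum] at this
  exact hvC this

/-- The parallel edge `e'` still represents the bundle after `e` is erased, so a piece remains. It
is compatible with every tube, since a tube strictly inside the least tube of `e` misses `e`.
Maximality puts it into `M`. -/
lemma erase_least_mem (hΓ : Γ.IsPiece univ) (hM : Maximal Γ.IsTubing M) {e e' : E} (hne : e' ≠ e)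
    (hb : Γ.bundle e' = Γ.bundle e) (he' : Sum.inr e' ∈ least M (Sum.inr e)) :
    (least M (Sum.inr e)).erase (Sum.inr e) ∈ M := by
  have hσ := least_mem hΓ hM.prop (Sum.inr e)
  have hmin : ∀ s ∈ insert univ M, Sum.inr e ∈ s → least M (Sum.inr e) ⊆ s :=
    fun s hs hvs ↦ least_subset hs hvs
  generalize least M (Sum.inr e) = σ at *
  have hσp := isPiece_of_mem hΓ hM.prop hσ
  have hleft : (σ.erase (Sum.inr e)).toLeft = σ.toLeft := by
    ext x; simp
  have htp : Γ.IsPiece (σ.erase (Sum.inr e)) := by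
    refine ⟨hleft ▸ hσp.conn, fun f hf ↦ ?_, fun k hk ↦ ?_⟩
    · rw [hleft]
      exact hσp.ends_subset f (mem_of_mem_erase hf)
    · rw [hleft] at hk
      obtain ⟨f, rfl, hf⟩ := hσp.exists_edge k hk
      by_cases hfe : f = e
      · subst hfe
        exact ⟨e', hb, mem_erase.2 ⟨by simpa using hne, he'⟩⟩
      · exact ⟨f, rfl, mem_erase.2 ⟨by simpa using hfe, hf⟩⟩
  have htM := mem_insert_univ_of_compat hM htp fun s hs ↦ ?_
  · refine htM.resolve_left fun h ↦ ?_
    have := mem_univ (Sum.inr e : V ⊕ E)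
    rw [← h] at this
    exact notMem_erase _ _ this
  · have hs' : s ∈ insert univ M := Or.inr hs
    have hcase : σ ⊆ s ∨ s ⊂ σ ∨ Γ.Far σ s := by
      rcases compat_of_mem hM.prop hσ hs' with rfl | h | h | h
      · exact Or.inl subset_rfl
      · exact Or.inl h.subset
      · exact Or.inr (Or.inl h)
      · exact Or.inr (Or.inr h)
    rcases hcase with h | h | h
    · exact compat_of_subset ((erase_subset _ _).trans h)
    · have hes : Sum.inr e ∉ s := fun hes ↦ h.not_subset (hmin s hs' hes)
      exact (compat_of_subset (Γ := Γ) (subset_erase.2 ⟨h.subset, hes⟩)).imp Eq.symm Compat.symm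
    · right; right; right
      exact fun x y hx hy ↦ h x y (mem_of_mem_erase hx) hy

lemma least_inr_ne (hΓ : Γ.IsPiece univ) (hM : Maximal Γ.IsTubing M) {e e' : E} (hne : e' ≠ e)
    (hb : Γ.bundle e' = Γ.bundle e) : least M (Sum.inr e') ≠ least M (Sum.inr e) := by
  intro h
  have he' : Sum.inr e' ∈ least M (Sum.inr e) := h ▸ mem_least _
  have h1 := erase_least_mem hΓ hM hne hb he'
  have h2 := least_subset (Or.inr h1) (mem_erase.2 ⟨by simpa using hne, he'⟩)
  rw [h] at h2
  exact notMem_erase _ _ (h2 (mem_least (M := M) (Sum.inr e)))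

variable (Γ M) in
/-- An edge is first in its bundle if no other edge of the bundle lies in each tube that contains
it. -/
def IsFirst (e : E) : Prop :=
  ∀ e', Γ.bundle e' = Γ.bundle e → Sum.inr e' ∈ least M (Sum.inr e) → e' = e

lemma erase_least_mem_of_not_isFirst (hΓ : Γ.IsPiece univ) (hM : Maximal Γ.IsTubing M) {e : E}
    (h : ¬ Γ.IsFirst M e) : (least M (Sum.inr e)).erase (Sum.inr e) ∈ M := by
  simp only [IsFirst, not_forall] at h
  obtain ⟨e', hb, he', hne⟩ := h
  exact erase_least_mem hΓ hM hne hb he'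

/-- Take the edge of the bundle whose least tube is smallest; least tubes of distinct parallel edges
differ. -/
lemma exists_isFirst (hΓ : Γ.IsPiece univ) (hM : Maximal Γ.IsTubing M) (k : K) :
    ∃ e, Γ.bundle e = k ∧ Γ.IsFirst M e := by
  classical
  obtain ⟨e, he, hmin⟩ := (univ.filter fun e ↦ Γ.bundle e = k).exists_min_image
    (fun e ↦ #(least M (Sum.inr e))) (by
      obtain ⟨e, he, -⟩ := hΓ.exists_edge k (fun x _ ↦ by simp)
      exact ⟨e, by simpa using he⟩)
  simp only [mem_filter, mem_univ, true_and] at he hmin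
  refine ⟨e, he, fun e' hb he' ↦ ?_⟩
  by_contra hne
  have h1 := least_subset (least_mem hΓ hM.prop _) he'
  exact least_inr_ne hΓ hM hne hb (eq_of_subset_of_card_le h1 (hmin e' (hb.trans he)))

lemma IsFirst.eq (hΓ : Γ.IsPiece univ) (hM : Γ.IsTubing M) {e e' : E} (h : Γ.IsFirst M e)
    (h' : Γ.IsFirst M e') (hb : Γ.bundle e = Γ.bundle e') : e = e' := by
  rcases nested_of_bundle_eq hΓ hM (least_mem hΓ hM (Sum.inr e)) (least_mem hΓ hM (Sum.inr e'))
    (mem_least _) (mem_least _) hb with hs | hs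
  · exact h' e hb (hs (mem_least _))
  · exact (h e' hb.symm (hs (mem_least _))).symm

/-- A vector is determined by its sums over the tubes of a maximal tubing and over the bundles. -/
lemma eq_zero_of_sums_eq_zero [DecidableEq K] (hΓ : Γ.IsPiece univ) (hM : Maximal Γ.IsTubing M)
    {d : V ⊕ E → ℝ} (ht : ∀ t ∈ insert univ M, ∑ x ∈ t, d x = 0)
    (hk : ∀ k, ∑ e with Γ.bundle e = k, d (Sum.inr e) = 0) : d = 0 := by
  -- The coordinate of a non-first edge is the difference of the sums over two members of `insert
  -- univ M`.
  have h1 : ∀ e, ¬ Γ.IsFirst M e → d (Sum.inr e) = 0 := by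
    intro e he
    have h2 := ht _ (Or.inr (erase_least_mem_of_not_isFirst hΓ hM he))
    have h3 := ht _ (least_mem hΓ hM.prop (Sum.inr e))
    rw [← add_sum_erase _ _ (mem_least (M := M) (Sum.inr e)), h2, add_zero] at h3
    exact h3
  have h2 : ∀ e, d (Sum.inr e) = 0 := by
    intro e
    by_cases he : Γ.IsFirst M e
    · rw [← hk (Γ.bundle e)]
      refine (sum_eq_single e (fun e' he' hne ↦ h1 e' fun h ↦ ?_) (fun h ↦ ?_)).symm
      · simp only [mem_filter, mem_univ, true_and] at he'
        exact hne (h.eq hΓ hM.prop he he')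
      · simp at h
    · exact h1 e he
  -- In the least tube of `v`, all other nodes have strictly smaller least tubes, so the system is
  -- triangular on the nodes.
  have h3 : ∀ n v, #(least M (Sum.inl v)) = n → d (Sum.inl v) = 0 := by
    intro n
    induction n using Nat.strong_induction_on with
    | _ n ih =>
      rintro v rfl
      rw [← ht _ (least_mem hΓ hM.prop (Sum.inl v))]
      refine (sum_eq_single (Sum.inl v) ?_ (fun h ↦ absurd (mem_least _) h)).symm
      rintro (w | e) hw hne
      · have hwv : w ≠ v := fun h ↦ hne (by rw [h])
        exact ih _ (card_lt_card ((least_subset (least_mem hΓ hM.prop _) hw).ssubset_of_ne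
          (least_inl_ne hΓ hM hwv))) w rfl
      · exact h2 e
  ext x
  rcases x with v | e
  · exact h3 _ v rfl
  · exact h2 e

/-- Otherwise take a largest member `r` strictly inside `t`. If `r` missed a node of `t`, the least
tube of a missing node adjacent to `r` would lie strictly between them. So `r` has all nodes of `t`.
For a missing edge, a parallel edge in `r` shows that it is not first, and its least tube again lies
strictly between. -/
lemma exists_least_eq (hΓ : Γ.IsPiece univ) (hM : Maximal Γ.IsTubing M) {t : Finset (V ⊕ E)}
    (ht : t ∈ insert univ M) :
    (∃ v, least M (Sum.inl v) = t) ∨ ∃ e, ¬ Γ.IsFirst M e ∧ least M (Sum.inr e) = t := by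
  by_contra! hcon
  obtain ⟨h1, h2⟩ := hcon
  have htp := isPiece_of_mem hΓ hM.prop ht
  have hlt : ∀ x ∈ t, least M x ≠ t → least M x ⊂ t :=
    fun x hx hne ↦ (least_subset ht hx).ssubset_of_ne hne
  obtain ⟨v, hv⟩ := htp.nonempty
  obtain ⟨r, hr, hmax⟩ := Set.exists_max_image {s ∈ insert univ M | s ⊂ t} card (Set.toFinite _)
    ⟨_, least_mem hΓ hM.prop _, hlt _ hv (h1 v)⟩
  have hmax' : ∀ s ∈ insert univ M, s ⊂ t → ¬ r ⊂ s := fun s hs hst hrs ↦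
    (card_lt_card hrs).not_ge (hmax s ⟨hs, hst⟩)
  have hrp := isPiece_of_mem hΓ hM.prop hr.1
  have hrt : r.toLeft = t.toLeft := by
    by_contra hne
    obtain ⟨x, hx, y, hy, hyr, hxy⟩ := htp.conn.2 r.toLeft (toLeft_subset_toLeft hr.2.subset)
      hrp.conn.1 hne
    rw [mem_toLeft] at hx hy hyr
    have hσ := least_mem hΓ hM.prop (Sum.inl y)
    rcases nested_of_adj hM.prop hr.1 hσ hx (mem_least _) (Or.inr hxy) with h | h
    · exact hmax' _ hσ (hlt _ hy (h1 y)) (h.ssubset_of_ne fun h' ↦ hyr (h' ▸ mem_least _))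
    · exact hyr (h (mem_least _))
  obtain ⟨x, hxt, hxr⟩ := exists_of_ssubset hr.2
  rcases x with x | e
  · exact hxr (mem_toLeft.1 (hrt ▸ mem_toLeft.2 hxt))
  · obtain ⟨f, hf, hfr⟩ := hrp.exists_edge (Γ.bundle e) (hrt ▸ htp.ends_subset e hxt)
    have hσ := least_mem hΓ hM.prop (Sum.inr e)
    rcases nested_of_bundle_eq hΓ hM.prop hr.1 hσ hfr (mem_least _) hf with h | h
    · have hfe : f ≠ e := fun h' ↦ hxr (h' ▸ hfr)
      exact hmax' _ hσ (hlt _ hxt (h2 e fun hfst ↦ hfe (hfst f hf (h hfr))))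
        (h.ssubset_of_ne fun h' ↦ hxr (h' ▸ mem_least _))
    · exact hxr (h (mem_least _))

/-- All nodes and edges except one first edge per bundle already suffice to produce every member as
a least tube. -/
lemma ncard_insert_univ_add_card_le [Fintype K] (hΓ : Γ.IsPiece univ)
    (hM : Maximal Γ.IsTubing M) :
    (insert univ M).ncard + Fintype.card K ≤ Fintype.card (V ⊕ E) := by
  classical
  choose fst hfst hfirst using exists_isFirst hΓ hM
  have hinj : Function.Injective fun k ↦ (Sum.inr (fst k) : V ⊕ E) := by
    intro k l h
    have h' := Sum.inr_injective h
    rw [← hfst k, ← hfst l, h']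
  have hsub : insert univ M ⊆
      (least M) '' ((univ \ univ.image fun k ↦ (Sum.inr (fst k) : V ⊕ E) : Finset (V ⊕ E)) :
        Set (V ⊕ E)) := by
    intro t ht
    rcases exists_least_eq hΓ hM ht with ⟨v, hv⟩ | ⟨e, he, hv⟩
    · exact ⟨_, by simp, hv⟩
    · refine ⟨_, ?_, hv⟩
      simp only [coe_sdiff, coe_univ, coe_image, Set.image_univ, Set.mem_sdiff, Set.mem_univ,
        Set.mem_range, Sum.inr.injEq, not_exists, true_and]
      rintro k rfl
      exact he (hfirst k)
  have h1 := (Set.ncard_le_ncard hsub (Set.toFinite _)).trans (Set.ncard_image_le (Set.toFinite _))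
  rw [Set.ncard_coe_finset, card_sdiff_of_subset (subset_univ _), card_image_of_injective _ hinj,
    card_univ, card_univ] at h1
  have h2 := Fintype.card_le_of_injective _ hinj
  omega

end MaximalStructure

end BundledGraph

namespace BundledGraph

open Finset

/-! ### Independence of the tube, node and bundle sums -/

section LinearAlgebra

variable {V E K : Type*} (Γ : BundledGraph V E K) [Fintype V] [Fintype E] [Fintype K]
  [DecidableEq V] [DecidableEq E] [DecidableEq K] {M : Set (Finset (V ⊕ E))}

/-- The edges of the bundle `k` in `t`. -/
def strand (t : Finset (V ⊕ E)) (k : K) : Finset E :=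
  univ.filter fun e ↦ Γ.bundle e = k ∧ Sum.inr e ∈ t

variable {Γ}

@[simp] lemma mem_strand {t : Finset (V ⊕ E)} {k : K} {e : E} :
    e ∈ Γ.strand t k ↔ Γ.bundle e = k ∧ Sum.inr e ∈ t := by
  simp [strand]

lemma sum_eq_sum_toLeft_add_sum_strand (t : Finset (V ⊕ E)) (p : V ⊕ E → ℝ) :
    ∑ x ∈ t, p x = ∑ v ∈ t.toLeft, p (Sum.inl v) + ∑ k, ∑ e ∈ Γ.strand t k, p (Sum.inr e) := by
  conv_lhs => rw [← toLeft_disjSum_toRight (u := t), sum_disjSum]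
  congr 1
  rw [← sum_fiberwise t.toRight Γ.bundle]
  refine sum_congr rfl fun k _ ↦ sum_congr ?_ fun _ _ ↦ rfl
  ext e
  simp [and_comm]

variable (Γ) in
/-- The sums of the coordinates over the sets in `U`, over all nodes, and over the bundles. -/
def sumsMap (U : Set (Finset (V ⊕ E))) :
    (V ⊕ E → ℝ) →ₗ[ℝ] (U → ℝ) × ℝ × (K → ℝ) where
  toFun d := (fun t ↦ ∑ x ∈ t.1, d x, ∑ v, d (Sum.inl v),
    fun k ↦ ∑ e ∈ Γ.strand univ k, d (Sum.inr e))
  map_add' d d' := by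
    refine Prod.ext ?_ (Prod.ext ?_ ?_)
    · ext t; simp [sum_add_distrib]
    · simp [sum_add_distrib]
    · ext k; simp [sum_add_distrib]
  map_smul' a d := by
    refine Prod.ext ?_ (Prod.ext ?_ ?_)
    · ext t; simp [mul_sum]
    · simp [mul_sum]
    · ext k; simp [mul_sum]

lemma sumsMap_apply (U : Set (Finset (V ⊕ E))) (d : V ⊕ E → ℝ) :
    Γ.sumsMap U d = (fun t ↦ ∑ x ∈ t.1, d x, ∑ v, d (Sum.inl v),
      fun k ↦ ∑ e ∈ Γ.strand univ k, d (Sum.inr e)) := rfl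

lemma mem_ker_sumsMap {U : Set (Finset (V ⊕ E))} {d : V ⊕ E → ℝ} :
    d ∈ LinearMap.ker (Γ.sumsMap U) ↔ (∀ t ∈ U, ∑ x ∈ t, d x = 0) ∧ ∑ v, d (Sum.inl v) = 0 ∧
      ∀ k, ∑ e ∈ Γ.strand univ k, d (Sum.inr e) = 0 := by
  rw [LinearMap.mem_ker, sumsMap_apply, Prod.mk_eq_zero, Prod.mk_eq_zero]
  simp [funext_iff]

lemma univ_notMem (hM : Γ.IsTubing M) : univ ∉ M := fun h ↦ (hM.1 _ h).2 rfl

lemma sumsMap_injective (hΓ : Γ.IsPiece univ) (hM : Maximal Γ.IsTubing M) :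
    Function.Injective (Γ.sumsMap M) := by
  rw [← LinearMap.ker_eq_bot, Submodule.eq_bot_iff]
  intro d hd
  rw [mem_ker_sumsMap] at hd
  refine eq_zero_of_sums_eq_zero hΓ hM ?_ fun k ↦ ?_
  · rintro t (rfl | ht)
    · rw [Γ.sum_eq_sum_toLeft_add_sum_strand, sum_congr rfl fun k _ ↦ hd.2.2 k, sum_const_zero,
        add_zero, ← hd.2.1]
      exact sum_congr (by ext; simp) fun _ _ ↦ rfl
    · exact hd.1 t ht
  · rw [← hd.2.2 k]
    exact sum_congr (by ext; simp) fun _ _ ↦ rfl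

lemma finrank_codomain (U : Set (Finset (V ⊕ E))) :
    Module.finrank ℝ ((U → ℝ) × ℝ × (K → ℝ)) = U.ncard + 1 + Fintype.card K := by
  classical
  rw [Module.finrank_prod, Module.finrank_prod, Module.finrank_fintype_fun_eq_card,
    Module.finrank_fintype_fun_eq_card, Module.finrank_self, ← Nat.card_coe_set_eq,
    Nat.card_eq_fintype_card]
  omega

/-- Injectivity of `sumsMap` gives one inequality, counting least tubes gives the other. Hence
`sumsMap` is bijective for a maximal tubing. -/
lemma ncard_add_one_add_card (hΓ : Γ.IsPiece univ) (hM : Maximal Γ.IsTubing M) :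
    M.ncard + 1 + Fintype.card K = Fintype.card (V ⊕ E) := by
  have h1 := LinearMap.finrank_le_finrank_of_injective (sumsMap_injective hΓ hM)
  rw [finrank_codomain, Module.finrank_fintype_fun_eq_card] at h1
  have h2 := ncard_insert_univ_add_card_le hΓ hM
  rw [Set.ncard_insert_of_notMem (univ_notMem hM.prop) (Set.toFinite M)] at h2
  omega

lemma sumsMap_surjective_of_maximal (hΓ : Γ.IsPiece univ) (hM : Maximal Γ.IsTubing M) :
    Function.Surjective (Γ.sumsMap M) := by
  refine (LinearMap.injective_iff_surjective_of_finrank_eq_finrank ?_).1 (sumsMap_injective hΓ hM)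
  rw [finrank_codomain, Module.finrank_fintype_fun_eq_card, ncard_add_one_add_card hΓ hM]

/-- The sums over the tubes of a tubing, over all nodes and over the bundles can be prescribed. -/
lemma exists_sums_eq (hΓ : Γ.IsPiece univ) {U : Set (Finset (V ⊕ E))} (hU : Γ.IsTubing U)
    (a : Finset (V ⊕ E) → ℝ) (b : ℝ) (c : K → ℝ) :
    ∃ f : V ⊕ E → ℝ, (∀ t ∈ U, ∑ x ∈ t, f x = a t) ∧ ∑ v, f (Sum.inl v) = b ∧
      ∀ k, ∑ e ∈ Γ.strand univ k, f (Sum.inr e) = c k := by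
  obtain ⟨M, hUM, hM⟩ := hU.exists_maximal
  obtain ⟨f, hf⟩ := sumsMap_surjective_of_maximal hΓ hM (fun t ↦ a t, b, c)
  rw [sumsMap_apply, Prod.mk.injEq, Prod.mk.injEq] at hf
  exact ⟨f, fun t ht ↦ congrFun hf.1 ⟨t, hUM ht⟩, hf.2.1, congrFun hf.2.2⟩

/-- The sums of a tubing extend to the independent sums of a maximal one, so they can be prescribed
freely, and rank-nullity applies. -/
lemma finrank_ker_sumsMap (hΓ : Γ.IsPiece univ) {U : Set (Finset (V ⊕ E))} (hU : Γ.IsTubing U) :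
    Module.finrank ℝ (LinearMap.ker (Γ.sumsMap U)) + U.ncard + 1 + Fintype.card K =
      Fintype.card (V ⊕ E) := by
  classical
  have hsurj : LinearMap.range (Γ.sumsMap U) = ⊤ := by
    rw [LinearMap.range_eq_top]
    rintro ⟨a, b, c⟩
    obtain ⟨f, h1, h2, h3⟩ := exists_sums_eq hΓ hU
      (fun t ↦ if h : t ∈ U then a ⟨t, h⟩ else 0) b c
    refine ⟨f, ?_⟩
    rw [sumsMap_apply]
    refine Prod.ext ?_ (Prod.ext h2 (funext h3))
    ext t
    simp [h1 t.1 t.2]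
  have h := LinearMap.finrank_range_add_finrank_ker (Γ.sumsMap U)
  rw [hsurj, finrank_top, finrank_codomain, Module.finrank_fintype_fun_eq_card] at h
  omega

end LinearAlgebra

end BundledGraph

namespace BundledGraph

open Finset

/-! ### Tube bounds and their supermodularity -/

section Bounds

variable {V E K : Type*} (Γ : BundledGraph V E K) [Fintype V] [Fintype E] [Fintype K]
  [DecidableEq V] [DecidableEq E] [DecidableEq K]

/-- The square of the number of nodes and edges. -/
noncomputable def cst (_ : BundledGraph V E K) : ℝ := (Fintype.card (V ⊕ E) : ℝ) ^ 2

/-- The contribution of a nonempty set of parallel edges to the bound of a tube. -/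
noncomputable def weight (S : Finset E) : ℝ := if S.Nonempty then Γ.cst ^ #S else 0

/-- The right-hand side of the inequality of a tube. -/
noncomputable def bound (t : Finset (V ⊕ E)) : ℝ :=
  Γ.cst ^ #t.toLeft + ∑ k, Γ.weight (Γ.strand t k) + (#tᶜ : ℝ) ^ 2

variable {Γ}

lemma weight_of_nonempty {S : Finset E} (h : S.Nonempty) : Γ.weight S = Γ.cst ^ #S := if_pos h

@[simp] lemma weight_empty : Γ.weight (∅ : Finset E) = 0 := by simp [weight]

lemma three_le_card [Nonempty K] (hΓ : Γ.IsPiece univ) : 3 ≤ Fintype.card (V ⊕ E) := by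
  obtain ⟨k⟩ := ‹Nonempty K›
  obtain ⟨x, y, -, -, hxy, -⟩ := Γ.exists_adj_ends k
  obtain ⟨e, -, -⟩ := hΓ.exists_edge k fun x _ ↦ by simp
  rw [Fintype.card_sum]
  have h1 : 1 < Fintype.card V := Fintype.one_lt_card_iff.2 ⟨x, y, hxy⟩
  have h2 : 0 < Fintype.card E := Fintype.card_pos_iff.2 ⟨e⟩
  omega

/-- A bundle provides two nodes and an edge, so there are at least three items. This is all the size
of `c` that most of the estimates need. -/
lemma nine_le_cst [Nonempty K] (hΓ : Γ.IsPiece univ) : 9 ≤ Γ.cst := by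
  have h : (3 : ℝ) ≤ Fintype.card (V ⊕ E) := by exact_mod_cast three_le_card hΓ
  rw [cst]
  nlinarith

lemma cst_nonneg : 0 ≤ Γ.cst := sq_nonneg _

lemma weight_nonneg (S : Finset E) : 0 ≤ Γ.weight S := by
  rw [weight]
  split_ifs
  · exact pow_nonneg cst_nonneg _
  · exact le_rfl

/-- This is the reason for taking `c` to be a square: the quadratic correction never reaches one
unit of `c`. -/
lemma sq_card_compl_lt_cst {t : Finset (V ⊕ E)} (h : t.Nonempty) : (#tᶜ : ℝ) ^ 2 < Γ.cst := by
  have h1 : #tᶜ < Fintype.card (V ⊕ E) := by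
    rw [← card_univ]
    refine card_lt_card ((subset_univ _).ssubset_of_ne fun h' ↦ ?_)
    rw [compl_eq_univ_iff] at h'
    exact h.ne_empty h'
  have h2 : (#tᶜ : ℝ) < Fintype.card (V ⊕ E) := by exact_mod_cast h1
  rw [cst]
  exact pow_lt_pow_left₀ h2 (by positivity) two_ne_zero

lemma IsPiece.nonempty_items {t : Finset (V ⊕ E)} (h : Γ.IsPiece t) : t.Nonempty :=
  h.nonempty.imp' _ fun _ h ↦ h

lemma IsPiece.strand_nonempty_iff {t : Finset (V ⊕ E)} (h : Γ.IsPiece t) {k : K} :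
    (Γ.strand t k).Nonempty ↔ Γ.ends k ⊆ t.toLeft := by
  constructor
  · rintro ⟨e, he⟩
    rw [mem_strand] at he
    exact he.1 ▸ h.ends_subset e he.2
  · intro hk
    obtain ⟨e, he⟩ := h.exists_edge k hk
    exact ⟨e, mem_strand.2 he⟩

lemma strand_inter (s t : Finset (V ⊕ E)) (k : K) :
    Γ.strand (s ∩ t) k = Γ.strand s k ∩ Γ.strand t k := by
  ext e; simp only [mem_strand, mem_inter]; tauto

lemma strand_union (s t : Finset (V ⊕ E)) (k : K) :
    Γ.strand (s ∪ t) k = Γ.strand s k ∪ Γ.strand t k := by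
  ext e; simp only [mem_strand, mem_union]; tauto

lemma strand_mono {s t : Finset (V ⊕ E)} (h : s ⊆ t) (k : K) : Γ.strand s k ⊆ Γ.strand t k :=
  fun e he ↦ by
    rw [mem_strand] at he ⊢
    exact ⟨he.1, h he.2⟩

lemma inter_union_swap_of_nested {ι R : Type*} [DecidableEq ι] [AddCommMonoid R]
    {s t : Finset ι} (h : s ⊆ t ∨ t ⊆ s) (g : Finset ι → R) : g (s ∩ t) + g (s ∪ t) = g s + g t := by
  rcases h with h | h
  · rw [inter_eq_left.2 h, union_eq_right.2 h]
  · rw [inter_eq_right.2 h, union_eq_left.2 h, add_comm]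

lemma IsPiece.inter {s t : Finset (V ⊕ E)} (hs : Γ.IsPiece s) (ht : Γ.IsPiece t)
    (hst : s.toLeft ⊆ t.toLeft)
    (hk : ∀ k, Γ.strand s k ⊆ Γ.strand t k ∨ Γ.strand t k ⊆ Γ.strand s k) : Γ.IsPiece (s ∩ t) := by
  have hl : (s ∩ t).toLeft = s.toLeft := by rw [toLeft_inter, inter_eq_left.2 hst]
  refine ⟨hl ▸ hs.conn, fun e he ↦ hl ▸ hs.ends_subset e (mem_inter.1 he).1, fun k h ↦ ?_⟩
  rw [hl] at h
  have h1 := hs.strand_nonempty_iff.2 h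
  have h2 := ht.strand_nonempty_iff.2 (h.trans hst)
  have h3 : (Γ.strand (s ∩ t) k).Nonempty := by
    rw [strand_inter]
    rcases hk k with h | h
    · rwa [inter_eq_left.2 h]
    · rwa [inter_eq_right.2 h]
  obtain ⟨e, he⟩ := h3
  exact ⟨e, mem_strand.1 he⟩

lemma IsPiece.union {s t : Finset (V ⊕ E)} (hs : Γ.IsPiece s) (ht : Γ.IsPiece t)
    (hst : s.toLeft ⊆ t.toLeft) : Γ.IsPiece (s ∪ t) := by
  have hl : (s ∪ t).toLeft = t.toLeft := by rw [toLeft_union, union_eq_right.2 hst]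
  refine ⟨hl ▸ ht.conn, fun e he ↦ ?_, fun k h ↦ ?_⟩
  · rw [hl]
    rcases mem_union.1 he with he | he
    · exact (hs.ends_subset e he).trans hst
    · exact ht.ends_subset e he
  · rw [hl] at h
    obtain ⟨e, he, het⟩ := ht.exists_edge k h
    exact ⟨e, he, mem_union_right _ het⟩

/-- The bounds are strictly supermodular on pieces whose node sets and strands are nested. -/
lemma bound_add_bound_lt {s t : Finset (V ⊕ E)} (hst : s.toLeft ⊆ t.toLeft)
    (hk : ∀ k, Γ.strand s k ⊆ Γ.strand t k ∨ Γ.strand t k ⊆ Γ.strand s k)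
    (h1 : ¬ s ⊆ t) (h2 : ¬ t ⊆ s) : Γ.bound s + Γ.bound t < Γ.bound (s ∩ t) + Γ.bound (s ∪ t) := by
  -- For nested sets, intersection and union are the same two sets again, so all power terms cancel
  -- and only the square terms can differ.
  have hA := inter_union_swap_of_nested (Or.inl hst) fun A ↦ Γ.cst ^ #A
  have hB : ∑ k, Γ.weight (Γ.strand (s ∩ t) k) + ∑ k, Γ.weight (Γ.strand (s ∪ t) k) =
      ∑ k, Γ.weight (Γ.strand s k) + ∑ k, Γ.weight (Γ.strand t k) := by
    rw [← sum_add_distrib, ← sum_add_distrib]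
    refine sum_congr rfl fun k _ ↦ ?_
    rw [strand_inter, strand_union]
    exact inter_union_swap_of_nested (hk k) _
  have hadd : (#(s ∩ t)ᶜ : ℝ) + #(s ∪ t)ᶜ = #sᶜ + #tᶜ := by
    rw [compl_inter, compl_union]
    exact_mod_cast card_union_add_card_inter sᶜ tᶜ
  have hs : (#(s ∪ t)ᶜ : ℝ) < #sᶜ := by
    refine Nat.cast_lt.2 (card_lt_card ?_)
    rw [compl_ssubset_compl]
    exact subset_union_left.ssubset_of_ne fun h ↦ h2 (h ▸ subset_union_right)
  have ht : (#(s ∪ t)ᶜ : ℝ) < #tᶜ := by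
    refine Nat.cast_lt.2 (card_lt_card ?_)
    rw [compl_ssubset_compl]
    exact subset_union_right.ssubset_of_ne fun h ↦ h1 (h ▸ subset_union_left)
  simp only [bound, toLeft_inter, toLeft_union] at hA ⊢
  -- The sizes of the complements have the same sum, but those of intersection and union are more
  -- spread out; squares are strictly convex.
  have hsq : (#sᶜ : ℝ) ^ 2 + (#tᶜ : ℝ) ^ 2 < (#(s ∩ t)ᶜ : ℝ) ^ 2 + (#(s ∪ t)ᶜ : ℝ) ^ 2 := by
    have h3 : (#(s ∩ t)ᶜ : ℝ) = #sᶜ + #tᶜ - #(s ∪ t)ᶜ := by linarith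
    rw [h3]
    nlinarith [mul_pos (sub_pos.2 hs) (sub_pos.2 ht)]
  linarith

end Bounds

/-! ### Tight tubes are compatible -/

section Region

variable {V E K : Type*} (Γ : BundledGraph V E K) [Fintype V] [Fintype E] [Fintype K]
  [DecidableEq V] [DecidableEq E] [DecidableEq K]

/-- The polyhedron cut out by the halfspaces of all tubes except the singletons of the nodes in
`D`. -/
def region (D : Set V) : Set (V ⊕ E → ℝ) :=
  {p | ∑ v, p (Sum.inl v) = Γ.cst ^ Fintype.card V ∧
    (∀ k, ∑ e ∈ Γ.strand univ k, p (Sum.inr e) = Γ.cst ^ #(Γ.strand univ k)) ∧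
    ∀ t, Γ.IsTube t → (∀ d ∈ D, t ≠ {Sum.inl d}) → Γ.bound t ≤ ∑ x ∈ t, p x}

variable {Γ} {D : Set V} {p : V ⊕ E → ℝ}

lemma strand_univ_nonempty (hΓ : Γ.IsPiece univ) (k : K) : (Γ.strand univ k).Nonempty :=
  hΓ.strand_nonempty_iff.2 fun x _ ↦ by simp

lemma toLeft_univ : (univ : Finset (V ⊕ E)).toLeft = univ := by ext; simp

lemma sum_univ_eq_bound (hΓ : Γ.IsPiece univ)
    (h1 : ∑ v, p (Sum.inl v) = Γ.cst ^ Fintype.card V)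
    (h2 : ∀ k, ∑ e ∈ Γ.strand univ k, p (Sum.inr e) = Γ.cst ^ #(Γ.strand univ k)) :
    ∑ x, p x = Γ.bound univ := by
  rw [Γ.sum_eq_sum_toLeft_add_sum_strand, toLeft_univ, h1, bound, toLeft_univ, card_univ]
  simp only [compl_univ, card_empty, Nat.cast_zero, ne_eq, OfNat.ofNat_ne_zero, not_false_eq_true,
    zero_pow, add_zero]
  congr 1
  exact sum_congr rfl fun k _ ↦ by rw [h2, weight_of_nonempty (strand_univ_nonempty hΓ k)]

lemma bound_le_sum (hΓ : Γ.IsPiece univ) (hp : p ∈ Γ.region D) {t : Finset (V ⊕ E)}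
    (ht : Γ.IsPiece t) (hD : ∀ d ∈ D, t ≠ {Sum.inl d}) : Γ.bound t ≤ ∑ x ∈ t, p x := by
  by_cases hu : t = univ
  · rw [hu, sum_univ_eq_bound hΓ hp.1 hp.2.1]
  · exact hp.2.2 t ⟨ht, hu⟩ hD

/-- Use the inequality of the piece that lacks only the edges of the bundle outside `S`. The node
sum and the other bundle sums are fixed by the equations and cancel. This piece has an edge, so it
is never an omitted singleton. -/
lemma weight_le_sum (hΓ : Γ.IsPiece univ) (hp : p ∈ Γ.region D) {k : K} {S : Finset E}
    (hS : S ⊆ Γ.strand univ k) : Γ.weight S ≤ ∑ e ∈ S, p (Sum.inr e) := by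
  rcases S.eq_empty_or_nonempty with rfl | hne
  · simp
  set t : Finset (V ⊕ E) := univ.disjSum (univ.filter fun e ↦ Γ.bundle e = k → e ∈ S) with ht
  have hl : t.toLeft = univ := toLeft_disjSum
  have hstr : ∀ l, l ≠ k → Γ.strand t l = Γ.strand univ l := by
    intro l hl
    ext e
    simp only [mem_strand, ht, inr_mem_disjSum, mem_filter, mem_univ, true_and, and_true,
      and_iff_left_iff_imp]
    rintro rfl h
    exact absurd h hl
  have hstrk : Γ.strand t k = S := by
    ext e
    simp only [mem_strand, ht, inr_mem_disjSum, mem_filter, mem_univ, true_and]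
    exact ⟨fun h ↦ h.2 h.1, fun h ↦ ⟨(mem_strand.1 (hS h)).1, fun _ ↦ h⟩⟩
  have htp : Γ.IsPiece t := by
    refine ⟨?_, fun e _ x _ ↦ by simp [hl], fun l _ ↦ ?_⟩
    · rw [hl, ← toLeft_univ (E := E)]; exact hΓ.conn
    · have : (Γ.strand t l).Nonempty := by
        by_cases h : l = k
        · rwa [h, hstrk]
        · rw [hstr l h]; exact strand_univ_nonempty hΓ l
      obtain ⟨e, he⟩ := this
      exact ⟨e, mem_strand.1 he⟩
  have hb := bound_le_sum hΓ hp htp fun d _ h ↦ by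
    obtain ⟨e, he⟩ := hne
    have : Sum.inr e ∈ t := (mem_strand.1 (hstrk ▸ he : e ∈ Γ.strand t k)).2
    rw [h] at this
    simp at this
  rw [Γ.sum_eq_sum_toLeft_add_sum_strand, bound, hl, hp.1, card_univ,
    ← add_sum_erase _ _ (mem_univ k), ← add_sum_erase _ _ (mem_univ k), hstrk,
    sum_congr rfl fun l hl ↦ show Γ.weight (Γ.strand t l) =
      ∑ e ∈ Γ.strand t l, p (Sum.inr e) by
        rw [hstr l (mem_erase.1 hl).1, hp.2.1, weight_of_nonempty (strand_univ_nonempty hΓ l)]] at hb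
  nlinarith [sq_nonneg (#tᶜ : ℝ)]

/-- Use the piece with all edges between nodes of `A`: its bundles are complete, so their sums
cancel by the bundle equations. -/
lemma cst_pow_le_sum (hΓ : Γ.IsPiece univ) (hp : p ∈ Γ.region D) {A : Finset V}
    (hA : Γ.ConnSet A) (hD : ∀ d ∈ D, A ≠ {d}) : Γ.cst ^ #A ≤ ∑ v ∈ A, p (Sum.inl v) := by
  set t : Finset (V ⊕ E) := A.disjSum (univ.filter fun e ↦ Γ.ends (Γ.bundle e) ⊆ A) with ht
  have hl : t.toLeft = A := toLeft_disjSum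
  have hstr : ∀ k, Γ.strand t k = if Γ.ends k ⊆ A then Γ.strand univ k else ∅ := by
    intro k
    ext e
    split_ifs with h
    · simp only [mem_strand, ht, inr_mem_disjSum, mem_filter, mem_univ, true_and, and_true,
        and_iff_left_iff_imp]
      rintro rfl
      exact h
    · simp only [mem_strand, ht, inr_mem_disjSum, mem_filter, mem_univ, true_and, notMem_empty,
        iff_false, not_and]
      rintro rfl
      exact h
  have htp : Γ.IsPiece t := by
    refine ⟨hl.symm ▸ hA, fun e he ↦ ?_, fun k hk ↦ ?_⟩
    · rw [ht, inr_mem_disjSum, mem_filter] at he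
      rw [hl]
      exact he.2
    · rw [hl] at hk
      obtain ⟨e, he⟩ := strand_univ_nonempty hΓ k
      have : e ∈ Γ.strand t k := by rwa [hstr, if_pos hk]
      exact ⟨e, mem_strand.1 this⟩
  have hb := bound_le_sum hΓ hp htp fun d hd h ↦ by
    refine hD d hd ?_
    rw [← hl, h]
    ext; simp
  rw [Γ.sum_eq_sum_toLeft_add_sum_strand, bound, hl,
    sum_congr rfl fun k _ ↦ show Γ.weight (Γ.strand t k) =
      ∑ e ∈ Γ.strand t k, p (Sum.inr e) by
        rw [hstr]
        split_ifs
        · rw [hp.2.1, weight_of_nonempty (strand_univ_nonempty hΓ k)]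
        · simp] at hb
  nlinarith [sq_nonneg (#tᶜ : ℝ)]

/-- Single coordinates at nodes of `D` may be negative. The hypothesis prevents such a node from
being a whole component of `W`, and every other component has a nonnegative sum. -/
lemma sum_nonneg_of_closed [Nonempty K] (hΓ : Γ.IsPiece univ) (hp : p ∈ Γ.region D) :
    ∀ W : Finset V, (∀ d ∈ D, d ∈ W → ∃ n ∈ W, Γ.Adj d n) → 0 ≤ ∑ v ∈ W, p (Sum.inl v) := by
  intro W
  induction W using Finset.strongInduction with
  | H W ih =>
    intro hW
    rcases W.eq_empty_or_nonempty with rfl | ⟨w, hw⟩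
    · simp
    obtain ⟨C, hCW, hwC, hC, hcl⟩ := Γ.exists_component W hw
    have h1 : Γ.cst ^ #C ≤ ∑ v ∈ C, p (Sum.inl v) := by
      refine cst_pow_le_sum hΓ hp hC fun d hd h ↦ ?_
      have hdC : d ∈ C := by simp [h]
      obtain ⟨n, hn, hdn⟩ := hW d hd (hCW hdC)
      have hnC := hcl d hdC n hn hdn
      rw [h, mem_singleton] at hnC
      exact hdn.1 hnC.symm
    have h2 := ih (W \ C) (sdiff_ssubset hCW ⟨w, hwC⟩) fun d hd hdW ↦ by
      rw [mem_sdiff] at hdW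
      obtain ⟨n, hn, hdn⟩ := hW d hd hdW.1
      exact ⟨n, mem_sdiff.2 ⟨hn, fun hnC ↦ hdW.2 (hcl n hnC d hdW.1 hdn.symm)⟩, hdn⟩
    rw [← sum_sdiff hCW]
    have := pow_nonneg (cst_nonneg (Γ := Γ)) #C
    linarith

lemma IsPiece.eq_singleton {t : Finset (V ⊕ E)} (ht : Γ.IsPiece t) {d : V}
    (h : t.toLeft = {d}) : t = {Sum.inl d} := by
  ext x
  rcases x with v | e
  · rw [← mem_toLeft, h]; simp
  · simp only [mem_singleton, reduceCtorEq, iff_false]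
    intro he
    obtain ⟨x, y, hx, hy, hxy, -⟩ := Γ.exists_adj_ends (Γ.bundle e)
    have hx' := ht.ends_subset e he hx
    have hy' := ht.ends_subset e he hy
    rw [h, mem_singleton] at hx' hy'
    exact hxy (hx'.trans hy'.symm)

lemma IsPiece.exists_adj {t : Finset (V ⊕ E)} (ht : Γ.IsPiece t) {d : V} (hd : Sum.inl d ∈ t)
    (h : t ≠ {Sum.inl d}) : ∃ n, Sum.inl n ∈ t ∧ Γ.Adj d n := by
  obtain ⟨x, hx, y, hy, -, hxy⟩ := ht.conn.2 {d} (by simpa using hd) (singleton_nonempty d)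
    fun h' ↦ h (ht.eq_singleton h'.symm)
  rw [mem_singleton] at hx
  exact ⟨y, mem_toLeft.1 hy, hx ▸ hxy⟩

/-- The total is exactly the bound and every strand sum is at least its share, so the node sum can
exceed its own share at most by the square term. -/
lemma sum_toLeft_le_of_tight (hΓ : Γ.IsPiece univ) (hp : p ∈ Γ.region D) {t : Finset (V ⊕ E)}
    (ht : ∑ x ∈ t, p x = Γ.bound t) :
    ∑ v ∈ t.toLeft, p (Sum.inl v) ≤ Γ.cst ^ #t.toLeft + (#tᶜ : ℝ) ^ 2 := by
  rw [Γ.sum_eq_sum_toLeft_add_sum_strand, bound] at ht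
  have := sum_le_sum fun k (_ : k ∈ univ) ↦
    weight_le_sum hΓ hp (Γ.strand_mono (subset_univ t) k)
  linarith

lemma sum_strand_le_of_tight (hΓ : Γ.IsPiece univ) (hp : p ∈ Γ.region D) {t : Finset (V ⊕ E)}
    (htp : Γ.IsPiece t) (hD : ∀ d ∈ D, t ≠ {Sum.inl d}) (ht : ∑ x ∈ t, p x = Γ.bound t) (k : K) :
    ∑ e ∈ Γ.strand t k, p (Sum.inr e) ≤ Γ.weight (Γ.strand t k) + (#tᶜ : ℝ) ^ 2 := by
  have h1 := cst_pow_le_sum hΓ hp htp.conn fun d hd h ↦ hD d hd (htp.eq_singleton h)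
  rw [Γ.sum_eq_sum_toLeft_add_sum_strand, bound, ← add_sum_erase _ _ (mem_univ k),
    ← add_sum_erase _ _ (mem_univ k)] at ht
  have := sum_le_sum fun l (_ : l ∈ univ.erase k) ↦
    weight_le_sum hΓ hp (Γ.strand_mono (subset_univ t) l)
  linarith

/-- With `n = m + 1`, each of the four terms is at most `c ^ m`, where `1 ≤ a < n` gives `1 ≤ m`;
and `4 < c`. -/
lemma pow_add_pow_lt {c : ℝ} (hc : 9 ≤ c) {a b n : ℕ} (ha : 1 ≤ a) (han : a < n)
    (hbn : b < n) {x y : ℝ} (hx : x < c) (hy : y < c) : c ^ a + x + (c ^ b + y) < c ^ n := by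
  obtain ⟨m, rfl⟩ : ∃ m, n = m + 1 := ⟨n - 1, by omega⟩
  have hc1 : (1 : ℝ) ≤ c := by linarith
  have h1 : c ^ a ≤ c ^ m := pow_le_pow_right₀ hc1 (by omega)
  have h2 : c ^ b ≤ c ^ m := pow_le_pow_right₀ hc1 (by omega)
  have h3 : c ^ 1 ≤ c ^ m := pow_le_pow_right₀ hc1 (by omega)
  rw [pow_one] at h3
  have h4 : c ^ (m + 1) = c * c ^ m := pow_succ' c m
  nlinarith

/-- The tubes whose inequalities are tight at a point are pairwise compatible. -/
lemma compat_of_tight [Nonempty K] (hΓ : Γ.IsPiece univ)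
    (hleaf : ∀ d ∈ D, ∀ x y, Γ.Adj d x → Γ.Adj d y → x = y)
    (hp : p ∈ Γ.region D) {s t : Finset (V ⊕ E)} (hs : Γ.IsPiece s) (ht : Γ.IsPiece t)
    (hsD : ∀ d ∈ D, s ≠ {Sum.inl d}) (htD : ∀ d ∈ D, t ≠ {Sum.inl d})
    (hse : ∑ x ∈ s, p x = Γ.bound s) (hte : ∑ x ∈ t, p x = Γ.bound t) (hne : s ≠ t) :
    Γ.Compat s t := by
  have hc := nine_le_cst hΓ
  by_contra hcom
  have hjoin : ∃ x y, Sum.inl x ∈ s ∧ Sum.inl y ∈ t ∧ (x = y ∨ Γ.Adj x y) := by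
    by_contra! h
    exact hcom (Or.inr (Or.inr fun x y hx hy ↦ h x y hx hy))
  obtain ⟨x, y, hx, hy, hxy⟩ := hjoin
  have hn1 : ¬ s ⊆ t := fun h ↦ hcom (Or.inl (h.ssubset_of_ne hne))
  have hn2 : ¬ t ⊆ s := fun h ↦ hcom (Or.inr (Or.inl (h.ssubset_of_ne hne.symm)))
  have hsc := sq_card_compl_lt_cst (Γ := Γ) hs.nonempty_items
  have htc := sq_card_compl_lt_cst (Γ := Γ) ht.nonempty_items
  -- Crossing node sets would make the union larger than both, so its lower bound is a power of `c`
  -- beyond what two tight tubes can supply.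
  have hV : s.toLeft ⊆ t.toLeft ∨ t.toLeft ⊆ s.toLeft := by
    by_contra! hV
    have h1 := sum_toLeft_le_of_tight hΓ hp hse
    have h2 := sum_toLeft_le_of_tight hΓ hp hte
    -- A node of `D` in both tubes has a neighbour in each of them. As it has only one neighbour,
    -- that neighbour lies in the intersection too.
    have h3 : 0 ≤ ∑ v ∈ s.toLeft ∩ t.toLeft, p (Sum.inl v) := by
      refine sum_nonneg_of_closed hΓ hp _ fun d hd hdst ↦ ?_
      simp only [mem_inter, mem_toLeft] at hdst
      obtain ⟨n, hn, hdn⟩ := hs.exists_adj hdst.1 (hsD d hd)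
      obtain ⟨m, hm, hdm⟩ := ht.exists_adj hdst.2 (htD d hd)
      obtain rfl := hleaf d hd n m hdn hdm
      exact ⟨n, by simp [hn, hm], hdn⟩
    have hlt1 : #s.toLeft < #(s.toLeft ∪ t.toLeft) := card_lt_card
      (subset_union_left.ssubset_of_ne fun h ↦ hV.2 (h ▸ subset_union_right))
    have hlt2 : #t.toLeft < #(s.toLeft ∪ t.toLeft) := card_lt_card
      (subset_union_right.ssubset_of_ne fun h ↦ hV.1 (h ▸ subset_union_left))
    have hs1 : 1 ≤ #s.toLeft := hs.conn.1.card_pos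
    have h4 := cst_pow_le_sum hΓ hp (hs.conn.union ht.conn (mem_toLeft.2 hx) (mem_toLeft.2 hy) hxy)
      fun d hd h ↦ by
        rw [h, card_singleton] at hlt1
        omega
    have h5 := sum_union_inter (s₁ := s.toLeft) (s₂ := t.toLeft) (f := fun v ↦ p (Sum.inl v))
    have h6 := pow_add_pow_lt hc hs1 hlt1 hlt2 hsc htc
    linarith
  have hK : ∀ k, Γ.strand s k ⊆ Γ.strand t k ∨ Γ.strand t k ⊆ Γ.strand s k := by
    intro k
    by_contra! hV
    have h1 := sum_strand_le_of_tight hΓ hp hs hsD hse k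
    have h2 := sum_strand_le_of_tight hΓ hp ht htD hte k
    have hs1 : (Γ.strand s k).Nonempty := by
      rw [nonempty_iff_ne_empty]; intro h; exact hV.1 (h ▸ empty_subset _)
    have ht1 : (Γ.strand t k).Nonempty := by
      rw [nonempty_iff_ne_empty]; intro h; exact hV.2 (h ▸ empty_subset _)
    have hlt1 : #(Γ.strand s k) < #(Γ.strand s k ∪ Γ.strand t k) := card_lt_card
      (subset_union_left.ssubset_of_ne fun h ↦ hV.2 (h ▸ subset_union_right))
    have hlt2 : #(Γ.strand t k) < #(Γ.strand s k ∪ Γ.strand t k) := card_lt_card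
      (subset_union_right.ssubset_of_ne fun h ↦ hV.1 (h ▸ subset_union_left))
    have hsu := Γ.strand_mono (subset_univ s) k
    have htu := Γ.strand_mono (subset_univ t) k
    have h3 := weight_le_sum hΓ hp (inter_subset_left.trans hsu : _ ∩ Γ.strand t k ⊆ _)
    have h3' := weight_nonneg (Γ := Γ) (Γ.strand s k ∩ Γ.strand t k)
    have h4 := weight_le_sum hΓ hp (union_subset hsu htu)
    rw [weight_of_nonempty (hs1.mono subset_union_left)] at h4
    rw [weight_of_nonempty hs1] at h1
    rw [weight_of_nonempty ht1] at h2
    have h5 := sum_union_inter (s₁ := Γ.strand s k) (s₂ := Γ.strand t k)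
      (f := fun v ↦ p (Sum.inr v))
    have h6 := pow_add_pow_lt hc hs1.card_pos hlt1 hlt2 hsc htc
    linarith
  -- Once everything is nested, strict supermodularity contradicts the inequalities for intersection
  -- and union.
  have main : ∀ s t : Finset (V ⊕ E), Γ.IsPiece s → Γ.IsPiece t → (∀ d ∈ D, s ≠ {Sum.inl d}) →
      (∀ d ∈ D, t ≠ {Sum.inl d}) → ∑ x ∈ s, p x = Γ.bound s → ∑ x ∈ t, p x = Γ.bound t →
      ¬ s ⊆ t → ¬ t ⊆ s → s.toLeft ⊆ t.toLeft →
      (∀ k, Γ.strand s k ⊆ Γ.strand t k ∨ Γ.strand t k ⊆ Γ.strand s k) → False := by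
    intro s t hs ht hsD htD hse hte hn1 hn2 hV hK
    have h1 := bound_add_bound_lt hV hK hn1 hn2
    have h2 := bound_le_sum hΓ hp (hs.inter ht hV hK) fun d hd h ↦ hsD d hd <| hs.eq_singleton <| by
      have : (s ∩ t).toLeft = {d} := by rw [h]; ext; simp
      rwa [toLeft_inter, inter_eq_left.2 hV] at this
    have h3 := bound_le_sum hΓ hp (hs.union ht hV) fun d hd h ↦ htD d hd <| ht.eq_singleton <| by
      have : (s ∪ t).toLeft = {d} := by rw [h]; ext; simp
      rwa [toLeft_union, union_eq_right.2 hV] at this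
    have h5 := sum_union_inter (s₁ := s) (s₂ := t) (f := p)
    linarith
  rcases hV with hV | hV
  · exact main s t hs ht hsD htD hse hte hn1 hn2 hV hK
  · exact main t s ht hs htD hsD hte hse hn2 hn1 hV fun k ↦ (hK k).symm

end Region

end BundledGraph

namespace BundledGraph

open Finset

/-! ### Coordinates and estimates at the vertex of a maximal tubing -/

section VertexPoint

variable {V E K : Type*} (Γ : BundledGraph V E K) [Fintype V] [Fintype E] [Fintype K]
  [DecidableEq V] [DecidableEq E] [DecidableEq K]

/-- The point where the inequalities of all tubes in `M` are tight. -/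
structure IsVertex (M : Set (Finset (V ⊕ E))) (f : V ⊕ E → ℝ) : Prop where
  sum_tube : ∀ t ∈ M, ∑ x ∈ t, f x = Γ.bound t
  sum_nodes : ∑ v, f (Sum.inl v) = Γ.cst ^ Fintype.card V
  sum_bundle : ∀ k, ∑ e ∈ Γ.strand univ k, f (Sum.inr e) = Γ.cst ^ #(Γ.strand univ k)

/-- A set of edges is initial if it is closed under parallel edges that lie in all tubes through
one of its edges. -/
def IsInitial (M : Set (Finset (V ⊕ E))) (S : Finset E) : Prop :=
  ∀ e ∈ S, ∀ e', Γ.bundle e' = Γ.bundle e → Sum.inr e' ∈ least M (Sum.inr e) → e' ∈ S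

variable {Γ} {M : Set (Finset (V ⊕ E))} {f : V ⊕ E → ℝ}

lemma exists_isVertex (hΓ : Γ.IsPiece univ) (hM : Γ.IsTubing M) : ∃ f, Γ.IsVertex M f := by
  obtain ⟨f, h1, h2, h3⟩ := exists_sums_eq hΓ hM Γ.bound (Γ.cst ^ Fintype.card V)
    fun k ↦ Γ.cst ^ #(Γ.strand univ k)
  exact ⟨f, h1, h2, h3⟩

lemma IsVertex.eq (hΓ : Γ.IsPiece univ) (hM : Maximal Γ.IsTubing M) {g : V ⊕ E → ℝ}
    (hf : Γ.IsVertex M f) (hg : Γ.IsVertex M g) : f = g := by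
  apply sumsMap_injective hΓ hM
  rw [sumsMap_apply, sumsMap_apply, hf.sum_nodes, hg.sum_nodes]
  refine Prod.ext ?_ (Prod.ext rfl ?_)
  · ext t
    exact (hf.sum_tube t t.2).trans (hg.sum_tube t t.2).symm
  · ext k
    exact (hf.sum_bundle k).trans (hg.sum_bundle k).symm

lemma IsVertex.sum_eq (hΓ : Γ.IsPiece univ) (hf : Γ.IsVertex M f) {t : Finset (V ⊕ E)}
    (ht : t ∈ insert univ M) : ∑ x ∈ t, f x = Γ.bound t := by
  rcases ht with rfl | ht
  · exact sum_univ_eq_bound hΓ hf.sum_nodes hf.sum_bundle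
  · exact hf.sum_tube t ht

/-- Subtract the tight equations of the least tube of `e` and of the same tube without `e`. If the
former has `q` items outside, the square terms contribute `q ^ 2 - (q + 1) ^ 2`. -/
lemma IsVertex.apply_inr (hΓ : Γ.IsPiece univ) (hM : Maximal Γ.IsTubing M) (hf : Γ.IsVertex M f)
    {e : E} (he : ¬ Γ.IsFirst M e) :
    f (Sum.inr e) = Γ.cst ^ #(Γ.strand (least M (Sum.inr e)) (Γ.bundle e)) -
      Γ.cst ^ (#(Γ.strand (least M (Sum.inr e)) (Γ.bundle e)) - 1) -
      (2 * (#(least M (Sum.inr e))ᶜ : ℝ) + 1) := by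
  have h1 := hf.sum_eq hΓ (least_mem hΓ hM.prop (Sum.inr e))
  have h2 := hf.sum_tube _ (erase_least_mem_of_not_isFirst hΓ hM he)
  have hmem := mem_least (M := M) (Sum.inr e)
  rw [← add_sum_erase _ _ hmem, h2] at h1
  have hne : ((Γ.strand (least M (Sum.inr e)) (Γ.bundle e)).erase e).Nonempty := by
    simp only [IsFirst, not_forall] at he
    obtain ⟨e', hb, he', hne⟩ := he
    exact ⟨e', mem_erase.2 ⟨hne, mem_strand.2 ⟨hb, he'⟩⟩⟩
  generalize least M (Sum.inr e) = σ at *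
  have hl : (σ.erase (Sum.inr e)).toLeft = σ.toLeft := by ext; simp
  have hs : Γ.strand (σ.erase (Sum.inr e)) (Γ.bundle e) = (Γ.strand σ (Γ.bundle e)).erase e := by
    ext e'
    simp only [mem_strand, mem_erase, ne_eq, Sum.inr.injEq]
    tauto
  have hs' : ∀ l, l ≠ Γ.bundle e → Γ.strand (σ.erase (Sum.inr e)) l = Γ.strand σ l := by
    intro l hl
    ext e'
    simp only [mem_strand, mem_erase, ne_eq, Sum.inr.injEq]
    constructor
    · tauto
    · rintro ⟨rfl, h⟩
      exact ⟨rfl, fun h' ↦ hl (by rw [h']), h⟩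
  have hmem' : e ∈ Γ.strand σ (Γ.bundle e) := mem_strand.2 ⟨rfl, hmem⟩
  have hcard : (#(σ.erase (Sum.inr e))ᶜ : ℝ) = #σᶜ + 1 := by
    rw [compl_erase, card_insert_of_notMem (by simpa using hmem)]
    push_cast
    rfl
  rw [bound, bound, hl, hcard, ← add_sum_erase _ _ (mem_univ (Γ.bundle e)),
    ← add_sum_erase univ (fun k ↦ Γ.weight (Γ.strand σ k)) (mem_univ (Γ.bundle e)), hs,
    weight_of_nonempty hne, weight_of_nonempty ⟨e, hmem'⟩, card_erase_of_mem hmem',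
    sum_congr rfl fun l hl ↦ by rw [hs' l (mem_erase.1 hl).1]] at h1
  linarith

lemma isInitial_strand {t : Finset (V ⊕ E)} (ht : t ∈ insert univ M) (k : K) :
    Γ.IsInitial M (Γ.strand t k) := by
  intro e he e' hb he'
  rw [mem_strand] at he ⊢
  exact ⟨hb.trans he.1, least_subset ht he.2 he'⟩

lemma mem_least_or_mem_least (hΓ : Γ.IsPiece univ) (hM : Γ.IsTubing M) {e e' : E}
    (hb : Γ.bundle e = Γ.bundle e') :
    Sum.inr e ∈ least M (Sum.inr e') ∨ Sum.inr e' ∈ least M (Sum.inr e) := by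
  rcases nested_of_bundle_eq hΓ hM (least_mem hΓ hM (Sum.inr e)) (least_mem hΓ hM (Sum.inr e'))
    (mem_least _) (mem_least _) hb with h | h
  · exact Or.inl (h (mem_least _))
  · exact Or.inr (h (mem_least _))

/-- Parallel edges are totally ordered by their least tubes, and initial sets are the lower sets of
this order. -/
lemma IsInitial.nested (hΓ : Γ.IsPiece univ) (hM : Γ.IsTubing M) {k : K} {S S' : Finset E}
    (hSk : S ⊆ Γ.strand univ k) (hSk' : S' ⊆ Γ.strand univ k) (hS : Γ.IsInitial M S)
    (hS' : Γ.IsInitial M S') : S ⊆ S' ∨ S' ⊆ S := by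
  by_contra! h
  obtain ⟨e, he, he'⟩ := not_subset.1 h.1
  obtain ⟨g, hg, hg'⟩ := not_subset.1 h.2
  have hb : Γ.bundle e = Γ.bundle g :=
    (mem_strand.1 (hSk he)).1.trans (mem_strand.1 (hSk' hg)).1.symm
  rcases mem_least_or_mem_least hΓ hM hb with h1 | h1
  · exact he' (hS' g hg e hb h1)
  · exact hg' (hS e he g hb.symm h1)

/-- Start from the whole bundle, whose sum is prescribed, and remove its last edges one at a time;
each removal contributes the correction in the coordinate of that edge. -/
lemma IsVertex.sum_of_isInitial (hΓ : Γ.IsPiece univ) (hM : Maximal Γ.IsTubing M)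
    (hf : Γ.IsVertex M f) {k : K} : ∀ n (S : Finset E), #(Γ.strand univ k \ S) = n →
      S.Nonempty → S ⊆ Γ.strand univ k → Γ.IsInitial M S →
      ∑ e ∈ S, f (Sum.inr e) = Γ.cst ^ #S +
        ∑ e ∈ Γ.strand univ k \ S, (2 * (#(least M (Sum.inr e))ᶜ : ℝ) + 1) := by
  intro n
  induction n with
  | zero =>
    intro S hn hne hSk hS
    rw [card_eq_zero] at hn
    rw [hn, sum_empty, add_zero, subset_antisymm hSk (sdiff_eq_empty_iff_subset.1 hn),
      hf.sum_bundle]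
  | succ n ih =>
    intro S hn hne hSk hS
    -- This is the edge that follows `S` in the order of the bundle: the strand of its least tube is
    -- exactly `insert e S`.
    obtain ⟨e, he, hmin⟩ := (Γ.strand univ k \ S).exists_min_image
      (fun e ↦ #(least M (Sum.inr e))) (card_pos.1 (by omega))
    rw [mem_sdiff] at he
    have hek : Γ.bundle e = k := (mem_strand.1 he.1).1
    have hins : Γ.strand (least M (Sum.inr e)) k = insert e S := by
      ext e'
      rw [mem_strand, mem_insert]
      constructor
      · rintro ⟨hb, he'⟩
        by_contra! h
        have hmem : e' ∈ Γ.strand univ k \ S :=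
          mem_sdiff.2 ⟨mem_strand.2 ⟨hb, mem_univ _⟩, h.2⟩
        exact least_inr_ne hΓ hM h.1 (hb.trans hek.symm) (eq_of_subset_of_card_le
          (least_subset (least_mem hΓ hM.prop _) he') (hmin e' hmem))
      · rintro (rfl | he')
        · exact ⟨hek, mem_least _⟩
        · have hb := (mem_strand.1 (hSk he')).1
          refine ⟨hb, (mem_least_or_mem_least hΓ hM.prop (hb.trans hek.symm)).resolve_right
            fun h ↦ he.2 (hS e' he' e (hek.trans hb.symm) h)⟩
    have hfirst : ¬ Γ.IsFirst M e := by
      intro h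
      obtain ⟨e', he'⟩ := hne
      have : e' ∈ Γ.strand (least M (Sum.inr e)) k := by rw [hins]; exact mem_insert_of_mem he'
      rw [mem_strand] at this
      exact he.2 (h e' (this.1.trans hek.symm) this.2 ▸ he')
    have hcard : #(insert e S) = #S + 1 := card_insert_of_notMem he.2
    have hval := hf.apply_inr hΓ hM hfirst
    rw [hek, hins, hcard, Nat.add_sub_cancel] at hval
    have hsd : Γ.strand univ k \ S = insert e (Γ.strand univ k \ insert e S) := by
      ext x
      simp only [mem_sdiff, mem_insert]
      by_cases hx : x = e
      · subst hx; simp [he.1, he.2]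
      · simp [hx]
    have hnot : e ∉ Γ.strand univ k \ insert e S := by simp
    rw [hsd, card_insert_of_notMem hnot] at hn
    have hsum := ih (insert e S) (by omega) (insert_nonempty e S) (insert_subset he.1 hSk)
      (hins ▸ isInitial_strand (least_mem hΓ hM.prop _) k)
    rw [sum_insert he.2, hval, hcard] at hsum
    rw [hsd, sum_insert hnot]
    linarith

lemma IsVertex.pow_le_sum_of_isInitial (hΓ : Γ.IsPiece univ) (hM : Maximal Γ.IsTubing M)
    (hf : Γ.IsVertex M f) {k : K} {S : Finset E} (hne : S.Nonempty) (hSk : S ⊆ Γ.strand univ k)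
    (hS : Γ.IsInitial M S) : Γ.cst ^ #S ≤ ∑ e ∈ S, f (Sum.inr e) := by
  rw [hf.sum_of_isInitial hΓ hM _ S rfl hne hSk hS]
  have : 0 ≤ ∑ e ∈ Γ.strand univ k \ S, (2 * (#(least M (Sum.inr e))ᶜ : ℝ) + 1) :=
    sum_nonneg fun _ _ ↦ by positivity
  linarith

lemma card_compl_add_one_le {t : Finset (V ⊕ E)} (h : t.Nonempty) :
    (#tᶜ : ℝ) + 1 ≤ Fintype.card (V ⊕ E) := by
  have h1 := card_compl_add_card t
  have h2 := h.card_pos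
  have h3 : #tᶜ + 1 ≤ Fintype.card (V ⊕ E) := by omega
  exact_mod_cast h3

/-- A non-first edge alone outweighs the power belonging to one edge fewer. The margin `3 * c` later
has to pay for a loss of up to `2 * c` on the nodes and a square term below `c`. -/
lemma IsVertex.le_apply_inr [Nonempty K] (hΓ : Γ.IsPiece univ) (hM : Maximal Γ.IsTubing M)
    (hf : Γ.IsVertex M f) {e : E} (he : ¬ Γ.IsFirst M e) :
    Γ.cst ^ (#(Γ.strand (least M (Sum.inr e)) (Γ.bundle e)) - 1) + 3 * Γ.cst ≤ f (Sum.inr e) := by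
  rw [hf.apply_inr hΓ hM he]
  have h2 : 1 < #(Γ.strand (least M (Sum.inr e)) (Γ.bundle e)) := by
    simp only [IsFirst, not_forall] at he
    obtain ⟨e', hb, he', hne⟩ := he
    exact one_lt_card.2 ⟨e', mem_strand.2 ⟨hb, he'⟩, e, mem_strand.2 ⟨rfl, mem_least _⟩, hne⟩
  obtain ⟨j, hj⟩ : ∃ j, #(Γ.strand (least M (Sum.inr e)) (Γ.bundle e)) = j + 2 :=
    ⟨_, (Nat.sub_add_cancel h2).symm⟩
  have hc := nine_le_cst hΓ
  have h3 := card_compl_add_one_le (t := least M (Sum.inr e)) ⟨_, mem_least _⟩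
  rw [hj, show j + 2 - 1 = j + 1 by omega, pow_succ Γ.cst (j + 1)]
  have h4 : Γ.cst ^ 1 ≤ Γ.cst ^ (j + 1) := pow_le_pow_right₀ (by linarith) (by omega)
  rw [pow_one] at h4
  have h5 : (Fintype.card (V ⊕ E) : ℝ) ≤ Γ.cst := by
    rw [cst]
    exact_mod_cast Nat.le_self_pow two_ne_zero _
  nlinarith

lemma IsVertex.inr_pos [Nonempty K] (hΓ : Γ.IsPiece univ) (hM : Maximal Γ.IsTubing M)
    (hf : Γ.IsVertex M f) (e : E) : 0 < f (Sum.inr e) := by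
  have hc := nine_le_cst hΓ
  by_cases he : Γ.IsFirst M e
  · have := hf.pow_le_sum_of_isInitial hΓ hM (k := Γ.bundle e) (singleton_nonempty e) (by simp)
      (by
        intro e₁ he₁ e' hb he'
        rw [mem_singleton] at he₁ ⊢
        subst he₁
        exact he e' hb he')
    rw [sum_singleton, card_singleton, pow_one] at this
    linarith
  · have h1 := hf.le_apply_inr hΓ hM he
    have := pow_nonneg (cst_nonneg (Γ := Γ))
      (#(Γ.strand (least M (Sum.inr e)) (Γ.bundle e)) - 1)
    linarith

/-- The last edge of `S` has a predecessor outside `S`, so its position in the bundle is greater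
than the size of `S`, and its coordinate alone suffices. -/
lemma IsVertex.le_sum_of_not_isInitial [Nonempty K] (hΓ : Γ.IsPiece univ)
    (hM : Maximal Γ.IsTubing M) (hf : Γ.IsVertex M f) {k : K} {S : Finset E}
    (hSk : S ⊆ Γ.strand univ k) (hS : ¬ Γ.IsInitial M S) :
    Γ.cst ^ #S + 3 * Γ.cst ≤ ∑ e ∈ S, f (Sum.inr e) := by
  have hne : S.Nonempty := by
    rw [nonempty_iff_ne_empty]
    rintro rfl
    exact hS fun e he ↦ by simp at he
  obtain ⟨e, he, hmax⟩ := S.exists_max_image (fun e ↦ #(least M (Sum.inr e))) hne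
  have hek := (mem_strand.1 (hSk he)).1
  have hsub : S ⊆ Γ.strand (least M (Sum.inr e)) (Γ.bundle e) := by
    intro e' he'
    have hb := (mem_strand.1 (hSk he')).1.trans hek.symm
    refine mem_strand.2 ⟨hb, ?_⟩
    rcases mem_least_or_mem_least hΓ hM.prop hb with h | h
    · exact h
    · rw [eq_of_subset_of_card_le (least_subset (least_mem hΓ hM.prop _) h) (hmax e' he')]
      exact mem_least _
  have hss : S ⊂ Γ.strand (least M (Sum.inr e)) (Γ.bundle e) := by
    refine hsub.ssubset_of_ne fun h ↦ hS ?_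
    rw [h]
    exact isInitial_strand (least_mem hΓ hM.prop _) _
  have hlt := card_lt_card hss
  have hfirst : ¬ Γ.IsFirst M e := by
    intro h
    obtain ⟨e', he', hne'⟩ := exists_of_ssubset hss
    rw [mem_strand] at he'
    exact hne' (h e' he'.1 he'.2 ▸ he)
  have h1 := hf.le_apply_inr hΓ hM hfirst
  have h2 : f (Sum.inr e) ≤ ∑ e ∈ S, f (Sum.inr e) :=
    single_le_sum (f := fun e ↦ f (Sum.inr e)) (fun e _ ↦ (hf.inr_pos hΓ hM e).le) he
  have h3 : Γ.cst ^ #S ≤ Γ.cst ^ (#(Γ.strand (least M (Sum.inr e)) (Γ.bundle e)) - 1) :=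
    pow_le_pow_right₀ (by linarith [nine_le_cst hΓ]) (by omega)
  linarith

lemma IsVertex.weight_le_sum [Nonempty K] (hΓ : Γ.IsPiece univ) (hM : Maximal Γ.IsTubing M)
    (hf : Γ.IsVertex M f) {k : K} {S : Finset E} (hSk : S ⊆ Γ.strand univ k) :
    Γ.weight S ≤ ∑ e ∈ S, f (Sum.inr e) := by
  rcases S.eq_empty_or_nonempty with rfl | hne
  · simp
  rw [weight_of_nonempty hne]
  by_cases hS : Γ.IsInitial M S
  · exact hf.pow_le_sum_of_isInitial hΓ hM hne hSk hS
  · linarith [hf.le_sum_of_not_isInitial hΓ hM hSk hS, nine_le_cst hΓ]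

lemma IsVertex.sum_toLeft_lt [Nonempty K] (hΓ : Γ.IsPiece univ) (hM : Maximal Γ.IsTubing M)
    (hf : Γ.IsVertex M f) {t : Finset (V ⊕ E)} (ht : t ∈ insert univ M) :
    ∑ v ∈ t.toLeft, f (Sum.inl v) < Γ.cst ^ #t.toLeft + Γ.cst := by
  have h := hf.sum_eq hΓ ht
  rw [Γ.sum_eq_sum_toLeft_add_sum_strand, bound] at h
  have h1 := sum_le_sum fun k (_ : k ∈ univ) ↦
    hf.weight_le_sum hΓ hM (Γ.strand_mono (subset_univ t) k)
  have h2 := sq_card_compl_lt_cst (Γ := Γ) (isPiece_of_mem hΓ hM.prop ht).nonempty_items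
  linarith

/-- The strands of a member are initial. Their excess is a sum of corrections, each at most `2 * N`
with `N` the number of items, and over all edges this is at most `2 * N ^ 2 = 2 * c`. -/
lemma IsVertex.le_sum_toLeft (hΓ : Γ.IsPiece univ) (hM : Maximal Γ.IsTubing M)
    (hf : Γ.IsVertex M f) {t : Finset (V ⊕ E)} (ht : t ∈ insert univ M) :
    Γ.cst ^ #t.toLeft - 2 * Γ.cst ≤ ∑ v ∈ t.toLeft, f (Sum.inl v) := by
  have h := hf.sum_eq hΓ ht
  rw [Γ.sum_eq_sum_toLeft_add_sum_strand, bound] at h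
  set N : ℝ := ((Fintype.card (V ⊕ E) : ℕ) : ℝ) with hN
  have h1 : ∀ k, ∑ e ∈ Γ.strand t k, f (Sum.inr e) ≤
      Γ.weight (Γ.strand t k) + ∑ e ∈ Γ.strand univ k, 2 * N := by
    intro k
    have h0 : 0 ≤ ∑ e ∈ Γ.strand univ k, 2 * N := sum_nonneg fun _ _ ↦ by positivity
    rcases (Γ.strand t k).eq_empty_or_nonempty with he | hne
    · simpa [he] using h0
    rw [weight_of_nonempty hne, hf.sum_of_isInitial hΓ hM _ _ rfl hne
      (Γ.strand_mono (subset_univ t) k) (isInitial_strand ht k)]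
    refine add_le_add le_rfl ?_
    refine (sum_le_sum (g := fun _ ↦ 2 * N) fun e _ ↦ ?_).trans
      (sum_le_sum_of_subset_of_nonneg sdiff_subset fun _ _ _ ↦ by positivity)
    have := card_compl_add_one_le (t := least M (Sum.inr e)) ⟨_, mem_least _⟩
    linarith
  have h2 := sum_le_sum fun k (_ : k ∈ univ) ↦ h1 k
  rw [sum_add_distrib] at h2
  have h3 : ∑ k, ∑ e ∈ Γ.strand univ k, 2 * N ≤ 2 * Γ.cst := by
    have h4 : ∑ k, ∑ e ∈ Γ.strand univ k, 2 * N = ∑ e : E, 2 * N := by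
      rw [← sum_fiberwise univ Γ.bundle]
      exact sum_congr rfl fun k _ ↦ sum_congr (by ext; simp) fun _ _ ↦ rfl
    rw [h4, sum_const, card_univ, nsmul_eq_mul, cst]
    have h5 : (Fintype.card E : ℝ) ≤ N := by
      rw [hN, Fintype.card_sum]
      push_cast
      linarith [Nat.cast_nonneg (α := ℝ) (Fintype.card V)]
    nlinarith [Nat.cast_nonneg (α := ℝ) (Fintype.card (V ⊕ E))]
  nlinarith [sq_nonneg (#tᶜ : ℝ)]

/-- Induction on the size of the least tube. The other nodes in it have least tubes with fewer
nodes, so their coordinates are at most about the next lower power of `c`; subtracting them from the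
node sum leaves almost the full power to `v`. -/
lemma IsVertex.inl_bounds [Nonempty K] (hΓ : Γ.IsPiece univ) (hM : Maximal Γ.IsTubing M)
    (hf : Γ.IsVertex M f) : ∀ n v, #(least M (Sum.inl v)) = n → 0 < f (Sum.inl v) ∧
      (2 ≤ #(least M (Sum.inl v)).toLeft →
        Γ.cst ^ (#(least M (Sum.inl v)).toLeft - 1) + Γ.cst ≤ f (Sum.inl v)) := by
  have hc := nine_le_cst hΓ
  intro n
  induction n using Nat.strong_induction_on with
  | _ n ih =>
    rintro v rfl
    have hmem := least_mem hΓ hM.prop (Sum.inl v)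
    have hvl : v ∈ (least M (Sum.inl v)).toLeft := mem_toLeft.2 (mem_least _)
    suffices h : 2 ≤ #(least M (Sum.inl v)).toLeft →
        Γ.cst ^ (#(least M (Sum.inl v)).toLeft - 1) + Γ.cst ≤ f (Sum.inl v) by
      refine ⟨?_, h⟩
      by_cases hm : 2 ≤ #(least M (Sum.inl v)).toLeft
      · have := pow_nonneg (cst_nonneg (Γ := Γ)) (#(least M (Sum.inl v)).toLeft - 1)
        linarith [h hm]
      · have h1 : #(least M (Sum.inl v)).toLeft = 1 := by
          have := card_pos.2 ⟨v, hvl⟩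
          omega
        obtain ⟨w, hw⟩ := card_eq_one.1 h1
        have hwv : w = v := by
          rw [hw, mem_singleton] at hvl
          exact hvl.symm
        subst hwv
        have h2 := hf.sum_eq hΓ hmem
        rw [(isPiece_of_mem hΓ hM.prop hmem).eq_singleton hw, sum_singleton] at h2
        rw [h2, bound]
        have h3 : 0 ≤ ∑ k, Γ.weight (Γ.strand {Sum.inl w} k) :=
          sum_nonneg fun _ _ ↦ weight_nonneg _
        have h4 : 0 < Γ.cst ^ #({Sum.inl w} : Finset (V ⊕ E)).toLeft := by positivity
        positivity
    intro hm
    obtain ⟨m, hm'⟩ : ∃ m, #(least M (Sum.inl v)).toLeft = m + 2 :=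
      ⟨_, (Nat.sub_add_cancel hm).symm⟩
    have h1 := hf.le_sum_toLeft hΓ hM hmem
    rw [← add_sum_erase _ _ hvl] at h1
    have h2 : ∀ w ∈ (least M (Sum.inl v)).toLeft.erase v,
        f (Sum.inl w) ≤ Γ.cst ^ (m + 1) + Γ.cst := by
      intro w hw
      rw [mem_erase, mem_toLeft] at hw
      have hsub := least_subset hmem hw.2
      have hss := hsub.ssubset_of_ne (least_inl_ne hΓ hM hw.1)
      have hmemw := least_mem hΓ hM.prop (Sum.inl w)
      have hvw : v ∉ (least M (Sum.inl w)).toLeft := fun h ↦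
        hss.not_subset (least_subset hmemw (mem_toLeft.1 h))
      have hcard : #(least M (Sum.inl w)).toLeft < #(least M (Sum.inl v)).toLeft :=
        card_lt_card ((toLeft_subset_toLeft hsub).ssubset_of_ne fun h ↦ hvw (h ▸ hvl))
      have hpos : ∀ u ∈ (least M (Sum.inl w)).toLeft, 0 ≤ f (Sum.inl u) := fun u hu ↦
        (ih _ ((card_le_card (least_subset hmemw (mem_toLeft.1 hu))).trans_lt
          (card_lt_card hss)) u rfl).1.le
      have h3 : f (Sum.inl w) ≤ ∑ u ∈ (least M (Sum.inl w)).toLeft, f (Sum.inl u) :=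
        single_le_sum (f := fun u ↦ f (Sum.inl u)) hpos (mem_toLeft.2 (mem_least _))
      have h4 := hf.sum_toLeft_lt hΓ hM hmemw
      have h5 : Γ.cst ^ #(least M (Sum.inl w)).toLeft ≤ Γ.cst ^ (m + 1) :=
        pow_le_pow_right₀ (by linarith) (by omega)
      linarith
    have h3 := sum_le_sum h2
    rw [sum_const, card_erase_of_mem hvl, hm', nsmul_eq_mul] at h3
    rw [hm'] at h1 ⊢
    rw [show m + 2 - 1 = m + 1 by omega] at h3 ⊢
    have hX : Γ.cst ^ 1 ≤ Γ.cst ^ (m + 1) := pow_le_pow_right₀ (by linarith) (by omega)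
    rw [pow_one] at hX
    -- The losses and the target together are `(m + 2) * c ^ (m + 1) + (m + 4) * c`, which is at
    -- most `(2 * m + 6) * c ^ (m + 1)`.
    have hcm : 2 * (m : ℝ) + 6 ≤ Γ.cst := by
      have h6 : m + 3 ≤ Fintype.card (V ⊕ E) := by
        rw [Fintype.card_sum]
        have h7 : #(least M (Sum.inl v)).toLeft ≤ Fintype.card V := card_le_univ _
        obtain ⟨e, -⟩ := strand_univ_nonempty hΓ (Classical.arbitrary K)
        have h8 : 0 < Fintype.card E := Fintype.card_pos_iff.2 ⟨e⟩
        omega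
      have h9 : (m : ℝ) + 3 ≤ Fintype.card (V ⊕ E) := by exact_mod_cast h6
      rw [cst]
      nlinarith [Nat.cast_nonneg (α := ℝ) m]
    have hpow : Γ.cst ^ (m + 2) = Γ.cst * Γ.cst ^ (m + 1) := pow_succ' _ _
    rw [hpow] at h1
    push_cast at h3
    have h10 := mul_le_mul_of_nonneg_right hcm (by positivity : 0 ≤ Γ.cst ^ (m + 1))
    nlinarith [Nat.cast_nonneg (α := ℝ) m]

end VertexPoint

end BundledGraph

namespace BundledGraph

open Finset

/-! ### Strictness of the other inequalities at a vertex -/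

section VertexInequalities

variable {V E K : Type*} {Γ : BundledGraph V E K} [Fintype V] [Fintype E] [Fintype K]
  [DecidableEq V] [DecidableEq E] [DecidableEq K] {M : Set (Finset (V ⊕ E))} {f : V ⊕ E → ℝ}

/-- Choose `v` in `t` with the largest least tube. If that tube missed a node of `t`, then by
connectedness it would miss one adjacent to it, whose least tube would be larger. -/
lemma exists_toLeft_subset_least (hΓ : Γ.IsPiece univ) (hM : Γ.IsTubing M) {t : Finset (V ⊕ E)}
    (ht : Γ.IsPiece t) : ∃ v ∈ t.toLeft, t.toLeft ⊆ (least M (Sum.inl v)).toLeft := by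
  obtain ⟨v, hv, hmax⟩ := t.toLeft.exists_max_image (fun v ↦ #(least M (Sum.inl v))) ht.conn.1
  refine ⟨v, hv, ?_⟩
  rw [← inter_eq_left]
  by_contra hne
  obtain ⟨x, hx, y, hy, hyS, hxy⟩ := ht.conn.2 _ inter_subset_left
    ⟨v, mem_inter.2 ⟨hv, mem_toLeft.2 (mem_least _)⟩⟩ hne
  have hyv : Sum.inl y ∉ least M (Sum.inl v) := fun h ↦
    hyS (mem_inter.2 ⟨hy, mem_toLeft.2 h⟩)
  rcases nested_of_adj hM (least_mem hΓ hM (Sum.inl v)) (least_mem hΓ hM (Sum.inl y))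
    (mem_toLeft.1 (mem_inter.1 hx).2) (mem_least _) (Or.inr hxy) with h | h
  · have hss := h.ssubset_of_ne fun h' ↦ hyv (h' ▸ mem_least _)
    exact (card_lt_card hss).not_ge (hmax y hy)
  · exact hyv (h (mem_least _))

lemma compat_cases {s t : Finset (V ⊕ E)} (h : s = t ∨ Γ.Compat s t) :
    s ⊆ t ∨ t ⊆ s ∨ Γ.Far s t := by
  rcases h with rfl | h | h | h
  · exact Or.inl subset_rfl
  · exact Or.inl h.subset
  · exact Or.inr (Or.inl h.subset)
  · exact Or.inr (Or.inr h)

lemma compat_of_cases {s t : Finset (V ⊕ E)} (h : s ⊆ t ∨ t ⊆ s ∨ Γ.Far s t) :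
    s = t ∨ Γ.Compat s t := by
  rcases h with h | h | h
  · exact compat_of_subset h
  · exact (compat_of_subset h).imp Eq.symm Compat.symm
  · exact Or.inr (Or.inr (Or.inr h))

lemma compat_inter {s t r : Finset (V ⊕ E)} (hs : s = r ∨ Γ.Compat s r)
    (ht : t = r ∨ Γ.Compat t r) : s ∩ t = r ∨ Γ.Compat (s ∩ t) r := by
  apply compat_of_cases
  rcases compat_cases hs with h | h | h
  · exact Or.inl (inter_subset_left.trans h)
  · rcases compat_cases ht with h' | h' | h'
    · exact Or.inl (inter_subset_right.trans h')
    · exact Or.inr (Or.inl (subset_inter h h'))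
    · exact Or.inr (Or.inr fun x y hx hy ↦ h' x y (mem_inter.1 hx).2 hy)
  · exact Or.inr (Or.inr fun x y hx hy ↦ h x y (mem_inter.1 hx).1 hy)

lemma compat_union {s t r : Finset (V ⊕ E)} {z : V} (hzs : Sum.inl z ∈ s) (hzt : Sum.inl z ∈ t)
    (hs : s = r ∨ Γ.Compat s r) (ht : t = r ∨ Γ.Compat t r) :
    s ∪ t = r ∨ Γ.Compat (s ∪ t) r := by
  apply compat_of_cases
  rcases compat_cases hs with h | h | h <;> rcases compat_cases ht with h' | h' | h'
  · exact Or.inl (union_subset h h')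
  · exact Or.inr (Or.inl (h'.trans subset_union_right))
  · exact absurd rfl (h' z z hzt (h hzs)).1
  · exact Or.inr (Or.inl (h.trans subset_union_left))
  · exact Or.inr (Or.inl (h.trans subset_union_left))
  · exact Or.inr (Or.inl (h.trans subset_union_left))
  · exact absurd rfl (h z z hzs (h' hzt)).1
  · exact Or.inr (Or.inl (h'.trans subset_union_right))
  · refine Or.inr (Or.inr fun x y hx hy ↦ ?_)
    rcases mem_union.1 hx with hx | hx
    · exact h x y hx hy
    · exact h' x y hx hy

/-- Induction on the number of tubes of `M` incompatible with `t`. The assumptions on nodes and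
strands make `t` nested with an incompatible `r`, so `t ∩ r` and `t ∪ r` are pieces with fewer
incompatibilities. Adding their inequalities, strict supermodularity and the equality at `r` give
strictness at `t`. -/
lemma IsVertex.bound_lt_of_isInitial (hΓ : Γ.IsPiece univ) (hM : Maximal Γ.IsTubing M)
    (hf : Γ.IsVertex M f) : ∀ n (t : Finset (V ⊕ E)),
      {r ∈ M | ¬ (t = r ∨ Γ.Compat t r)}.ncard = n → Γ.IsPiece t →
      (∃ s ∈ insert univ M, t.toLeft = s.toLeft) → (∀ k, Γ.IsInitial M (Γ.strand t k)) →
      Γ.bound t ≤ ∑ x ∈ t, f x ∧ (t ∉ insert univ M → Γ.bound t < ∑ x ∈ t, f x) := by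
  intro n
  induction n using Nat.strong_induction_on with
  | _ n ih =>
    rintro t rfl ht ⟨s, hs, hts⟩ hinit
    by_cases htM : t ∈ insert univ M
    · exact ⟨(hf.sum_eq hΓ htM).ge, fun h ↦ absurd htM h⟩
    suffices h : Γ.bound t < ∑ x ∈ t, f x from ⟨h.le, fun _ ↦ h⟩
    obtain ⟨r, hr, hrt⟩ : ∃ r ∈ M, ¬ (t = r ∨ Γ.Compat t r) := by
      by_contra! h
      exact htM (mem_insert_univ_of_compat hM ht fun r hr ↦ by
        have := h r hr
        tauto)
    have hr' : r ∈ insert univ M := Or.inr hr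
    have hrp := isPiece_of_mem hΓ hM.prop hr'
    have hn1 : ¬ t ⊆ r := fun h ↦ hrt (compat_of_cases (Or.inl h))
    have hn2 : ¬ r ⊆ t := fun h ↦ hrt (compat_of_cases (Or.inr (Or.inl h)))
    have hV : t.toLeft ⊆ r.toLeft ∨ r.toLeft ⊆ t.toLeft := by
      rw [hts]
      rcases compat_cases (compat_of_mem hM.prop hs hr') with h | h | h
      · exact Or.inl (toLeft_subset_toLeft h)
      · exact Or.inr (toLeft_subset_toLeft h)
      · refine absurd (compat_of_cases (Or.inr (Or.inr fun x y hx hy ↦ h x y ?_ hy))) hrt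
        rw [← mem_toLeft, ← hts]
        exact mem_toLeft.2 hx
    have hK : ∀ k, Γ.strand t k ⊆ Γ.strand r k ∨ Γ.strand r k ⊆ Γ.strand t k := fun k ↦
      (hinit k).nested hΓ hM.prop (Γ.strand_mono (subset_univ t) k)
        (Γ.strand_mono (subset_univ r) k) (isInitial_strand hr' k)
    obtain ⟨z, hzt, hzr⟩ : ∃ z, Sum.inl z ∈ t ∧ Sum.inl z ∈ r := by
      rcases hV with h | h
      · obtain ⟨z, hz⟩ := ht.nonempty
        exact ⟨z, hz, mem_toLeft.1 (h (mem_toLeft.2 hz))⟩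
      · obtain ⟨z, hz⟩ := hrp.nonempty
        exact ⟨z, mem_toLeft.1 (h (mem_toLeft.2 hz)), hz⟩
    have hlt : ∀ w : Finset (V ⊕ E), (w = r ∨ Γ.Compat w r) →
        (∀ q ∈ M, (t = q ∨ Γ.Compat t q) → (w = q ∨ Γ.Compat w q)) →
        {r ∈ M | ¬ (w = r ∨ Γ.Compat w r)}.ncard < {r ∈ M | ¬ (t = r ∨ Γ.Compat t r)}.ncard := by
      intro w hwr hw
      refine Set.ncard_lt_ncard ⟨fun q hq ↦ ⟨hq.1, fun h ↦ hq.2 (hw q hq.1 h)⟩, fun h ↦ ?_⟩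
        (Set.toFinite _)
      exact (h ⟨hr, hrt⟩).2 hwr
    have hpieces : Γ.IsPiece (t ∩ r) ∧ Γ.IsPiece (t ∪ r) ∧
        Γ.bound t + Γ.bound r < Γ.bound (t ∩ r) + Γ.bound (t ∪ r) ∧
        (∃ s ∈ insert univ M, (t ∩ r).toLeft = s.toLeft) ∧
        ∃ s ∈ insert univ M, (t ∪ r).toLeft = s.toLeft := by
      rcases hV with h | h
      · refine ⟨ht.inter hrp h hK, ht.union hrp h, bound_add_bound_lt h hK hn1 hn2,
          ⟨s, hs, ?_⟩, ⟨r, hr', ?_⟩⟩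
        · rw [toLeft_inter, inter_eq_left.2 h, hts]
        · rw [toLeft_union, union_eq_right.2 h]
      · have hK' := fun k ↦ (hK k).symm
        rw [inter_comm, union_comm, add_comm]
        refine ⟨hrp.inter ht h hK', hrp.union ht h, bound_add_bound_lt h hK' hn2 hn1,
          ⟨r, hr', ?_⟩, ⟨s, hs, ?_⟩⟩
        · rw [toLeft_inter, inter_eq_left.2 h]
        · rw [toLeft_union, union_eq_right.2 h, hts]
    obtain ⟨hp1, hp2, hbd, hl1, hl2⟩ := hpieces
    have hi : ∀ k, Γ.IsInitial M (Γ.strand (t ∩ r) k) := fun k ↦ by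
      rw [strand_inter]
      rcases hK k with h | h
      · rw [inter_eq_left.2 h]; exact hinit k
      · rw [inter_eq_right.2 h]; exact isInitial_strand hr' k
    have hu : ∀ k, Γ.IsInitial M (Γ.strand (t ∪ r) k) := fun k ↦ by
      rw [strand_union]
      rcases hK k with h | h
      · rw [union_eq_right.2 h]; exact isInitial_strand hr' k
      · rw [union_eq_left.2 h]; exact hinit k
    have h1 := (ih _ (hlt (t ∩ r) (compat_of_cases (Or.inl inter_subset_right)) fun q hq h ↦
      compat_inter h (compat_of_mem hM.prop hr' (Or.inr hq))) _ rfl hp1 hl1 hi).1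
    have h2 := (ih _ (hlt (t ∪ r) (compat_of_cases (Or.inr (Or.inl subset_union_right)))
      fun q hq h ↦ compat_union hzt hzr h (compat_of_mem hM.prop hr' (Or.inr hq))) _ rfl hp2
      hl2 hu).1
    have h3 := hf.sum_eq hΓ hr'
    have h4 := sum_union_inter (s₁ := t) (s₂ := r) (f := f)
    linarith

/-- At the vertex of a maximal tubing the inequalities of all other tubes are strict. -/
theorem IsVertex.bound_lt_sum [Nonempty K] (hΓ : Γ.IsPiece univ) (hM : Maximal Γ.IsTubing M)
    (hf : Γ.IsVertex M f) {t : Finset (V ⊕ E)} (ht : Γ.IsPiece t) (htM : t ∉ insert univ M) :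
    Γ.bound t < ∑ x ∈ t, f x := by
  have hc := nine_le_cst hΓ
  have hcod := sq_card_compl_lt_cst (Γ := Γ) ht.nonempty_items
  have hw := fun k ↦ hf.weight_le_sum hΓ hM (Γ.strand_mono (subset_univ t) k)
  obtain ⟨v, hv, hvt⟩ := exists_toLeft_subset_least hΓ hM.prop ht
  have hmem := least_mem hΓ hM.prop (Sum.inl v)
  by_cases hl : t.toLeft = (least M (Sum.inl v)).toLeft
  · by_cases hinit : ∀ k, Γ.IsInitial M (Γ.strand t k)
    · exact (hf.bound_lt_of_isInitial hΓ hM _ t rfl ht ⟨_, hmem, hl⟩ hinit).2 htM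
    · push Not at hinit
      obtain ⟨k, hk⟩ := hinit
      -- The strand gains `3 * c`, the nodes lose at most `2 * c`, and the square term is below `c`.
      have h1 := hf.le_sum_of_not_isInitial hΓ hM (Γ.strand_mono (subset_univ t) k) hk
      have h2 := sum_le_sum fun l (_ : l ∈ univ.erase k) ↦ hw l
      have h3 := hf.le_sum_toLeft hΓ hM hmem
      rw [← hl] at h3
      have h4 : Γ.weight (Γ.strand t k) ≤ Γ.cst ^ #(Γ.strand t k) := by
        rw [weight]
        split_ifs
        · exact le_rfl
        · exact pow_nonneg cst_nonneg _
      rw [Γ.sum_eq_sum_toLeft_add_sum_strand, bound, ← add_sum_erase _ _ (mem_univ k),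
        ← add_sum_erase univ (fun k ↦ ∑ e ∈ Γ.strand t k, f (Sum.inr e)) (mem_univ k)]
      linarith
  · have hlt : #t.toLeft < #(least M (Sum.inl v)).toLeft :=
      card_lt_card (hvt.ssubset_of_ne hl)
    have hpos := ht.conn.1.card_pos
    have h1 := (hf.inl_bounds hΓ hM _ v rfl).2 (by omega)
    have h2 : f (Sum.inl v) ≤ ∑ v ∈ t.toLeft, f (Sum.inl v) :=
      single_le_sum (f := fun v ↦ f (Sum.inl v))
        (fun w _ ↦ (hf.inl_bounds hΓ hM _ w rfl).1.le) hv
    have h3 : Γ.cst ^ #t.toLeft ≤ Γ.cst ^ (#(least M (Sum.inl v)).toLeft - 1) :=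
      pow_le_pow_right₀ (by linarith) (by omega)
    have h4 := sum_le_sum fun k (_ : k ∈ univ) ↦ hw k
    rw [Γ.sum_eq_sum_toLeft_add_sum_strand, bound]
    linarith

/-- Every tubing is the set of tight tubes at some point. -/
theorem exists_tight_eq [Nonempty K] (hΓ : Γ.IsPiece univ) {U : Set (Finset (V ⊕ E))}
    (hU : Γ.IsTubing U) : ∃ p ∈ Γ.region ∅, ∀ t, Γ.IsTube t →
      (∑ x ∈ t, p x = Γ.bound t ↔ t ∈ U) := by
  classical
  obtain ⟨M, hUM, hM⟩ := hU.exists_maximal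
  obtain ⟨f, hf⟩ := exists_isVertex hΓ hM.prop
  -- The direction `d` keeps the sums over `U` and increases those over the rest of `M`. A short
  -- step along it preserves the strict inequalities outside `M`.
  obtain ⟨d, hd1, hd2, hd3⟩ := exists_sums_eq hΓ hM.prop
    (fun t ↦ if t ∈ U then 0 else 1) 0 (fun _ ↦ 0)
  have hev : ∀ᶠ ε : ℝ in nhdsWithin 0 (Set.Ioi 0), ∀ t ∈ (univ : Finset (Finset (V ⊕ E))),
      Γ.IsTube t → t ∉ M → Γ.bound t < ∑ x ∈ t, (f + ε • d) x := by
    rw [Filter.eventually_all_finset]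
    intro t _
    by_cases ht : Γ.IsTube t ∧ t ∉ M
    · have h1 : Γ.bound t < ∑ x ∈ t, f x := hf.bound_lt_sum hΓ hM ht.1.1 fun h ↦
        h.elim ht.1.2 ht.2
      have h2 : Filter.Tendsto (fun ε : ℝ ↦ ∑ x ∈ t, (f + ε • d) x) (nhdsWithin 0 (Set.Ioi 0))
          (nhds (∑ x ∈ t, f x)) := by
        have hcont : Continuous fun ε : ℝ ↦ ∑ x ∈ t, (f + ε • d) x := by
          simp only [Pi.add_apply, Pi.smul_apply, smul_eq_mul]
          fun_prop
        have := (hcont.tendsto 0).mono_left (nhdsWithin_le_nhds (s := Set.Ioi 0))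
        simpa using this
      filter_upwards [h2.eventually (lt_mem_nhds h1)] with ε hε _ _ using hε
    · exact Filter.Eventually.of_forall fun ε h1 h2 ↦ absurd ⟨h1, h2⟩ ht
  obtain ⟨ε, hε, hε0⟩ := (hev.and self_mem_nhdsWithin).exists
  have hsum : ∀ s : Finset (V ⊕ E), ∑ x ∈ s, (f + ε • d) x = ∑ x ∈ s, f x + ε * ∑ x ∈ s, d x := by
    intro s
    simp [sum_add_distrib, mul_sum]
  have hsumM : ∀ t ∈ M, ∑ x ∈ t, (f + ε • d) x = Γ.bound t + ε * if t ∈ U then 0 else 1 := by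
    intro t ht
    rw [hsum, hf.sum_tube t ht, hd1 t ht]
  refine ⟨f + ε • d, ⟨?_, fun k ↦ ?_, fun t ht _ ↦ ?_⟩, fun t ht ↦ ?_⟩
  · simp [sum_add_distrib, ← mul_sum, hd2, hf.sum_nodes]
  · simp [sum_add_distrib, ← mul_sum, hd3, hf.sum_bundle]
  · by_cases htM : t ∈ M
    · rw [hsumM t htM]
      split_ifs <;> linarith
    · exact (hε t (mem_univ t) ht htM).le
  · by_cases htM : t ∈ M
    · rw [hsumM t htM]
      split_ifs with h
      · simp [h]
      · simp [h, hε0.ne']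
    · exact iff_of_false (hε t (mem_univ t) ht htM).ne' fun h ↦ htM (hUM h)

end VertexInequalities

end BundledGraph

namespace BundledGraph

open Finset

/-! ### Faces of the region and sets of tight tubes -/

section Faces

variable {V E K : Type*} (Γ : BundledGraph V E K) [Fintype V] [Fintype E] [Fintype K]
  [DecidableEq V] [DecidableEq E] [DecidableEq K]

/-- The tubes whose halfspaces define `Γ.region D`. -/
def keptTubes (D : Set V) : Set (Finset (V ⊕ E)) :=
  {t | Γ.IsTube t ∧ ∀ d ∈ D, t ≠ {Sum.inl d}}

/-- The part of the region where the inequalities of the tubes in `U` are tight. -/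
def face (D : Set V) (U : Set (Finset (V ⊕ E))) : Set (V ⊕ E → ℝ) :=
  {p ∈ Γ.region D | ∀ t ∈ U, ∑ x ∈ t, p x = Γ.bound t}

/-- The tubes that are tight at `p`. -/
def tight (D : Set V) (p : V ⊕ E → ℝ) : Set (Finset (V ⊕ E)) :=
  {t ∈ Γ.keptTubes D | ∑ x ∈ t, p x = Γ.bound t}

variable {Γ} {D : Set V} {p q d : V ⊕ E → ℝ}

lemma bound_le_of_mem_keptTubes (hp : p ∈ Γ.region D) {t : Finset (V ⊕ E)}
    (ht : t ∈ Γ.keptTubes D) : Γ.bound t ≤ ∑ x ∈ t, p x := hp.2.2 t ht.1 ht.2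

lemma sum_add_smul (s : Finset (V ⊕ E)) (p d : V ⊕ E → ℝ) (ε : ℝ) :
    ∑ x ∈ s, (p + ε • d) x = ∑ x ∈ s, p x + ε * ∑ x ∈ s, d x := by
  simp [sum_add_distrib, mul_sum]

lemma convex_region : Convex ℝ (Γ.region D) := by
  rintro p hp q hq a b ha hb hab
  refine ⟨?_, fun k ↦ ?_, fun t ht htD ↦ ?_⟩
  · simp only [Pi.add_apply, Pi.smul_apply, smul_eq_mul, sum_add_distrib, ← mul_sum, hp.1, hq.1]
    rw [← add_mul, hab, one_mul]
  · simp only [Pi.add_apply, Pi.smul_apply, smul_eq_mul, sum_add_distrib, ← mul_sum, hp.2.1,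
      hq.2.1]
    rw [← add_mul, hab, one_mul]
  · simp only [Pi.add_apply, Pi.smul_apply, smul_eq_mul, sum_add_distrib, ← mul_sum]
    have h1 := mul_le_mul_of_nonneg_left (hp.2.2 t ht htD) ha
    have h2 := mul_le_mul_of_nonneg_left (hq.2.2 t ht htD) hb
    calc Γ.bound t = a * Γ.bound t + b * Γ.bound t := by rw [← add_mul, hab, one_mul]
      _ ≤ _ := add_le_add h1 h2

/-- Along `d` the equations and the tight inequalities stay equalities, and the finitely many slack
inequalities survive a short step. -/
lemma exists_add_smul_mem_region (hp : p ∈ Γ.region D)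
    (hd : d ∈ LinearMap.ker (Γ.sumsMap (Γ.tight D p))) : ∃ ε : ℝ, 0 < ε ∧ p + ε • d ∈ Γ.region D := by
  rw [mem_ker_sumsMap] at hd
  have hev : ∀ᶠ ε : ℝ in nhdsWithin 0 (Set.Ioi 0), ∀ t ∈ (univ : Finset (Finset (V ⊕ E))),
      t ∈ Γ.keptTubes D → Γ.bound t ≤ ∑ x ∈ t, (p + ε • d) x := by
    rw [Filter.eventually_all_finset]
    intro t _
    by_cases ht : t ∈ Γ.keptTubes D
    swap
    · exact Filter.Eventually.of_forall fun ε h1 ↦ absurd h1 ht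
    by_cases htt : ∑ x ∈ t, p x = Γ.bound t
    · refine Filter.Eventually.of_forall fun ε _ ↦ ?_
      rw [sum_add_smul, hd.1 t ⟨ht, htt⟩, htt]
      simp
    · have h1 : Γ.bound t < ∑ x ∈ t, p x :=
        (bound_le_of_mem_keptTubes hp ht).lt_of_ne fun h ↦ htt h.symm
      have h2 : Filter.Tendsto (fun ε : ℝ ↦ ∑ x ∈ t, (p + ε • d) x) (nhdsWithin 0 (Set.Ioi 0))
          (nhds (∑ x ∈ t, p x)) := by
        have hcont : Continuous fun ε : ℝ ↦ ∑ x ∈ t, (p + ε • d) x := by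
          simp only [Pi.add_apply, Pi.smul_apply, smul_eq_mul]
          fun_prop
        have := (hcont.tendsto 0).mono_left (nhdsWithin_le_nhds (s := Set.Ioi 0))
        simpa using this
      filter_upwards [h2.eventually (lt_mem_nhds h1)] with ε hε _ using hε.le
  obtain ⟨ε, hε, hε0⟩ := (hev.and self_mem_nhdsWithin).exists
  refine ⟨ε, hε0, ?_, fun k ↦ ?_, fun t ht htD ↦ hε t (mem_univ t) ⟨ht, htD⟩⟩
  · simp [sum_add_distrib, ← mul_sum, hd.2.1, hp.1]
  · simp [sum_add_distrib, ← mul_sum, hd.2.2, hp.2.1]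

/-- The sum of the tube sums over `U` is at least the sum of the bounds, with equality only if each
term is tight. Its negative is therefore an exposing functional. -/
lemma isExposed_face {U : Set (Finset (V ⊕ E))} (hU : U ⊆ Γ.keptTubes D) :
    IsExposed ℝ (Γ.region D) (Γ.face D U) := by
  classical
  rintro ⟨y₀, hy₀⟩
  let l : StrongDual ℝ (V ⊕ E → ℝ) :=
    -∑ t ∈ U.toFinset, ∑ x ∈ t, ContinuousLinearMap.proj (R := ℝ) (φ := fun _ : V ⊕ E ↦ ℝ) x
  have hl : ∀ y, l y = -∑ t ∈ U.toFinset, ∑ x ∈ t, y x := by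
    intro y
    simp [l]
  refine ⟨l, ?_⟩
  ext x
  simp only [hl, neg_le_neg_iff]
  constructor
  · rintro ⟨hx, hxU⟩
    refine ⟨hx, fun y hy ↦ sum_le_sum fun t ht ↦ ?_⟩
    rw [Set.mem_toFinset] at ht
    rw [hxU t ht]
    exact bound_le_of_mem_keptTubes hy (hU ht)
  · rintro ⟨hx, hmax⟩
    refine ⟨hx, fun t ht ↦ ?_⟩
    have h1 : ∀ s ∈ U.toFinset, Γ.bound s ≤ ∑ y ∈ s, x y := fun s hs ↦
      bound_le_of_mem_keptTubes hx (hU (Set.mem_toFinset.1 hs))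
    have h2 : ∑ s ∈ U.toFinset, ∑ y ∈ s, y₀ y = ∑ s ∈ U.toFinset, Γ.bound s :=
      sum_congr rfl fun s hs ↦ hy₀.2 s (Set.mem_toFinset.1 hs)
    have h3 := hmax y₀ hy₀.1
    rw [h2] at h3
    exact ((sum_eq_sum_iff_of_le h1).1 (le_antisymm (sum_le_sum h1) h3) t
      (Set.mem_toFinset.2 ht)).symm

lemma sub_mem_ker {U : Set (Finset (V ⊕ E))} (hp : p ∈ Γ.face D U) (hq : q ∈ Γ.face D U) :
    p - q ∈ LinearMap.ker (Γ.sumsMap U) := by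
  rw [mem_ker_sumsMap]
  refine ⟨fun t ht ↦ ?_, ?_, fun k ↦ ?_⟩
  · simp [sum_sub_distrib, hp.2 t ht, hq.2 t ht]
  · simp [sum_sub_distrib, hp.1.1, hq.1.1]
  · simp [sum_sub_distrib, hp.1.2.1, hq.1.2.1]

lemma mem_face_tight (hp : p ∈ Γ.region D) : p ∈ Γ.face D (Γ.tight D p) :=
  ⟨hp, fun _ ht ↦ ht.2⟩

/-- Every nonempty exposed face is the face of the tight tubes of one of its points. -/
lemma exists_eq_face_tight {F : Set (V ⊕ E → ℝ)} (hF : IsExposed ℝ (Γ.region D) F)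
    (hne : F.Nonempty) : ∃ q ∈ Γ.region D, F = Γ.face D (Γ.tight D q) := by
  obtain ⟨l, hl⟩ := hF hne
  have hFP : F ⊆ Γ.region D := by rw [hl]; exact fun x hx ↦ hx.1
  -- A point with the fewest tight tubes plays the role of a relative interior point of `F`.
  obtain ⟨q, hq, hmin⟩ : ∃ q ∈ F, ∀ x ∈ F, (Γ.tight D q).ncard ≤ (Γ.tight D x).ncard := by
    obtain ⟨n, hn, hmin⟩ := exists_minimal_of_wellFoundedLT
      (fun n : ℕ ↦ ∃ x ∈ F, (Γ.tight D x).ncard = n) (hne.imp' _ fun x hx ↦ ⟨x, hx, rfl⟩)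
    obtain ⟨q, hq, rfl⟩ := hn
    refine ⟨q, hq, fun x hx ↦ ?_⟩
    by_contra! h
    exact h.not_ge (hmin ⟨x, hx, rfl⟩ h.le)
  refine ⟨q, hFP hq, Set.Subset.antisymm ?_ ?_⟩
  · intro x hx
    refine ⟨hFP hx, ?_⟩
    -- A tube tight at the midpoint is tight at both points, so by minimality the tubes tight at `q`
    -- are tight at `x`.
    have hm : (1 / 2 : ℝ) • q + (1 / 2 : ℝ) • x ∈ F :=
      hF.convex convex_region hq hx (by norm_num) (by norm_num) (by norm_num)
    have hsub : Γ.tight D ((1 / 2 : ℝ) • q + (1 / 2 : ℝ) • x) ⊆ Γ.tight D q ∩ Γ.tight D x := by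
      rintro t ⟨ht, hte⟩
      have h1 := bound_le_of_mem_keptTubes (hFP hq) ht
      have h2 := bound_le_of_mem_keptTubes (hFP hx) ht
      simp only [Pi.add_apply, Pi.smul_apply, smul_eq_mul, sum_add_distrib, ← mul_sum] at hte
      exact ⟨⟨ht, by linarith⟩, ht, by linarith⟩
    have heq := Set.eq_of_subset_of_ncard_le (hsub.trans Set.inter_subset_left) (hmin _ hm)
      (Set.toFinite _)
    intro t ht
    rw [← heq] at ht
    exact (hsub ht).2.2
  · intro x hx
    -- From `q` one can move a little further away from `x` within the region. As the functional is
    -- maximal at `q`, it cannot be smaller at `x`.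
    obtain ⟨ε, hε, hmem⟩ := exists_add_smul_mem_region (hFP hq)
      (sub_mem_ker (mem_face_tight (hFP hq)) hx)
    have hqmax : ∀ y ∈ Γ.region D, l y ≤ l q := by
      rw [hl] at hq
      exact hq.2
    have h1 := hqmax _ hmem
    rw [map_add, map_smul, map_sub, smul_eq_mul] at h1
    have h2 : l q ≤ l x := by
      by_contra! h
      nlinarith [mul_pos hε (sub_pos.2 h)]
    rw [hl]
    exact ⟨hx.1, fun y hy ↦ (hqmax y hy).trans h2⟩

/-- From `q` a short step is possible in every direction that keeps the tight sums, so the face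
spans the whole kernel. -/
lemma vectorSpan_face_tight (hq : q ∈ Γ.region D) :
    vectorSpan ℝ (Γ.face D (Γ.tight D q)) = LinearMap.ker (Γ.sumsMap (Γ.tight D q)) := by
  apply le_antisymm
  · rw [vectorSpan_def, Submodule.span_le]
    rintro _ ⟨x, hx, y, hy, rfl⟩
    exact sub_mem_ker hx hy
  · intro d hd
    obtain ⟨ε, hε, hmem⟩ := exists_add_smul_mem_region hq hd
    rw [mem_ker_sumsMap] at hd
    have hface : q + ε • d ∈ Γ.face D (Γ.tight D q) :=
      ⟨hmem, fun t ht ↦ by rw [sum_add_smul, hd.1 t ht, ht.2]; simp⟩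
    have h := vsub_mem_vectorSpan ℝ hface (mem_face_tight hq)
    rw [vsub_eq_sub, add_sub_cancel_left] at h
    have h' := Submodule.smul_mem _ ε⁻¹ h
    rwa [smul_smul, inv_mul_cancel₀ hε.ne', one_smul] at h'

lemma region_anti {D D' : Set V} (h : D ⊆ D') : Γ.region D ⊆ Γ.region D' := fun _ hp ↦
  ⟨hp.1, hp.2.1, fun t ht htD ↦ hp.2.2 t ht fun d hd ↦ htD d (h hd)⟩

lemma exists_tight_eq_of_subset [Nonempty K] (hΓ : Γ.IsPiece univ) {U : Set (Finset (V ⊕ E))}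
    (hU : Γ.IsTubing U) (hUD : U ⊆ Γ.keptTubes D) : ∃ p ∈ Γ.region D, Γ.tight D p = U := by
  obtain ⟨p, hp, h⟩ := exists_tight_eq hΓ hU
  refine ⟨p, region_anti (Set.empty_subset D) hp, ?_⟩
  ext t
  exact ⟨fun ht ↦ (h t ht.1.1).1 ht.2, fun ht ↦ ⟨hUD ht, (h t (hU.1 t ht)).2 ht⟩⟩

lemma isTubing_tight [Nonempty K] (hΓ : Γ.IsPiece univ)
    (hleaf : ∀ d ∈ D, ∀ x y, Γ.Adj d x → Γ.Adj d y → x = y) (hp : p ∈ Γ.region D) :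
    Γ.IsTubing (Γ.tight D p) :=
  ⟨fun _ ht ↦ ht.1.1, fun _ hs _ ht hne ↦ compat_of_tight hΓ hleaf hp hs.1.1.1 ht.1.1.1 hs.1.2
    ht.1.2 hs.2 ht.2 hne⟩

lemma face_nonempty [Nonempty K] (hΓ : Γ.IsPiece univ) {U : Set (Finset (V ⊕ E))}
    (hU : Γ.IsTubing U) (hUD : U ⊆ Γ.keptTubes D) : (Γ.face D U).Nonempty := by
  obtain ⟨p, hp, rfl⟩ := exists_tight_eq_of_subset hΓ hU hUD
  exact ⟨p, mem_face_tight hp⟩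

lemma face_subset_face_iff [Nonempty K] (hΓ : Γ.IsPiece univ) {T U : Set (Finset (V ⊕ E))}
    (hT : Γ.IsTubing T) (hTD : T ⊆ Γ.keptTubes D) (hUD : U ⊆ Γ.keptTubes D) :
    Γ.face D T ⊆ Γ.face D U ↔ U ⊆ T := by
  refine ⟨fun h ↦ ?_, fun h p hp ↦ ⟨hp.1, fun t ht ↦ hp.2 t (h ht)⟩⟩
  obtain ⟨p, hp, rfl⟩ := exists_tight_eq_of_subset hΓ hT hTD
  intro t ht
  exact ⟨hUD ht, (h (mem_face_tight hp)).2 t ht⟩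

lemma finrank_vectorSpan_face [Nonempty K] (hΓ : Γ.IsPiece univ) {U : Set (Finset (V ⊕ E))}
    (hU : Γ.IsTubing U) (hUD : U ⊆ Γ.keptTubes D) :
    Module.finrank ℝ (vectorSpan ℝ (Γ.face D U)) + U.ncard + 1 + Fintype.card K =
      Fintype.card V + Fintype.card E := by
  obtain ⟨p, hp, rfl⟩ := exists_tight_eq_of_subset hΓ hU hUD
  rw [vectorSpan_face_tight hp, finrank_ker_sumsMap hΓ hU, Fintype.card_sum]

end Faces

end BundledGraph

namespace BundledGraph

open Finset

/-! ### Compactness, extreme points and unboundedness -/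

section Hull

variable {V E K : Type*} {Γ : BundledGraph V E K} [Fintype V] [Fintype E] [Fintype K]
  [DecidableEq V] [DecidableEq E] [DecidableEq K] {M : Set (Finset (V ⊕ E))} {f : V ⊕ E → ℝ}
  {D : Set V}

lemma isClosed_region : IsClosed (Γ.region D) := by
  have h : Γ.region D = {p | ∑ v, p (Sum.inl v) = Γ.cst ^ Fintype.card V} ∩
      ((⋂ k, {p | ∑ e ∈ Γ.strand univ k, p (Sum.inr e) = Γ.cst ^ #(Γ.strand univ k)}) ∩
      ⋂ t ∈ Γ.keptTubes D, {p | Γ.bound t ≤ ∑ x ∈ t, p x}) := by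
    ext p
    simp only [region, keptTubes, Set.mem_ofPred_eq, Set.mem_inter_iff, Set.mem_iInter, and_imp]
  rw [h]
  refine (isClosed_eq (by fun_prop) (by fun_prop)).inter ((isClosed_iInter fun k ↦
    isClosed_eq (by fun_prop) (by fun_prop)).inter
    (isClosed_biInter fun t _ ↦ isClosed_le (by fun_prop) (by fun_prop)))

/-- When no singleton is omitted all coordinates are nonnegative, and the node and bundle equations
bound them from above. -/
lemma isCompact_region (hΓ : Γ.IsPiece univ) : IsCompact (Γ.region ∅) := by
  refine (isCompact_Icc (a := (0 : V ⊕ E → ℝ)) (b := Sum.elim (fun _ ↦ Γ.cst ^ Fintype.card V)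
    fun e ↦ Γ.cst ^ #(Γ.strand univ (Γ.bundle e)))).of_isClosed_subset isClosed_region ?_
  intro p hp
  have hv : ∀ v, 0 ≤ p (Sum.inl v) := by
    intro v
    have h := cst_pow_le_sum hΓ hp (connSet_singleton v) (by simp)
    rw [sum_singleton] at h
    exact (pow_nonneg cst_nonneg _).trans h
  have he : ∀ e, 0 ≤ p (Sum.inr e) := by
    intro e
    have h := weight_le_sum hΓ hp (k := Γ.bundle e) (S := {e}) (by simp)
    rw [sum_singleton] at h
    exact (weight_nonneg _).trans h
  refine ⟨?_, ?_⟩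
  · rintro (v | e)
    · exact hv v
    · exact he e
  · rintro (v | e)
    · rw [Sum.elim_inl, ← hp.1]
      exact single_le_sum (f := fun v ↦ p (Sum.inl v)) (fun v _ ↦ hv v) (mem_univ v)
    · rw [Sum.elim_inr, ← hp.2.1]
      exact single_le_sum (f := fun e ↦ p (Sum.inr e)) (fun e _ ↦ he e) (by simp)

lemma IsVertex.mem_region [Nonempty K] (hΓ : Γ.IsPiece univ) (hM : Maximal Γ.IsTubing M)
    (hf : Γ.IsVertex M f) : f ∈ Γ.region ∅ := by
  refine ⟨hf.sum_nodes, hf.sum_bundle, fun t ht _ ↦ ?_⟩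
  by_cases htM : t ∈ insert univ M
  · exact (hf.sum_eq hΓ htM).ge
  · exact (hf.bound_lt_sum hΓ hM ht.1 htM).le

lemma exists_isVertex_of_mem_extremePoints [Nonempty K] (hΓ : Γ.IsPiece univ) {p : V ⊕ E → ℝ}
    (hp : p ∈ (Γ.region ∅).extremePoints ℝ) : ∃ M, Maximal Γ.IsTubing M ∧ Γ.IsVertex M p := by
  classical
  rw [mem_extremePoints] at hp
  obtain ⟨hp, hext⟩ := hp
  obtain ⟨M, hUM, hM⟩ := (isTubing_tight hΓ (by simp) hp).exists_maximal
  -- If some tube of `M` were not tight, `d` would be a nonzero direction in which `p` can move both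
  -- ways, against extremality.
  obtain ⟨d, hd1, hd2, hd3⟩ := exists_sums_eq hΓ hM.prop
    (fun t ↦ if t ∈ Γ.tight ∅ p then 0 else 1) 0 (fun _ ↦ 0)
  have hker : d ∈ LinearMap.ker (Γ.sumsMap (Γ.tight ∅ p)) :=
    mem_ker_sumsMap.2 ⟨fun t ht ↦ by rw [hd1 t (hUM ht), if_pos ht], hd2, hd3⟩
  obtain ⟨ε, hε, h1⟩ := exists_add_smul_mem_region hp hker
  obtain ⟨δ, hδ, h2⟩ := exists_add_smul_mem_region hp (neg_mem hker)
  have hseg : p ∈ openSegment ℝ (p + ε • d) (p + δ • -d) := by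
    refine ⟨δ / (ε + δ), ε / (ε + δ), by positivity, by positivity, by field_simp; ring, ?_⟩
    ext x
    simp only [Pi.add_apply, Pi.smul_apply, Pi.neg_apply, smul_eq_mul]
    field_simp
    ring
  have hzero : ε • d = 0 := by simpa using (hext _ h1 _ h2 hseg).1
  have hd : d = 0 := (smul_eq_zero.1 hzero).resolve_left hε.ne'
  refine ⟨M, hM, fun t ht ↦ ?_, hp.1, hp.2.1⟩
  by_contra hne
  have := hd1 t ht
  rw [if_neg fun h ↦ hne h.2, hd] at this
  simp at this

/-- The region of all tubes is the convex hull of the vertices of the maximal tubings. -/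
theorem convexHull_isVertex [Nonempty K] (hΓ : Γ.IsPiece univ) :
    convexHull ℝ {p | ∃ M, Maximal Γ.IsTubing M ∧ Γ.IsVertex M p} = Γ.region ∅ := by
  refine Set.Subset.antisymm (convexHull_min ?_ convex_region) ?_
  · rintro p ⟨M, hM, hp⟩
    exact hp.mem_region hΓ hM
  · have hfin : {p | ∃ M, Maximal Γ.IsTubing M ∧ Γ.IsVertex M p}.Finite := by
      have : {p | ∃ M, Maximal Γ.IsTubing M ∧ Γ.IsVertex M p} =
          ⋃ M ∈ {M | Maximal Γ.IsTubing M}, {p | Γ.IsVertex M p} := by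
        ext p
        simp
      rw [this]
      exact (Set.toFinite _).biUnion fun M hM ↦
        Set.Subsingleton.finite fun p hp q hq ↦ hp.eq hΓ hM hq
    -- Krein–Milman; the closure can be dropped because the hull of finitely many vertices is
    -- closed.
    rw [← closure_convexHull_extremePoints (isCompact_region hΓ) convex_region,
      ← hfin.isCompact_convexHull (𝕜 := ℝ) |>.isClosed.closure_eq]
    exact closure_mono (convexHull_mono fun p hp ↦ exists_isVertex_of_mem_extremePoints hΓ hp)

/-- Shift weight from `d` to its only neighbour `n`. A kept tube through `d` is not the singleton of
`d`, so it contains `n` and its sum does not change; the sums over other tubes do not decrease. -/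
lemma not_isBounded_region [Nonempty K] (hΓ : Γ.IsPiece univ)
    (hleaf : ∀ d ∈ D, ∀ x y, Γ.Adj d x → Γ.Adj d y → x = y) (hD : ∃ d ∈ D, ∃ n, Γ.Adj d n) :
    ¬ Bornology.IsBounded (Γ.region D) := by
  obtain ⟨d, hd, n, hdn⟩ := hD
  obtain ⟨p, hp, -⟩ := exists_tight_eq hΓ (U := ∅) ⟨by simp, by simp⟩
  have hp := region_anti (Set.empty_subset D) hp
  set w : V ⊕ E → ℝ := Pi.single (Sum.inl n) 1 - Pi.single (Sum.inl d) 1 with hw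
  have hmem : ∀ c : ℝ, 0 ≤ c → p + c • w ∈ Γ.region D := by
    intro c hc
    refine ⟨?_, fun k ↦ ?_, fun t ht htD ↦ ?_⟩
    · have h0 : ∑ v, w (Sum.inl v) = 0 := by
        simp [hw, Pi.single_apply]
      simp [sum_add_distrib, ← mul_sum, h0, hp.1]
    · have h0 : ∑ e ∈ Γ.strand univ k, w (Sum.inr e) = 0 := by
        simp [hw]
      simp [sum_add_distrib, ← mul_sum, h0, hp.2.1]
    · have h0 : 0 ≤ ∑ x ∈ t, w x := by
        simp only [hw, Pi.sub_apply, Pi.single_apply, sum_sub_distrib, sum_ite_eq']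
        by_cases hdt : Sum.inl d ∈ t
        · obtain ⟨m, hm, hdm⟩ := ht.1.exists_adj hdt (htD d hd)
          obtain rfl := hleaf d hd n m hdn hdm
          simp [hdt, hm]
        · simp only [hdt, if_false, sub_zero]
          split_ifs <;> norm_num
      rw [sum_add_smul]
      linarith [hp.2.2 t ht htD, mul_nonneg hc h0]
  intro hb
  obtain ⟨C, hC⟩ := isBounded_iff_forall_norm_le.1 hb
  have h1 := (norm_le_pi_norm _ (Sum.inl n)).trans
    (hC _ (hmem (|C| + |p (Sum.inl n)| + 1) (by positivity)))
  have hwn : w (Sum.inl n) = 1 := by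
    simp [hw, hdn.1.symm]
  rw [Pi.add_apply, Pi.smul_apply, hwn, smul_eq_mul, mul_one, Real.norm_eq_abs] at h1
  have h2 := le_abs_self (p (Sum.inl n) + (|C| + |p (Sum.inl n)| + 1))
  have h3 := neg_abs_le (p (Sum.inl n))
  have h4 := le_abs_self C
  linarith

end Hull

/-! ### The explicit formulas for the edge coordinates -/

section EdgeCoordinates

variable {V E K : Type*} (Γ : BundledGraph V E K) [Fintype V] [Fintype E] [Fintype K]
  [DecidableEq V] [DecidableEq E] [DecidableEq K]

/-- The number of tubes of `M` that avoid the edge `e`. -/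
noncomputable def avoid (M : Set (Finset (V ⊕ E))) (e : E) : ℕ := {t ∈ M | Sum.inr e ∉ t}.ncard

/-- The least number of items outside a tube of `M` that contains `e` but not `f`. -/
noncomputable def gap (M : Set (Finset (V ⊕ E))) (e f : E) : ℕ :=
  sInf ((fun t : Finset (V ⊕ E) ↦ #tᶜ) '' {t ∈ M | Sum.inr e ∈ t ∧ Sum.inr f ∉ t})

/-- The formulas for the coordinates of the edges in a bundle. -/
def HasEdgeCoords (M : Set (Finset (V ⊕ E))) (f : V ⊕ E → ℝ) (k : K) (e : ℕ → E) : Prop :=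
  Set.BijOn e (Set.Icc 1 #(Γ.strand univ k)) (Γ.strand univ k) ∧
  StrictMonoOn (fun j ↦ avoid M (e j)) (Set.Icc 1 #(Γ.strand univ k)) ∧
  f (Sum.inr (e 1)) = Γ.cst +
    ∑ i ∈ Ico 1 #(Γ.strand univ k), (2 * (gap M (e i) (e (i + 1)) : ℝ) - 1) ∧
  ∀ j ∈ Icc 2 #(Γ.strand univ k), f (Sum.inr (e j)) =
    Γ.cst ^ (j - 1) * (Γ.cst - 1) - (2 * (gap M (e (j - 1)) (e j) : ℝ) - 1)

variable {Γ} {M : Set (Finset (V ⊕ E))} {f : V ⊕ E → ℝ}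

/-- The terms are `c ^ j - c ^ (j - 1)` up to the corrections `w`, so the powers telescope to `c ^ b
- c`. The corrections are what the formula for the first edge compensates. -/
lemma sum_Icc_telescope (c : ℝ) (a w : ℕ → ℝ) (b : ℕ) (hb : 1 ≤ b)
    (h : ∀ j ∈ Icc 2 b, a j = c ^ (j - 1) * (c - 1) - w (j - 1)) :
    ∑ j ∈ Icc 1 b, a j = a 1 + c ^ b - c - ∑ i ∈ Ico 1 b, w i := by
  induction b, hb using Nat.le_induction with
  | base => simp
  | succ b hb ih =>
    rw [sum_Icc_succ_top (by omega), sum_Ico_succ_top hb, ih fun j hj ↦ h j ?_,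
      h (b + 1) (by simp; omega), Nat.add_sub_cancel, pow_succ]
    · ring
    · rw [mem_Icc] at hj ⊢
      omega

lemma sum_strand_eq_of_bijOn {k : K} {e : ℕ → E}
    (he : Set.BijOn e (Set.Icc 1 #(Γ.strand univ k)) (Γ.strand univ k)) :
    ∑ e ∈ Γ.strand univ k, f (Sum.inr e) =
      ∑ j ∈ Icc 1 #(Γ.strand univ k), f (Sum.inr (e j)) := by
  rw [← coe_Icc] at he
  rw [← coe_inj.1 ((coe_image (f := e)).trans he.image_eq), sum_image he.injOn]
  rw [coe_inj.1 ((coe_image (f := e)).trans he.image_eq)]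

lemma HasEdgeCoords.sum_eq (hΓ : Γ.IsPiece univ) {k : K} {e : ℕ → E}
    (h : Γ.HasEdgeCoords M f k e) :
    ∑ e ∈ Γ.strand univ k, f (Sum.inr e) = Γ.cst ^ #(Γ.strand univ k) := by
  rw [sum_strand_eq_of_bijOn h.1, sum_Icc_telescope Γ.cst (fun j ↦ f (Sum.inr (e j)))
    (fun i ↦ 2 * (gap M (e i) (e (i + 1)) : ℝ) - 1) _ (strand_univ_nonempty hΓ k).card_pos, h.2.2.1]
  · ring
  · intro j hj
    rw [h.2.2.2 j hj]
    rw [mem_Icc] at hj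
    rw [show j - 1 + 1 = j by omega]

lemma card_strand_least_lt (hΓ : Γ.IsPiece univ) (hM : Maximal Γ.IsTubing M) {e e' : E}
    (hne : e ≠ e') (hb : Γ.bundle e = Γ.bundle e') (h : Sum.inr e ∈ least M (Sum.inr e')) :
    #(Γ.strand (least M (Sum.inr e)) (Γ.bundle e)) <
      #(Γ.strand (least M (Sum.inr e')) (Γ.bundle e')) := by
  have hsub := least_subset (least_mem hΓ hM.prop _) h
  refine card_lt_card ⟨hb ▸ Γ.strand_mono hsub _, fun h' ↦ ?_⟩
  have he' := (mem_strand.1 (h' (mem_strand.2 ⟨rfl, mem_least _⟩))).2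
  exact least_inr_ne hΓ hM hne hb
    (subset_antisymm hsub (least_subset (least_mem hΓ hM.prop _) he'))

lemma mem_least_of_card_strand_lt (hΓ : Γ.IsPiece univ) (hM : Maximal Γ.IsTubing M) {e e' : E}
    (hb : Γ.bundle e = Γ.bundle e')
    (h : #(Γ.strand (least M (Sum.inr e)) (Γ.bundle e)) <
      #(Γ.strand (least M (Sum.inr e')) (Γ.bundle e'))) :
    e ≠ e' ∧ Sum.inr e ∈ least M (Sum.inr e') := by
  have hne : e ≠ e' := by
    rintro rfl
    exact lt_irrefl _ h
  refine ⟨hne, (mem_least_or_mem_least hΓ hM.prop hb).resolve_right fun h' ↦ ?_⟩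
  exact h.not_gt (card_strand_least_lt hΓ hM hne.symm hb.symm h')

/-- A tube through `e'` also contains `e`, while the least tube of `e'` with `e'` erased contains
only `e`. So counting avoided tubes gives the order by least tubes. -/
lemma avoid_lt (hΓ : Γ.IsPiece univ) (hM : Maximal Γ.IsTubing M) {e e' : E}
    (hne : e ≠ e') (hb : Γ.bundle e = Γ.bundle e') (h : Sum.inr e ∈ least M (Sum.inr e')) :
    avoid M e < avoid M e' := by
  have h1 := erase_least_mem hΓ hM hne hb h
  refine Set.ncard_lt_ncard ⟨fun t ht ↦ ⟨ht.1, fun h' ↦ ht.2 ?_⟩, fun h' ↦ ?_⟩ (Set.toFinite _)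
  · exact least_subset (Or.inr ht.1) h' h
  · exact (h' ⟨h1, notMem_erase _ _⟩).2 (mem_erase.2 ⟨by simpa using hne, h⟩)

/-- The largest tube with `e` but not `e'` is the least tube of `e'` with `e'` erased, for every `e`
that precedes `e'`. The added one turns `2 * gap - 1` into the correction of `IsVertex.apply_inr`.
-/
lemma gap_eq (hΓ : Γ.IsPiece univ) (hM : Maximal Γ.IsTubing M) {e e' : E}
    (hne : e ≠ e') (hb : Γ.bundle e = Γ.bundle e') (h : Sum.inr e ∈ least M (Sum.inr e')) :
    gap M e e' = #(least M (Sum.inr e'))ᶜ + 1 := by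
  have h1 := erase_least_mem hΓ hM hne hb h
  rw [← card_insert_of_notMem (by simp [mem_least] : Sum.inr e' ∉ (least M (Sum.inr e'))ᶜ),
    ← compl_erase]
  refine IsLeast.csInf_eq ⟨⟨_, ⟨h1, mem_erase.2 ⟨by simpa using hne, h⟩, notMem_erase _ _⟩, rfl⟩, ?_⟩
  rintro _ ⟨t, ⟨ht, het, het'⟩, rfl⟩
  refine card_le_card (compl_subset_compl.2 (subset_erase.2 ⟨?_, het'⟩))
  rcases nested_of_bundle_eq hΓ hM.prop (Or.inr ht) (least_mem hΓ hM.prop (Sum.inr e')) het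
    (mem_least _) hb with h' | h'
  · exact h'
  · exact absurd (h' (mem_least _)) het'

lemma IsVertex.exists_hasEdgeCoords (hΓ : Γ.IsPiece univ) (hM : Maximal Γ.IsTubing M)
    (hf : Γ.IsVertex M f) (k : K) : ∃ e, Γ.HasEdgeCoords M f k e := by
  set b := #(Γ.strand univ k) with hb
  -- The number of parallel edges in the least tube of an edge is its position in the bundle,
  -- counted from 1; the enumeration `e` is the inverse of this map.
  let pos : E → ℕ := fun e ↦ #(Γ.strand (least M (Sum.inr e)) (Γ.bundle e))
  have hbk : ∀ e ∈ Γ.strand univ k, Γ.bundle e = k := fun e he ↦ (mem_strand.1 he).1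
  have hmaps : Set.MapsTo pos (Γ.strand univ k : Set E) (Set.Icc 1 b) := by
    intro e he
    rw [mem_coe] at he
    simp only [pos, Set.mem_Icc]
    refine ⟨card_pos.2 ⟨e, mem_strand.2 ⟨rfl, mem_least _⟩⟩, card_le_card ?_⟩
    rw [hbk e he]
    exact Γ.strand_mono (subset_univ _) k
  have hinj : Set.InjOn pos (Γ.strand univ k : Set E) := by
    intro e he e' he' h
    by_contra hne
    have hbe := (hbk e he).trans (hbk e' he').symm
    rcases mem_least_or_mem_least hΓ hM.prop hbe with h' | h'
    · exact (card_strand_least_lt hΓ hM hne hbe h').ne h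
    · exact (card_strand_least_lt hΓ hM (Ne.symm hne) hbe.symm h').ne' h
  have hsurj : Set.SurjOn pos (Γ.strand univ k : Set E) (Set.Icc 1 b) := by
    rw [← coe_Icc] at hmaps ⊢
    exact surjOn_of_injOn_of_card_le pos hmaps hinj (by simp [hb])
  have hbij : Set.BijOn pos (Γ.strand univ k : Set E) (Set.Icc 1 b) := ⟨hmaps, hinj, hsurj⟩
  obtain ⟨e₀, -⟩ := strand_univ_nonempty hΓ k
  have : Nonempty E := ⟨e₀⟩
  have hinv := hbij.invOn_invFunOn
  set e := Function.invFunOn pos (Γ.strand univ k : Set E) with he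
  have hebij : Set.BijOn e (Set.Icc 1 b) (Γ.strand univ k) := hbij.symm hinv.symm
  have hpos : ∀ j ∈ Set.Icc 1 b, pos (e j) = j := fun j hj ↦ hinv.2 hj
  have hek : ∀ j ∈ Set.Icc 1 b, Γ.bundle (e j) = k := fun j hj ↦ hbk _ (hebij.mapsTo hj)
  have hlt : ∀ i ∈ Set.Icc 1 b, ∀ j ∈ Set.Icc 1 b, i < j →
      e i ≠ e j ∧ Γ.bundle (e i) = Γ.bundle (e j) ∧ Sum.inr (e i) ∈ least M (Sum.inr (e j)) := by
    intro i hi j hj hij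
    have hbb := (hek i hi).trans (hek j hj).symm
    have h1 := mem_least_of_card_strand_lt hΓ hM hbb
      (show pos (e i) < pos (e j) by rwa [hpos i hi, hpos j hj])
    exact ⟨h1.1, hbb, h1.2⟩
  have hform : ∀ j ∈ Icc 2 b, f (Sum.inr (e j)) =
      Γ.cst ^ (j - 1) * (Γ.cst - 1) - (2 * (gap M (e (j - 1)) (e j) : ℝ) - 1) := by
    intro j hj
    rw [mem_Icc] at hj
    have hj1 : j ∈ Set.Icc 1 b := ⟨by omega, hj.2⟩
    have hj0 : j - 1 ∈ Set.Icc 1 b := ⟨by omega, by omega⟩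
    obtain ⟨h1, h2, h3⟩ := hlt _ hj0 _ hj1 (by omega)
    rw [gap_eq hΓ hM h1 h2 h3, hf.apply_inr hΓ hM fun h ↦ h1 (h _ h2 h3)]
    have h4 : #(Γ.strand (least M (Sum.inr (e j))) (Γ.bundle (e j))) = j := hpos j hj1
    rw [h4]
    obtain ⟨i, rfl⟩ : ∃ i, j = i + 1 := ⟨j - 1, by omega⟩
    rw [Nat.add_sub_cancel, pow_succ]
    push_cast
    ring
  refine ⟨e, hebij, fun i hi j hj hij ↦ ?_, ?_, hform⟩
  · obtain ⟨h1, h2, h3⟩ := hlt i hi j hj hij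
    exact avoid_lt hΓ hM h1 h2 h3
  · have h1 := hf.sum_bundle k
    rw [sum_strand_eq_of_bijOn hebij, sum_Icc_telescope Γ.cst (fun j ↦ f (Sum.inr (e j)))
      (fun i ↦ 2 * (gap M (e i) (e (i + 1)) : ℝ) - 1) _ (strand_univ_nonempty hΓ k).card_pos] at h1
    · linarith
    · intro j hj
      rw [hform j hj]
      rw [mem_Icc] at hj
      rw [show j - 1 + 1 = j by omega]

/-- The vertex of a maximal tubing is given by the formulas for the edges and by the sums over the
tubes. -/
theorem isVertex_iff (hΓ : Γ.IsPiece univ) (hM : Maximal Γ.IsTubing M) :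
    Γ.IsVertex M f ↔ (∀ k, ∃ e, Γ.HasEdgeCoords M f k e) ∧
      (∀ t ∈ M, ∑ x ∈ t, f x = Γ.bound t) ∧ ∑ x, f x = Γ.bound univ := by
  refine ⟨fun h ↦ ⟨h.exists_hasEdgeCoords hΓ hM, h.sum_tube, h.sum_eq hΓ (Or.inl rfl)⟩, ?_⟩
  rintro ⟨h1, h2, h3⟩
  have h4 : ∀ k, ∑ e ∈ Γ.strand univ k, f (Sum.inr e) = Γ.cst ^ #(Γ.strand univ k) := fun k ↦ by
    obtain ⟨e, he⟩ := h1 k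
    exact he.sum_eq hΓ
  refine ⟨h2, ?_, h4⟩
  rw [Γ.sum_eq_sum_toLeft_add_sum_strand, bound, toLeft_univ, card_univ,
    sum_congr rfl fun k _ ↦ show Γ.weight (Γ.strand univ k) =
      ∑ e ∈ Γ.strand univ k, f (Sum.inr e) by
        rw [h4, weight_of_nonempty (strand_univ_nonempty hΓ k)]] at h3
  simpa using h3

end EdgeCoordinates

end BundledGraph

namespace Graph

open Finset

/-! ### Translation of graphs and subgraphs to finite sets -/

section Bundled

variable {α β : Type*} (H : Graph α β)

/-- The edges parallel to `e`. -/
def parallel (e : β) : Set β := {e' | ∀ x y, H.IsLink e x y → H.IsLink e' x y}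

variable {H}

lemma IsLink.parallel_eq {e : β} {x y : α} (h : H.IsLink e x y) :
    H.parallel e = {e' | H.IsLink e' x y} := by
  ext e'
  refine ⟨fun he' ↦ he' x y h, fun he' x' y' h' ↦ ?_⟩
  rcases h.eq_and_eq_or_eq_and_eq h' with ⟨rfl, rfl⟩ | ⟨rfl, rfl⟩
  · exact he'
  · exact IsLink.symm he'

lemma parallel_mem_bundles [H.Loopless] {e : β} (he : e ∈ E(H)) : H.parallel e ∈ H.bundles := by
  obtain ⟨x, y, h⟩ := exists_isLink_of_mem_edgeSet he
  exact ⟨x, y, h.ne, h.adj, h.parallel_eq⟩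

lemma parallel_eq_of_mem [H.Loopless] {e : β} {B : Set β} (hB : B ∈ H.bundles) (he : e ∈ B) :
    H.parallel e = B := by
  obtain ⟨x, y, -, -, rfl⟩ := hB
  exact IsLink.parallel_eq he

lemma mem_parallel_self (e : β) : e ∈ H.parallel e := fun _ _ h ↦ h

lemma subset_edgeSet_of_mem_bundles {B : Set β} (hB : B ∈ H.bundles) : B ⊆ E(H) := by
  obtain ⟨x, y, -, -, rfl⟩ := hB
  exact fun e he ↦ IsLink.edge_mem he

lemma finite_bundles (hE : E(H).Finite) : H.bundles.Finite :=
  hE.finite_subsets.subset fun _ hB ↦ subset_edgeSet_of_mem_bundles hB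

variable (H) in
/-- The incidence data of a finite loopless graph. -/
noncomputable def toBundled [H.Loopless] [Fintype V(H)] : BundledGraph V(H) E(H) H.bundles where
  bundle e := ⟨H.parallel e, parallel_mem_bundles e.2⟩
  ends B := by
    classical exact univ.filter fun v ↦ ∃ e ∈ B.1, H.Inc e v
  exists_ends := by
    classical
    rintro ⟨B, x, y, hxy, ⟨e₀, he₀⟩, rfl⟩
    refine ⟨⟨x, he₀.left_mem⟩, ⟨y, he₀.right_mem⟩, by simpa using hxy, fun z ↦ ?_⟩
    simp only [Set.mem_ofPred_eq, mem_filter, mem_univ, true_and, Subtype.ext_iff]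
    constructor
    · rintro ⟨e, he, hz⟩
      exact hz.eq_or_eq_of_isLink he
    · rintro (h | h)
      · exact ⟨e₀, he₀, h ▸ he₀.inc_left⟩
      · exact ⟨e₀, he₀, h ▸ he₀.inc_right⟩

variable [H.Loopless] [Fintype V(H)]

lemma mem_ends {B : H.bundles} {v : V(H)} :
    v ∈ H.toBundled.ends B ↔ ∃ e ∈ B.1, H.Inc e v := by
  simp [toBundled]

lemma bundle_eq_iff {e : E(H)} {B : H.bundles} : H.toBundled.bundle e = B ↔ (e : β) ∈ B.1 := by
  rw [toBundled, Subtype.ext_iff]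
  exact ⟨fun h ↦ h ▸ mem_parallel_self _, fun h ↦ parallel_eq_of_mem B.2 h⟩

lemma mem_ends_bundle {e : E(H)} {v : V(H)} :
    v ∈ H.toBundled.ends (H.toBundled.bundle e) ↔ H.Inc e v := by
  rw [mem_ends]
  constructor
  · rintro ⟨e', he', hv⟩
    obtain ⟨x, y, hxy⟩ := exists_isLink_of_mem_edgeSet e.2
    have h2 := he' x y hxy
    rcases hv.eq_or_eq_of_isLink h2 with h | h
    · exact h ▸ hxy.inc_left
    · exact h ▸ hxy.inc_right
  · exact fun h ↦ ⟨e, mem_parallel_self _, h⟩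

lemma isLink_of_mem_ends {B : H.bundles} {x y : V(H)} (hxy : x ≠ y)
    (hx : x ∈ H.toBundled.ends B) (hy : y ∈ H.toBundled.ends B) {e : β} (he : e ∈ B.1) :
    H.IsLink e x y := by
  have heE := subset_edgeSet_of_mem_bundles B.2 he
  have hB : H.toBundled.bundle ⟨e, heE⟩ = B := bundle_eq_iff.2 he
  rw [← hB, mem_ends_bundle] at hx hy
  obtain ⟨z, hz⟩ := hx
  rcases hy.eq_or_eq_of_isLink hz with h | h
  · exact absurd (Subtype.ext h.symm) hxy
  · rwa [h]

lemma toBundled_adj {x y : V(H)} : H.toBundled.Adj x y ↔ H.Adj x y := by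
  constructor
  · rintro ⟨hxy, B, hx, hy⟩
    obtain ⟨e, he, -⟩ := mem_ends.1 hx
    exact ⟨e, isLink_of_mem_ends hxy hx hy he⟩
  · rintro ⟨e, he⟩
    refine ⟨fun h ↦ he.ne (by rw [h]), H.toBundled.bundle ⟨e, he.edge_mem⟩, ?_, ?_⟩
    · rw [mem_ends_bundle]; exact he.inc_left
    · rw [mem_ends_bundle]; exact he.inc_right

variable [Fintype E(H)]

variable (H) in
open Classical in
/-- The nodes and edges of the subgraph `t` of `H`. -/
noncomputable def items (t : Graph α β) : Finset (V(H) ⊕ E(H)) :=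
  (univ.filter fun v : V(H) ↦ (v : α) ∈ V(t)).disjSum
    (univ.filter fun e : E(H) ↦ (e : β) ∈ E(t))

@[simp] lemma inl_mem_items {t : Graph α β} {v : V(H)} :
    Sum.inl v ∈ H.items t ↔ (v : α) ∈ V(t) := by
  simp [items]

@[simp] lemma inr_mem_items {t : Graph α β} {e : E(H)} :
    Sum.inr e ∈ H.items t ↔ (e : β) ∈ E(t) := by
  simp [items]

lemma items_subset_iff {s t : Graph α β} (hs : s ≤ H) (ht : t ≤ H) :
    H.items s ⊆ H.items t ↔ s ≤ t := by
  rw [(Compatible.of_le_le hs ht).le_iff]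
  constructor
  · intro h
    refine ⟨fun v hv ↦ ?_, fun e he ↦ ?_⟩
    · exact inl_mem_items.1 (h (inl_mem_items (v := ⟨v, hs.vertexSet_mono hv⟩).2 hv))
    · exact inr_mem_items.1 (h (inr_mem_items (e := ⟨e, hs.edgeSet_mono he⟩).2 he))
  · rintro ⟨h1, h2⟩ (v | e) hx
    · exact inl_mem_items.2 (h1 (inl_mem_items.1 hx))
    · exact inr_mem_items.2 (h2 (inr_mem_items.1 hx))

lemma items_ssubset_iff {s t : Graph α β} (hs : s ≤ H) (ht : t ≤ H) :
    H.items s ⊂ H.items t ↔ s < t := by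
  rw [ssubset_iff_subset_not_subset, lt_iff_le_not_ge, items_subset_iff hs ht,
    items_subset_iff ht hs]

lemma items_injOn : Set.InjOn H.items {t | t ≤ H} := fun _ hs _ ht h ↦
  le_antisymm ((items_subset_iff hs ht).1 h.subset) ((items_subset_iff ht hs).1 h.symm.subset)

lemma items_self : H.items H = univ := by
  ext (v | e) <;> simp

lemma items_ne_univ_iff {t : Graph α β} (ht : t ≤ H) : H.items t ≠ univ ↔ t < H := by
  rw [← items_self, ne_eq, items_injOn.eq_iff ht (le_refl H), lt_iff_le_and_ne]
  exact ⟨fun h ↦ ⟨ht, h⟩, fun h ↦ h.2⟩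

/-- By `hind`, distinct nodes of `t` that are adjacent in `H` are adjacent in `t`, so cuts may be
tested in either graph. -/
lemma connSet_items_iff {t : Graph α β} (ht : t ≤ H)
    (hind : ∀ x ∈ V(t), ∀ y ∈ V(t), x ≠ y → H.Adj x y → t.Adj x y) :
    H.toBundled.ConnSet (H.items t).toLeft ↔ t.toSimpleGraph.Connected := by
  classical
  constructor
  · rintro ⟨⟨v, hv⟩, h⟩
    rw [mem_toLeft, inl_mem_items] at hv
    rw [SimpleGraph.connected_iff_exists_forall_reachable]
    refine ⟨⟨v, hv⟩, fun w ↦ ?_⟩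
    by_contra hw
    -- The nodes of `t` reachable from `v`; an edge leaving this set would extend it.
    let S : Finset V(H) := univ.filter fun x ↦
      ∃ hx : (x : α) ∈ V(t), t.toSimpleGraph.Reachable ⟨v, hv⟩ ⟨x, hx⟩
    have hS : ∀ x, x ∈ S ↔ ∃ hx : (x : α) ∈ V(t), t.toSimpleGraph.Reachable ⟨v, hv⟩ ⟨x, hx⟩ := by
      simp [S]
    obtain ⟨x, hx, y, hy, hyS, hxy⟩ := h S (fun x hx ↦ by
        obtain ⟨hx, -⟩ := (hS x).1 hx
        simpa using hx) ⟨⟨v, ht.vertexSet_mono hv⟩, (hS _).2 ⟨hv, SimpleGraph.Reachable.refl _⟩⟩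
      (fun heq ↦ by
        have : (⟨w, ht.vertexSet_mono w.2⟩ : V(H)) ∈ S := by rw [heq]; simp
        exact hw ((hS _).1 this).2)
    rw [mem_toLeft, inl_mem_items] at hy
    obtain ⟨hxt, hr⟩ := (hS x).1 hx
    refine hyS ((hS y).2 ⟨hy, hr.trans (SimpleGraph.Adj.reachable ?_)⟩)
    have hne : (x : α) ≠ y := fun h' ↦ hxy.1 (Subtype.ext h')
    exact ⟨fun h' ↦ hne (Subtype.mk.inj h'), hind x hxt y hy hne (toBundled_adj.1 hxy)⟩
  · intro hc
    obtain ⟨v⟩ := hc.nonempty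
    refine ⟨⟨⟨v, ht.vertexSet_mono v.2⟩, by simp⟩, fun S hS hne hS' ↦ ?_⟩
    obtain ⟨x, hx⟩ := hne
    obtain ⟨y, hy, hyS⟩ := exists_of_ssubset (hS.ssubset_of_ne hS')
    have hxt : (x : α) ∈ V(t) := by simpa using hS hx
    have hyt : (y : α) ∈ V(t) := by simpa using hy
    obtain ⟨w⟩ := hc.preconnected ⟨x, hxt⟩ ⟨y, hyt⟩
    obtain ⟨d, -, hd1, hd2⟩ := w.exists_boundary_dart
      {z | (⟨z, ht.vertexSet_mono z.2⟩ : V(H)) ∈ S} hx hyS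
    exact ⟨_, hd1, ⟨d.snd, ht.vertexSet_mono d.snd.2⟩, by simp, hd2,
      toBundled_adj.2 (d.adj.2.mono ht)⟩

lemma isPiece_items_iff {t : Graph α β} (ht : t ≤ H) :
    H.toBundled.IsPiece (H.items t) ↔ t.toSimpleGraph.Connected ∧
      ∀ x ∈ V(t), ∀ y ∈ V(t), x ≠ y → H.Adj x y → t.Adj x y := by
  constructor
  · intro h
    have hind : ∀ x ∈ V(t), ∀ y ∈ V(t), x ≠ y → H.Adj x y → t.Adj x y := by
      intro x hx y hy hxy hadj
      obtain ⟨-, B, hxB, hyB⟩ := toBundled_adj (x := ⟨x, hadj.left_mem⟩)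
        (y := ⟨y, hadj.right_mem⟩).2 hadj
      have hne : (⟨x, hadj.left_mem⟩ : V(H)) ≠ ⟨y, hadj.right_mem⟩ := by simpa using hxy
      obtain ⟨e, he, het⟩ := h.exists_edge B
        (BundledGraph.ends_subset hne hxB hyB (by simpa using hx) (by simpa using hy))
      rw [inr_mem_items] at het
      exact ⟨e, (ht.isLink_iff het).2 (isLink_of_mem_ends hne hxB hyB (bundle_eq_iff.1 he))⟩
    exact ⟨(connSet_items_iff ht hind).1 h.conn, hind⟩
  · rintro ⟨hc, hind⟩
    refine ⟨(connSet_items_iff ht hind).2 hc, fun e he v hv ↦ ?_, fun B hB ↦ ?_⟩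
    · rw [inr_mem_items] at he
      rw [mem_ends_bundle] at hv
      rw [mem_toLeft, inl_mem_items]
      exact ((ht.inc_congr he).2 hv).vertex_mem
    · obtain ⟨x, y, hx, hy, hxy⟩ := H.toBundled.exists_adj_ends B
      have hne : (x : α) ≠ y := fun h' ↦ hxy.1 (Subtype.ext h')
      obtain ⟨e, he⟩ := hind x (by simpa using hB hx) y (by simpa using hB hy) hne
        (toBundled_adj.1 hxy)
      have heH := he.mono ht
      refine ⟨⟨e, heH.edge_mem⟩, bundle_eq_iff.2 ?_, by simpa using he.edge_mem⟩
      obtain ⟨e', he', -⟩ := mem_ends.1 hx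
      have h1 := isLink_of_mem_ends hxy.1 hx hy he'
      rw [← parallel_eq_of_mem B.2 he', h1.parallel_eq]
      exact heH

lemma isTube_iff {t : Graph α β} (ht : t ≤ H) :
    H.IsTube t ↔ H.toBundled.IsTube (H.items t) := by
  rw [IsTube, BundledGraph.IsTube, isPiece_items_iff ht, items_ne_univ_iff ht]
  tauto

lemma tubeCompatible_iff {s t : Graph α β} (hs : s ≤ H) (ht : t ≤ H) :
    H.TubeCompatible s t ↔ H.toBundled.Compat (H.items s) (H.items t) := by
  rw [TubeCompatible, BundledGraph.Compat, items_ssubset_iff hs ht, items_ssubset_iff ht hs]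
  refine or_congr_right (or_congr_right ?_)
  constructor
  · rintro ⟨h1, h2⟩ x y hx hy
    rw [inl_mem_items] at hx hy
    refine ⟨?_, fun h ↦ h2 x hx y hy (toBundled_adj.1 h)⟩
    rintro rfl
    exact Set.disjoint_left.1 h1 hx hy
  · intro h
    refine ⟨Set.disjoint_left.2 fun x hx hy ↦ ?_, fun x hx y hy hxy ↦ ?_⟩
    · have hxH := hs.vertexSet_mono hx
      exact (h ⟨x, hxH⟩ ⟨x, hxH⟩ (by simpa using hx) (by simpa using hy)).1 rfl
    · exact (h ⟨x, hs.vertexSet_mono hx⟩ ⟨y, ht.vertexSet_mono hy⟩ (by simpa using hx)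
        (by simpa using hy)).2 (toBundled_adj.2 hxy)

variable (H) in
/-- The subgraph of `H` with the nodes and edges in `u`. -/
def ofItems (u : Finset (V(H) ⊕ E(H))) : Graph α β :=
  (H.induce {x | ∃ h : x ∈ V(H), Sum.inl ⟨x, h⟩ ∈ u}).restrict
    {e | ∃ h : e ∈ E(H), Sum.inr ⟨e, h⟩ ∈ u}

lemma ofItems_le (u : Finset (V(H) ⊕ E(H))) : H.ofItems u ≤ H :=
  restrict_le.trans (induce_le fun _ hx ↦ hx.1)

/-- A piece contains the ends of its edges, so no edge is lost when restricting to its nodes. -/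
lemma items_ofItems {u : Finset (V(H) ⊕ E(H))} (hu : H.toBundled.IsPiece u) :
    H.items (H.ofItems u) = u := by
  ext (v | e)
  · simp [ofItems]
  · rw [inr_mem_items]
    constructor
    · rintro he
      simp only [ofItems, edgeSet_restrict] at he
      exact he.2.2
    · intro he
      obtain ⟨x, y, hxy⟩ := exists_isLink_of_mem_edgeSet e.2
      have hx := hu.ends_subset e he (mem_ends_bundle (v := ⟨x, hxy.left_mem⟩).2 hxy.inc_left)
      have hy := hu.ends_subset e he (mem_ends_bundle (v := ⟨y, hxy.right_mem⟩).2 hxy.inc_right)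
      have : (H.ofItems u).IsLink e x y := by
        simp only [ofItems, restrict_isLink, induce_isLink]
        rw [mem_toLeft] at hx hy
        exact ⟨⟨e.2, he⟩, hxy, ⟨_, hx⟩, ⟨_, hy⟩⟩
      exact this.edge_mem

lemma IsTube.le {t : Graph α β} (h : H.IsTube t) : t ≤ H := h.1.le

/-- For connected `H` the clause on components is automatic: `H` is itself a component but not a
tube. -/
lemma isTubing_iff (hc : H.toSimpleGraph.Connected) {T : Set (Graph α β)} (hT : ∀ t ∈ T, t ≤ H) :
    H.IsTubing T ↔ H.toBundled.IsTubing (H.items '' T) := by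
  constructor
  · rintro ⟨h1, h2, -⟩
    refine ⟨?_, ?_⟩
    · rintro _ ⟨t, ht, rfl⟩
      exact (isTube_iff (hT t ht)).1 (h1 t ht)
    · rintro _ ⟨s, hs, rfl⟩ _ ⟨t, ht, rfl⟩ hne
      exact (tubeCompatible_iff (hT s hs) (hT t ht)).1 (h2 hs ht fun h ↦ hne (by rw [h]))
  · rintro ⟨h1, h2⟩
    have htube : ∀ t ∈ T, H.IsTube t := fun t ht ↦
      (isTube_iff (hT t ht)).2 (h1 _ ⟨t, ht, rfl⟩)
    refine ⟨htube, fun s hs t ht hne ↦ ?_, fun h ↦ ?_⟩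
    · exact (tubeCompatible_iff (hT s hs) (hT t ht)).2 (h2 ⟨s, hs, rfl⟩ ⟨t, ht, rfl⟩ fun h ↦
        hne (items_injOn (hT s hs) (hT t ht) h))
    · exact lt_irrefl _ (htube H (h ⟨IsClosedSubgraph.rfl, hc⟩)).1

lemma IsTubing.items (hc : H.toSimpleGraph.Connected) {T : Set (Graph α β)} (h : H.IsTubing T) :
    H.toBundled.IsTubing (H.items '' T) :=
  (isTubing_iff hc fun t ht ↦ (h.1 t ht).le).1 h

lemma items_image_ofItems {U : Set (Finset (V(H) ⊕ E(H)))} (hU : H.toBundled.IsTubing U) :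
    H.items '' (H.ofItems '' U) = U := by
  rw [Set.image_image]
  exact (Set.image_congr fun u hu ↦ items_ofItems (hU.1 u hu).1).trans (Set.image_id' U)

lemma isTubing_ofItems (hc : H.toSimpleGraph.Connected) {U : Set (Finset (V(H) ⊕ E(H)))}
    (hU : H.toBundled.IsTubing U) : H.IsTubing (H.ofItems '' U) := by
  rw [isTubing_iff hc (by rintro _ ⟨u, -, rfl⟩; exact ofItems_le u), items_image_ofItems hU]
  exact hU

lemma items_image_subset_iff {S T : Set (Graph α β)} (hS : ∀ t ∈ S, t ≤ H) (hT : ∀ t ∈ T, t ≤ H) :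
    H.items '' S ⊆ H.items '' T ↔ S ⊆ T := items_injOn.image_subset_image_iff hS hT

lemma maximal_isTubing_iff (hc : H.toSimpleGraph.Connected) {T : Set (Graph α β)}
    (hT : ∀ t ∈ T, t ≤ H) :
    Maximal H.IsTubing T ↔ Maximal H.toBundled.IsTubing (H.items '' T) := by
  constructor
  · rintro ⟨h1, h2⟩
    refine ⟨h1.items hc, fun U hU hTU ↦ ?_⟩
    have hU' := isTubing_ofItems hc hU
    have hle : T ⊆ H.ofItems '' U := by
      rw [← items_image_subset_iff hT (fun t ht ↦ (hU'.1 t ht).le),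
        items_image_ofItems hU]
      exact hTU
    have h3 := Set.image_mono (f := H.items) (h2 hU' hle)
    rwa [items_image_ofItems hU] at h3
  · rintro ⟨h1, h2⟩
    refine ⟨(isTubing_iff hc hT).2 h1, fun S hS hTS ↦ ?_⟩
    exact (items_image_subset_iff (fun t ht ↦ (hS.1 t ht).le) hT).1
      (h2 (hS.items hc) (Set.image_mono hTS))

lemma isPiece_univ (hc : H.toSimpleGraph.Connected) : H.toBundled.IsPiece univ := by
  rw [← items_self, isPiece_items_iff le_rfl]
  exact ⟨hc, fun _ _ _ _ _ h ↦ h⟩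

end Bundled

end Graph

namespace Graph

open Finset

/-! ### Transfer of points, regions and faces -/

section Transfer

variable {α β : Type*} {H : Graph α β} [H.Loopless] [Fintype V(H)] [Fintype E(H)]

lemma image_toLeft_items {t : Graph α β} (ht : t ≤ H) :
    Subtype.val '' ((H.items t).toLeft : Set V(H)) = V(t) := by
  ext v
  simp only [Set.mem_image, mem_coe, mem_toLeft, inl_mem_items, Subtype.exists, exists_and_left,
    exists_prop, exists_eq_right_right, and_iff_left_iff_imp]
  exact fun h ↦ ht.vertexSet_mono h

lemma card_toLeft_items {t : Graph α β} (ht : t ≤ H) : #(H.items t).toLeft = V(t).ncard := by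
  rw [← image_toLeft_items ht, Set.ncard_image_of_injective _ Subtype.val_injective,
    Set.ncard_coe_finset]

lemma card_compl_items [DecidableEq V(H)] [DecidableEq E(H)] (t : Graph α β) :
    #(H.items t)ᶜ = H.codeg t := by
  rw [codeg, ← card_toLeft_add_card_toRight]
  have h1 : V(H) \ V(t) = Subtype.val '' ((H.items t)ᶜ.toLeft : Set V(H)) := by
    ext v
    simp [and_comm]
  have h2 : E(H) \ E(t) = Subtype.val '' ((H.items t)ᶜ.toRight : Set E(H)) := by
    ext v
    simp [and_comm]
  rw [h1, h2, Set.ncard_image_of_injective _ Subtype.val_injective,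
    Set.ncard_image_of_injective _ Subtype.val_injective, Set.ncard_coe_finset,
    Set.ncard_coe_finset]

lemma ncard_vertexSet : V(H).ncard = Fintype.card V(H) := by
  rw [← Nat.card_coe_set_eq, Nat.card_eq_fintype_card]

lemma ncard_edgeSet : E(H).ncard = Fintype.card E(H) := by
  rw [← Nat.card_coe_set_eq, Nat.card_eq_fintype_card]

lemma coordConst_eq_cst : H.coordConst = H.toBundled.cst := by
  rw [coordConst, BundledGraph.cst, ncard_vertexSet, ncard_edgeSet, Fintype.card_sum]

lemma tubeSum_eq_sum (t : Graph α β) (p : H.Coords) : H.tubeSum t p = ∑ x ∈ H.items t, p x := by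
  classical
  rw [items, sum_disjSum, tubeSum, finsum_eq_sum_of_fintype, finsum_eq_sum_of_fintype, sum_filter,
    sum_filter]
  congr 1
  · exact sum_congr rfl fun v _ ↦ finsum_eq_if
  · exact sum_congr rfl fun v _ ↦ finsum_eq_if

variable [Fintype H.bundles] [DecidableEq V(H)] [DecidableEq E(H)] [DecidableEq H.bundles]

lemma image_strand_items (t : Graph α β) (B : H.bundles) :
    Subtype.val '' (H.toBundled.strand (H.items t) B : Set E(H)) = B.1 ∩ E(t) := by
  ext e
  constructor
  · rintro ⟨e, he, rfl⟩
    rw [mem_coe, BundledGraph.mem_strand, bundle_eq_iff, inr_mem_items] at he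
    exact he
  · intro h
    refine ⟨⟨e, subset_edgeSet_of_mem_bundles B.2 h.1⟩, ?_, rfl⟩
    rw [mem_coe, BundledGraph.mem_strand, bundle_eq_iff, inr_mem_items]
    exact h

lemma card_strand_items (t : Graph α β) (B : H.bundles) :
    #(H.toBundled.strand (H.items t) B) = (B.1 ∩ E(t)).ncard := by
  rw [← image_strand_items, Set.ncard_image_of_injective _ Subtype.val_injective,
    Set.ncard_coe_finset]

lemma card_strand_univ (B : H.bundles) : #(H.toBundled.strand univ B) = B.1.ncard := by
  rw [← items_self, card_strand_items, Set.inter_eq_left.2 (subset_edgeSet_of_mem_bundles B.2)]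

lemma weight_strand_items (t : Graph α β) (B : H.bundles) [Decidable (B.1 ∩ E(t)).Nonempty] :
    H.toBundled.weight (H.toBundled.strand (H.items t) B) =
      if (B.1 ∩ E(t)).Nonempty then H.coordConst ^ (B.1 ∩ E(t)).ncard else 0 := by
  rw [BundledGraph.weight, card_strand_items, coordConst_eq_cst]
  refine if_congr ?_ rfl rfl
  rw [← image_strand_items, Set.image_nonempty, coe_nonempty]

lemma tubeBound_eq_bound {t : Graph α β} (ht : t ≤ H) :
    H.tubeBound t = H.toBundled.bound (H.items t) := by
  classical
  rw [tubeBound, BundledGraph.bound, card_toLeft_items ht, card_compl_items,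
    sum_congr rfl fun B _ ↦ weight_strand_items t B, ← finsum_eq_sum_of_fintype,
    finsum_set_coe_eq_finsum_mem H.bundles
      (f := fun B ↦ if (B ∩ E(t)).Nonempty then H.coordConst ^ (B ∩ E(t)).ncard else 0),
    coordConst_eq_cst]
  congr 2
  rw [finsum_mem_def, finsum_mem_def]
  refine finsum_congr fun B ↦ ?_
  by_cases h1 : B ∈ H.bundles <;> by_cases h2 : (B ∩ E(t)).Nonempty <;>
    simp [Set.indicator, h1, h2]

lemma finsum_bundle_eq_sum (B : H.bundles) (p : H.Coords) :
    ∑ᶠ (e : E(H)) (_ : (e : β) ∈ B.1), p (Sum.inr e) =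
      ∑ e ∈ H.toBundled.strand univ B, p (Sum.inr e) := by
  classical
  rw [finsum_eq_sum_of_fintype, BundledGraph.strand, sum_filter]
  refine sum_congr rfl fun e _ ↦ ?_
  rw [finsum_eq_if]
  exact if_congr (by simp [bundle_eq_iff]) rfl rfl

lemma region_eq_region {S : Set (Graph α β)} {D : Set V(H)} (hS : ∀ t ∈ S, t ≤ H)
    (hSD : H.items '' S = H.toBundled.keptTubes D) : H.region S = H.toBundled.region D := by
  ext p
  refine and_congr ?_ (and_congr ?_ ?_)
  · rw [finsum_eq_sum_of_fintype, coordConst_eq_cst, ncard_vertexSet]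
  · constructor
    · intro h B
      rw [← finsum_bundle_eq_sum, h B.1 B.2, card_strand_univ, coordConst_eq_cst]
    · intro h B hB
      have := h ⟨B, hB⟩
      rw [← finsum_bundle_eq_sum, card_strand_univ, ← coordConst_eq_cst] at this
      exact this
  · constructor
    · intro h u hu huD
      obtain ⟨t, ht, rfl⟩ : u ∈ H.items '' S := by rw [hSD]; exact ⟨hu, huD⟩
      rw [← tubeBound_eq_bound (hS t ht), ← tubeSum_eq_sum]
      exact h t ht
    · intro h t ht
      have hk : H.items t ∈ H.toBundled.keptTubes D := hSD ▸ ⟨t, ht, rfl⟩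
      rw [tubeBound_eq_bound (hS t ht), tubeSum_eq_sum]
      exact h _ hk.1 hk.2

lemma tubingFace_eq_face {P : Set H.Coords} {D : Set V(H)} (hP : P = H.toBundled.region D)
    {U : Set (Graph α β)} (hU : ∀ t ∈ U, t ≤ H) :
    H.tubingFace P U = H.toBundled.face D (H.items '' U) := by
  ext p
  rw [hP]
  refine and_congr Iff.rfl ?_
  rw [Set.forall_mem_image]
  refine forall₂_congr fun t ht ↦ ?_
  rw [tubeBound_eq_bound (hU t ht), tubeSum_eq_sum]

lemma avoidCount_eq_avoid {T : Set (Graph α β)} (hT : ∀ t ∈ T, t ≤ H) (e : E(H)) :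
    avoidCount T (e : β) = BundledGraph.avoid (H.items '' T) e := by
  rw [avoidCount, BundledGraph.avoid, ← Set.InjOn.ncard_image
    (items_injOn.mono fun t (ht : t ∈ {t ∈ T | (e : β) ∉ E(t)}) ↦ hT t ht.1)]
  congr 1
  ext u
  constructor
  · rintro ⟨t, ht, rfl⟩
    exact ⟨⟨t, ht.1, rfl⟩, by simpa using ht.2⟩
  · rintro ⟨⟨t, ht, rfl⟩, h⟩
    exact ⟨t, ⟨ht, by simpa using h⟩, rfl⟩

lemma gap_eq_gap (T : Set (Graph α β)) (e e' : E(H)) :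
    H.gap T e e' = BundledGraph.gap (H.items '' T) e e' := by
  rw [gap, BundledGraph.gap]
  congr 1
  ext n
  constructor
  · rintro ⟨t, ht, rfl⟩
    exact ⟨H.items t, ⟨⟨t, ht.1, rfl⟩, by simpa using ht.2⟩, card_compl_items t⟩
  · rintro ⟨_, ⟨⟨t, ht, rfl⟩, h⟩, rfl⟩
    exact ⟨t, ⟨ht, by simpa using h⟩, (card_compl_items t).symm⟩

lemma bijOn_val_iff (B : H.bundles) (e : ℕ → E(H)) (I : Set ℕ) :
    Set.BijOn (fun j ↦ (e j : β)) I B.1 ↔ Set.BijOn e I (H.toBundled.strand univ B) := by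
  have hmem : ∀ e : E(H), e ∈ (H.toBundled.strand univ B : Set E(H)) ↔ (e : β) ∈ B.1 := by
    intro e
    simp [bundle_eq_iff]
  constructor
  · rintro ⟨h1, h2, h3⟩
    refine ⟨fun j hj ↦ (hmem _).2 (h1 hj), fun i hi j hj h ↦ h2 hi hj (by simp [h]), fun x hx ↦ ?_⟩
    obtain ⟨j, hj, h⟩ := h3 ((hmem x).1 hx)
    exact ⟨j, hj, Subtype.ext h⟩
  · rintro ⟨h1, h2, h3⟩
    refine ⟨fun j hj ↦ (hmem _).1 (h1 hj), fun i hi j hj h ↦ h2 hi hj (Subtype.ext h),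
      fun x hx ↦ ?_⟩
    obtain ⟨j, hj, h⟩ := h3 ((hmem ⟨x, subset_edgeSet_of_mem_bundles B.2 hx⟩).2 hx)
    exact ⟨j, hj, by simp [h]⟩

lemma isVertexPoint_iff (hc : H.toSimpleGraph.Connected) {T : Set (Graph α β)}
    (hT : Maximal H.IsTubing T) {p : H.Coords} :
    H.IsVertexPoint T p ↔ H.toBundled.IsVertex (H.items '' T) p := by
  have hle : ∀ t ∈ T, t ≤ H := fun t ht ↦ (hT.prop.1 t ht).le
  rw [BundledGraph.isVertex_iff (isPiece_univ hc) ((maximal_isTubing_iff hc hle).1 hT),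
    IsVertexPoint, tubeSum_eq_sum, tubeBound_eq_bound le_rfl, items_self, Set.forall_mem_image,
    coordConst_eq_cst]
  refine and_congr ?_ (and_congr ?_ Iff.rfl)
  · have key : ∀ (B : H.bundles) (e : ℕ → E(H)), (Set.BijOn (fun j ↦ (e j : β))
        (Set.Icc 1 B.1.ncard) B.1 ∧
        StrictMonoOn (fun j ↦ avoidCount T (e j : β)) (Set.Icc 1 B.1.ncard) ∧
        p (Sum.inr (e 1)) = H.toBundled.cst +
          ∑ k ∈ Finset.Ico 1 B.1.ncard, (2 * (H.gap T (e k) (e (k + 1)) : ℝ) - 1) ∧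
        ∀ j ∈ Finset.Icc 2 B.1.ncard, p (Sum.inr (e j)) =
          H.toBundled.cst ^ (j - 1) * (H.toBundled.cst - 1)
            - (2 * (H.gap T (e (j - 1)) (e j) : ℝ) - 1)) ↔
        H.toBundled.HasEdgeCoords (H.items '' T) p B e := by
      intro B e
      simp only [BundledGraph.HasEdgeCoords, card_strand_univ, avoidCount_eq_avoid hle, gap_eq_gap,
        bijOn_val_iff]
    constructor
    · intro h B
      obtain ⟨e, he⟩ := h B.1 B.2
      exact ⟨e, (key B e).1 he⟩
    · intro h B hB
      obtain ⟨e, he⟩ := h ⟨B, hB⟩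
      exact ⟨e, (key ⟨B, hB⟩ e).2 he⟩
  · refine forall₂_congr fun t ht ↦ ?_
    rw [tubeBound_eq_bound (hle t ht), tubeSum_eq_sum]

lemma existsUnique_isVertexPoint (hc : H.toSimpleGraph.Connected) {T : Set (Graph α β)}
    (hT : Maximal H.IsTubing T) : ∃! p, H.IsVertexPoint T p := by
  have hle : ∀ t ∈ T, t ≤ H := fun t ht ↦ (hT.prop.1 t ht).le
  have hM := (maximal_isTubing_iff hc hle).1 hT
  obtain ⟨f, hf⟩ := BundledGraph.exists_isVertex (isPiece_univ hc) hM.prop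
  refine ⟨f, (isVertexPoint_iff hc hT).2 hf, fun g hg ↦ ?_⟩
  exact ((isVertexPoint_iff hc hT).1 hg).eq (isPiece_univ hc) hM hf

lemma hullRealization_eq [Nonempty H.bundles] (hc : H.toSimpleGraph.Connected) :
    H.hullRealization = H.toBundled.region ∅ := by
  rw [← BundledGraph.convexHull_isVertex (isPiece_univ hc), hullRealization]
  congr 1
  ext p
  constructor
  · rintro ⟨T, hT, hp⟩
    have hle : ∀ t ∈ T, t ≤ H := fun t ht ↦ (hT.prop.1 t ht).le
    exact ⟨_, (maximal_isTubing_iff hc hle).1 hT, (isVertexPoint_iff hc hT).1 hp⟩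
  · rintro ⟨M, hM, hp⟩
    have hM' : Maximal H.IsTubing (H.ofItems '' M) := by
      rw [maximal_isTubing_iff hc (by rintro _ ⟨u, -, rfl⟩; exact ofItems_le u),
        items_image_ofItems hM.prop]
      exact hM
    refine ⟨_, hM', (isVertexPoint_iff hc hM').2 ?_⟩
    rwa [items_image_ofItems hM.prop]

lemma items_image_isTube : H.items '' {t | H.IsTube t} = H.toBundled.keptTubes ∅ := by
  ext u
  constructor
  · rintro ⟨t, ht, rfl⟩
    exact ⟨(isTube_iff ht.le).1 ht, by simp⟩
  · rintro ⟨hu, -⟩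
    refine ⟨H.ofItems u, (isTube_iff (ofItems_le u)).2 ?_, items_ofItems hu.1⟩
    rwa [items_ofItems hu.1]

/-- The region of the tubes outside `D` realizes the associahedron of a graph whose tubings
correspond to the tubings of `H` outside `D`. -/
lemma isRealization_of_bijection {α' β' : Type*} {G : Graph α' β'} [Nonempty H.bundles]
    (hc : H.toSimpleGraph.Connected) {P : Set H.Coords} {D : Set V(H)}
    (hP : P = H.toBundled.region D)
    (hleaf : ∀ d ∈ D, ∀ x y, H.toBundled.Adj d x → H.toBundled.Adj d y → x = y)
    (φ : Graph α' β' → Graph α β) (hinj : Set.InjOn φ {t | G.IsTube t})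
    (h1 : ∀ T, G.IsTubing T →
      H.IsTubing (φ '' T) ∧ H.items '' (φ '' T) ⊆ H.toBundled.keptTubes D)
    (h2 : ∀ U, H.IsTubing U → H.items '' U ⊆ H.toBundled.keptTubes D →
      ∃ T, G.IsTubing T ∧ φ '' T = U)
    (hcard : V(G).ncard + G.redundancy + Fintype.card H.bundles = V(H).ncard + E(H).ncard) :
    G.IsRealization P (fun T ↦ H.tubingFace P (φ '' T)) := by
  have hΓ := isPiece_univ hc
  have hle : ∀ T, G.IsTubing T → ∀ t ∈ φ '' T, t ≤ H := fun T hT t ht ↦ ((h1 T hT).1.1 t ht).le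
  have hface : ∀ T, G.IsTubing T →
      H.tubingFace P (φ '' T) = H.toBundled.face D (H.items '' (φ '' T)) :=
    fun T hT ↦ tubingFace_eq_face hP (hle T hT)
  refine ⟨fun T hT ↦ ?_, fun F hF hne ↦ ?_, fun T U hT hU ↦ ?_, fun T hT ↦ ?_⟩
  · rw [hface T hT, hP]
    exact ⟨BundledGraph.isExposed_face (h1 T hT).2,
      BundledGraph.face_nonempty hΓ ((h1 T hT).1.items hc) (h1 T hT).2⟩
  · rw [hP] at hF
    -- Any nonempty face is cut out by the tight tubes of one of its points, and these form a tubing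
    -- without omitted singletons.
    obtain ⟨q, hq, rfl⟩ := BundledGraph.exists_eq_face_tight hF hne
    have htub := BundledGraph.isTubing_tight hΓ hleaf hq
    obtain ⟨T, hT, hTU⟩ := h2 _ (isTubing_ofItems hc htub)
      (by rw [items_image_ofItems htub]; exact fun t ht ↦ ht.1)
    refine ⟨T, hT, ?_⟩
    rw [hface T hT, hTU, items_image_ofItems htub]
  · simp only [hface T hT, hface U hU]
    rw [BundledGraph.face_subset_face_iff hΓ ((h1 T hT).1.items hc) (h1 T hT).2 (h1 U hU).2,
      items_image_subset_iff (hle U hU) (hle T hT)]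
    exact hinj.image_subset_image_iff hU.1 hT.1
  · rw [hface T hT]
    have h3 := BundledGraph.finrank_vectorSpan_face hΓ ((h1 T hT).1.items hc) (h1 T hT).2
    rw [Set.InjOn.ncard_image (items_injOn.mono (hle T hT)),
      Set.InjOn.ncard_image (hinj.mono hT.1)] at h3
    rw [ncard_vertexSet (H := H), ncard_edgeSet] at hcard
    omega

end Transfer

end Graph

namespace Graph

/-! ### Redundancy and the number of bundles -/

section Redundancy

variable {α β : Type*} {G : Graph α β}

lemma IsLink.parallel_mem_bundles {e : β} {x y : α} (h : G.IsLink e x y) (hxy : x ≠ y) :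
    G.parallel e ∈ G.bundles := ⟨x, y, hxy, h.adj, h.parallel_eq⟩

/-- A simple graph left after deletion has no loops and at most one edge per bundle, and keeping one
representative of each bundle attains this. -/
lemma redundancy_add_ncard_bundles (hE : E(G).Finite) :
    G.redundancy + G.bundles.ncard = E(G).ncard := by
  have hfin := finite_bundles hE
  have hlower : ∀ F ⊆ E(G), (G.deleteEdges F).Simple → E(G).ncard ≤ F.ncard + G.bundles.ncard := by
    intro F hF hs
    have hlink : ∀ e ∈ E(G) \ F, ∃ x y, (G.deleteEdges F).IsLink e x y := by
      rintro e ⟨he, heF⟩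
      obtain ⟨x, y, h⟩ := exists_isLink_of_mem_edgeSet he
      exact ⟨x, y, by simp [deleteEdges_isLink, h, heF]⟩
    have h1 : (E(G) \ F).ncard ≤ G.bundles.ncard := by
      refine Set.ncard_le_ncard_of_injOn G.parallel (fun e he ↦ ?_) (fun e he e' he' h ↦ ?_) hfin
      · obtain ⟨x, y, h⟩ := hlink e he
        exact (h.mono deleteEdges_le).parallel_mem_bundles h.ne
      · obtain ⟨x, y, hxy⟩ := hlink e he
        have h2 : e' ∈ G.parallel e := h ▸ mem_parallel_self e'
        have h3 := h2 x y (hxy.mono deleteEdges_le)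
        have h4 : (G.deleteEdges F).IsLink e' x y := by
          simp [deleteEdges_isLink, h3, he'.2]
        exact hs.eq_of_isLink hxy h4
    have h2 := Set.ncard_sdiff_add_ncard_of_subset hF hE
    omega
  have hne : ∀ B : G.bundles, ∃ e, e ∈ B.1 := by
    rintro ⟨B, x, y, -, ⟨e, he⟩, rfl⟩
    exact ⟨e, he⟩
  choose r hr using hne
  have hpar : ∀ B : G.bundles, G.parallel (r B) = B.1 := by
    intro B
    obtain ⟨x, y, -, -, h⟩ := B.2
    have h1 := hr B
    rw [h] at h1 ⊢
    exact IsLink.parallel_eq h1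
  have hrinj : Function.Injective r := fun B B' h ↦ Subtype.ext (by rw [← hpar, h, hpar])
  have hrE : Set.range r ⊆ E(G) := by
    rintro _ ⟨B, rfl⟩
    exact subset_edgeSet_of_mem_bundles B.2 (hr B)
  have hcard : (Set.range r).ncard = G.bundles.ncard := by
    rw [← Set.image_univ, Set.ncard_image_of_injective _ hrinj, Set.ncard_univ,
      Nat.card_coe_set_eq]
  have hsimple : (G.deleteEdges (E(G) \ Set.range r)).Simple := by
    have hmem : ∀ {e x y}, (G.deleteEdges (E(G) \ Set.range r)).IsLink e x y →
        G.IsLink e x y ∧ e ∈ Set.range r := by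
      intro e x y h
      have h1 := h.mono deleteEdges_le
      rw [deleteEdges_isLink] at h
      by_contra h2
      exact absurd (show e ∈ E(G) \ Set.range r from ⟨h1.edge_mem, fun h3 ↦ h2 ⟨h1, h3⟩⟩)
        (by tauto)
    refine { not_isLoopAt := ?_, eq_of_isLink := ?_ }
    · intro e x h
      obtain ⟨h1, B, rfl⟩ := hmem h
      obtain ⟨u, v, huv, -, hB⟩ := B.2
      have h2 : G.IsLink (r B) u v := by
        have := hr B
        rwa [hB] at this
      exact huv ((IsLoopAt.eq_of_inc h1 h2.inc_left).symm.trans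
        (IsLoopAt.eq_of_inc h1 h2.inc_right))
    · intro e e' x y h h'
      obtain ⟨h1, B, rfl⟩ := hmem h
      obtain ⟨h2, B', rfl⟩ := hmem h'
      congr 1
      apply Subtype.ext
      rw [← hpar, ← hpar, h1.parallel_eq, h2.parallel_eq]
  have hF := Set.ncard_sdiff_add_ncard_of_subset hrE hE
  have hmem : (E(G) \ Set.range r).ncard ∈
      {k | ∃ F ⊆ E(G), F.ncard = k ∧ (G.deleteEdges F).Simple} :=
    ⟨_, Set.sdiff_subset, rfl, hsimple⟩
  have hle : G.redundancy ≤ (E(G) \ Set.range r).ncard := Nat.sInf_le hmem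
  obtain ⟨F, hFE, hFk, hFs⟩ := Nat.sInf_mem ⟨_, hmem⟩
  have := hlower F hFE hFs
  change F.ncard = G.redundancy at hFk
  omega

end Redundancy

/-! ### Connectedness of a graph by cuts -/

section Connected

variable {α β : Type*} {G : Graph α β}

lemma connected_iff_forall_cut : G.toSimpleGraph.Connected ↔ V(G).Nonempty ∧
    ∀ S ⊆ V(G), S.Nonempty → S ≠ V(G) → ∃ x ∈ S, ∃ y ∈ V(G), y ∉ S ∧ G.Adj x y := by
  constructor
  · intro hc
    obtain ⟨v⟩ := hc.nonempty
    refine ⟨⟨v, v.2⟩, fun S hS ⟨x, hx⟩ hne ↦ ?_⟩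
    obtain ⟨y, hy, hyS⟩ := Set.exists_of_ssubset (hS.ssubset_of_ne hne)
    obtain ⟨w⟩ := hc.preconnected ⟨x, hS hx⟩ ⟨y, hy⟩
    obtain ⟨d, -, hd1, hd2⟩ := w.exists_boundary_dart {z | (z : α) ∈ S} hx hyS
    exact ⟨_, hd1, _, d.snd.2, hd2, d.adj.2⟩
  · rintro ⟨⟨v, hv⟩, h⟩
    rw [SimpleGraph.connected_iff_exists_forall_reachable]
    refine ⟨⟨v, hv⟩, fun w ↦ ?_⟩
    by_contra hw
    obtain ⟨x, ⟨hxV, hx⟩, y, hy, hyS, hxy⟩ := h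
      {x | ∃ hx : x ∈ V(G), G.toSimpleGraph.Reachable ⟨v, hv⟩ ⟨x, hx⟩} (fun x hx ↦ hx.1)
      ⟨v, hv, SimpleGraph.Reachable.refl _⟩ (fun heq ↦ by
        obtain ⟨_, h1⟩ := heq.ge w.2
        exact hw h1)
    by_cases hne : x = y
    · subst hne
      exact hyS ⟨hxV, hx⟩
    · exact hyS ⟨hy, hx.trans (SimpleGraph.Adj.reachable ⟨fun h ↦ hne (Subtype.mk.inj h), hxy⟩)⟩

end Connected

/-! ### Tubes and bundles of the loop-free graph -/

section LoopFree

variable {α β : Type*} {G s t : Graph α β}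

lemma loopFree_isLink {e : β} {x y : α ⊕ α} : G.loopFree.IsLink e x y ↔
    (∃ u v, u ≠ v ∧ G.IsLink e u v ∧ x = Sum.inl u ∧ y = Sum.inl v) ∨
      ∃ v, G.IsLoopAt e v ∧
        ((x = Sum.inl v ∧ y = Sum.inr v) ∨ (x = Sum.inr v ∧ y = Sum.inl v)) := Iff.rfl

lemma edgeSet_loopFree : E(G.loopFree) = E(G) := rfl

@[simp] lemma inl_mem_loopFree {v : α} : Sum.inl v ∈ V(G.loopFree) ↔ v ∈ V(G) := by
  simp [loopFree]

@[simp] lemma inr_mem_loopFree {v : α} : Sum.inr v ∈ V(G.loopFree) ↔ ∃ e, G.IsLoopAt e v := by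
  simp [loopFree]

lemma loopFree_isLink_inl_inl {e : β} {u v : α} :
    G.loopFree.IsLink e (Sum.inl u) (Sum.inl v) ↔ u ≠ v ∧ G.IsLink e u v := by
  simp [loopFree_isLink]

lemma loopFree_isLink_inl_inr {e : β} {u v : α} :
    G.loopFree.IsLink e (Sum.inl u) (Sum.inr v) ↔ u = v ∧ G.IsLoopAt e v := by
  rw [loopFree_isLink]
  constructor
  · rintro (⟨_, _, -, -, -, h⟩ | ⟨w, h, ⟨h1, h2⟩ | ⟨h1, -⟩⟩)
    · cases h
    · cases h1
      cases h2
      exact ⟨rfl, h⟩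
    · cases h1
  · rintro ⟨rfl, h⟩
    exact Or.inr ⟨u, h, Or.inl ⟨rfl, rfl⟩⟩

lemma loopFree_isLink_inr_inl {e : β} {u v : α} :
    G.loopFree.IsLink e (Sum.inr v) (Sum.inl u) ↔ u = v ∧ G.IsLoopAt e v := by
  rw [isLink_comm, loopFree_isLink_inl_inr]

lemma not_loopFree_isLink_inr_inr {e : β} {u v : α} :
    ¬ G.loopFree.IsLink e (Sum.inr u) (Sum.inr v) := by
  simp [loopFree_isLink]

instance loopless_loopFree : G.loopFree.Loopless := by
  refine ⟨?_⟩
  rintro e (v | v) h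
  · exact (loopFree_isLink_inl_inl.1 h).1 rfl
  · exact not_loopFree_isLink_inr_inr h

lemma loopFree_adj_inl_inl {u v : α} :
    G.loopFree.Adj (Sum.inl u) (Sum.inl v) ↔ u ≠ v ∧ G.Adj u v := by
  simp only [Adj, loopFree_isLink_inl_inl, exists_and_left]

lemma loopFree_adj_inl_inr {u v : α} :
    G.loopFree.Adj (Sum.inl u) (Sum.inr v) ↔ u = v ∧ ∃ e, G.IsLoopAt e v := by
  simp only [Adj, loopFree_isLink_inl_inr, exists_and_left]

lemma loopFree_adj_inr_inl {u v : α} :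
    G.loopFree.Adj (Sum.inr v) (Sum.inl u) ↔ u = v ∧ ∃ e, G.IsLoopAt e v := by
  rw [adj_comm, loopFree_adj_inl_inr]

lemma not_loopFree_adj_inr_inr {u v : α} : ¬ G.loopFree.Adj (Sum.inr u) (Sum.inr v) :=
  fun ⟨_, h⟩ ↦ not_loopFree_isLink_inr_inr h

lemma loopFree_le_loopFree_iff : s.loopFree ≤ t.loopFree ↔ s ≤ t := by
  constructor
  · intro h
    refine ⟨fun v hv ↦ ?_, fun e x y hxy ↦ ?_⟩
    · exact inl_mem_loopFree.1 (h.vertexSet_mono (inl_mem_loopFree.2 hv))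
    · by_cases hne : x = y
      · subst hne
        exact (loopFree_isLink_inl_inr.1 ((loopFree_isLink_inl_inr.2 ⟨rfl, hxy⟩).mono h)).2
      · exact (loopFree_isLink_inl_inl.1 ((loopFree_isLink_inl_inl.2 ⟨hne, hxy⟩).mono h)).2
  · intro h
    refine ⟨?_, ?_⟩
    · rintro (v | v) hv
      · exact inl_mem_loopFree.2 (h.vertexSet_mono (inl_mem_loopFree.1 hv))
      · obtain ⟨e, he⟩ := inr_mem_loopFree.1 hv
        exact inr_mem_loopFree.2 ⟨e, he.mono h⟩
    · rintro e x y (⟨u, v, huv, hl, rfl, rfl⟩ | ⟨v, hl, h'⟩)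
      · exact Or.inl ⟨u, v, huv, hl.mono h, rfl, rfl⟩
      · exact Or.inr ⟨v, hl.mono h, h'⟩

lemma loopFree_lt_loopFree_iff : s.loopFree < t.loopFree ↔ s < t := by
  rw [lt_iff_le_not_ge, lt_iff_le_not_ge, loopFree_le_loopFree_iff, loopFree_le_loopFree_iff]

lemma loopFree_injective : Function.Injective (loopFree : Graph α β → Graph (α ⊕ α) β) :=
  fun _ _ h ↦ le_antisymm (loopFree_le_loopFree_iff.1 h.le) (loopFree_le_loopFree_iff.1 h.ge)

/-- Each ghost node hangs on the node that carries its loops, so adding or forgetting ghosts does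
not affect connectedness. -/
lemma connected_loopFree_iff :
    t.loopFree.toSimpleGraph.Connected ↔ t.toSimpleGraph.Connected := by
  rw [connected_iff_forall_cut, connected_iff_forall_cut]
  constructor
  · rintro ⟨⟨z, hz⟩, h⟩
    refine ⟨?_, fun S hS ⟨x, hx⟩ hne ↦ ?_⟩
    · rcases z with v | v
      · exact ⟨v, inl_mem_loopFree.1 hz⟩
      · obtain ⟨e, he⟩ := inr_mem_loopFree.1 hz
        exact ⟨v, he.vertex_mem⟩
    · obtain ⟨y, hy, hyS⟩ := Set.exists_of_ssubset (hS.ssubset_of_ne hne)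
      have hmem : ∀ z, z ∈ {z ∈ V(t.loopFree) | Sum.elim id id z ∈ S} ↔
        z ∈ V(t.loopFree) ∧ Sum.elim id id z ∈ S := fun z ↦ Iff.rfl
      -- This set keeps each ghost on the same side as its node, so an edge crossing the cut is not
      -- a former loop.
      obtain ⟨a, ha, b, hb, hbS, hab⟩ := h {z ∈ V(t.loopFree) | Sum.elim id id z ∈ S}
        (fun z hz ↦ hz.1) ⟨Sum.inl x, inl_mem_loopFree.2 (hS hx), hx⟩ (fun heq ↦ by
          have h1 : Sum.inl y ∈ V(t.loopFree) := inl_mem_loopFree.2 hy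
          rw [← heq] at h1
          exact hyS h1.2)
      have hbS' : Sum.elim id id b ∉ S := fun h' ↦ hbS ⟨hb, h'⟩
      have haS := ha.2
      rcases a with u | u <;> rcases b with v | v
      · exact ⟨u, haS, v, inl_mem_loopFree.1 hb, hbS', (loopFree_adj_inl_inl.1 hab).2⟩
      · obtain ⟨rfl, -⟩ := loopFree_adj_inl_inr.1 hab
        exact absurd haS hbS'
      · obtain ⟨rfl, -⟩ := loopFree_adj_inr_inl.1 hab
        exact absurd haS hbS'
      · exact absurd hab not_loopFree_adj_inr_inr
  · rintro ⟨⟨v, hv⟩, h⟩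
    refine ⟨⟨Sum.inl v, inl_mem_loopFree.2 hv⟩, fun S hS ⟨x, hx⟩ hne ↦ ?_⟩
    by_cases h0 : ∃ w, Sum.inl w ∈ S
    · by_cases h1 : {w | Sum.inl w ∈ S} = V(t)
      · obtain ⟨y, hy, hyS⟩ := Set.exists_of_ssubset (hS.ssubset_of_ne hne)
        rcases y with w | w
        · rw [inl_mem_loopFree, ← h1] at hy
          exact absurd hy hyS
        · obtain ⟨e, he⟩ := inr_mem_loopFree.1 hy
          have hw : w ∈ {w | Sum.inl w ∈ S} := h1 ▸ he.vertex_mem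
          exact ⟨_, hw, _, hy, hyS, loopFree_adj_inl_inr.2 ⟨rfl, e, he⟩⟩
      · obtain ⟨a, ha, b, hb, hbS, hab⟩ := h {w | Sum.inl w ∈ S}
          (fun w hw ↦ inl_mem_loopFree.1 (hS hw)) h0 h1
        refine ⟨_, ha, Sum.inl b, inl_mem_loopFree.2 hb, hbS, loopFree_adj_inl_inl.2 ⟨?_, hab⟩⟩
        rintro rfl
        exact hbS ha
    · rcases x with w | w
      · exact absurd ⟨w, hx⟩ h0
      · obtain ⟨e, he⟩ := inr_mem_loopFree.1 (hS hx)
        exact ⟨_, hx, Sum.inl w, inl_mem_loopFree.2 he.vertex_mem, fun h' ↦ h0 ⟨w, h'⟩,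
          loopFree_adj_inr_inl.2 ⟨rfl, e, he⟩⟩

lemma isTube_loopFree_iff : G.loopFree.IsTube t.loopFree ↔ G.IsTube t := by
  rw [IsTube, IsTube, loopFree_lt_loopFree_iff, connected_loopFree_iff]
  refine and_congr_right fun _ ↦ and_congr_right fun _ ↦ ⟨fun h x hx y hy hxy hadj ↦ ?_, fun h ↦ ?_⟩
  · exact (loopFree_adj_inl_inl.1 (h (Sum.inl x) (inl_mem_loopFree.2 hx) (Sum.inl y)
      (inl_mem_loopFree.2 hy) (by simpa using hxy) (loopFree_adj_inl_inl.2 ⟨hxy, hadj⟩))).2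
  · rintro (u | u) hu (v | v) hv - hadj
    · obtain ⟨huv, hadj⟩ := loopFree_adj_inl_inl.1 hadj
      exact loopFree_adj_inl_inl.2
        ⟨huv, h u (inl_mem_loopFree.1 hu) v (inl_mem_loopFree.1 hv) huv hadj⟩
    · obtain ⟨rfl, -⟩ := loopFree_adj_inl_inr.1 hadj
      exact loopFree_adj_inl_inr.2 ⟨rfl, inr_mem_loopFree.1 hv⟩
    · obtain ⟨rfl, -⟩ := loopFree_adj_inr_inl.1 hadj
      exact loopFree_adj_inr_inl.2 ⟨rfl, inr_mem_loopFree.1 hu⟩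
    · exact absurd hadj not_loopFree_adj_inr_inr

lemma mem_of_mem_loopFree {z : α ⊕ α} (hz : z ∈ V(t.loopFree)) : Sum.elim id id z ∈ V(t) := by
  rcases z with v | v
  · exact inl_mem_loopFree.1 hz
  · obtain ⟨e, he⟩ := inr_mem_loopFree.1 hz
    exact he.vertex_mem

lemma tubeCompatible_loopFree_iff :
    G.loopFree.TubeCompatible s.loopFree t.loopFree ↔ G.TubeCompatible s t := by
  rw [TubeCompatible, TubeCompatible, loopFree_lt_loopFree_iff, loopFree_lt_loopFree_iff]
  refine or_congr_right (or_congr_right ?_)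
  constructor
  · rintro ⟨h1, h2⟩
    have hdisj : Disjoint V(s) V(t) := Set.disjoint_left.2 fun v hv hv' ↦
      Set.disjoint_left.1 h1 (inl_mem_loopFree.2 hv) (inl_mem_loopFree.2 hv')
    refine ⟨hdisj, fun x hx y hy hxy ↦ ?_⟩
    refine h2 (Sum.inl x) (inl_mem_loopFree.2 hx) (Sum.inl y) (inl_mem_loopFree.2 hy)
      (loopFree_adj_inl_inl.2 ⟨?_, hxy⟩)
    rintro rfl
    exact Set.disjoint_left.1 hdisj hx hy
  · rintro ⟨h1, h2⟩
    have hdisj : ∀ x ∈ V(s.loopFree), ∀ y ∈ V(t.loopFree), Sum.elim id id x ≠ Sum.elim id id y :=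
      fun x hx y hy h ↦ Set.disjoint_left.1 h1 (mem_of_mem_loopFree hx)
        (h ▸ mem_of_mem_loopFree hy)
    refine ⟨Set.disjoint_left.2 fun x hx hy ↦ hdisj x hx x hy rfl, fun x hx y hy hxy ↦ ?_⟩
    have hne := hdisj x hx y hy
    rcases x with u | u <;> rcases y with v | v
    · exact h2 u (inl_mem_loopFree.1 hx) v (inl_mem_loopFree.1 hy) (loopFree_adj_inl_inl.1 hxy).2
    · exact hne (loopFree_adj_inl_inr.1 hxy).1
    · exact hne (loopFree_adj_inr_inl.1 hxy).1.symm
    · exact not_loopFree_adj_inr_inr hxy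

lemma isTubing_iff_of_connected (hc : G.toSimpleGraph.Connected) {T : Set (Graph α β)} :
    G.IsTubing T ↔ (∀ t ∈ T, G.IsTube t) ∧ T.Pairwise G.TubeCompatible := by
  refine ⟨fun h ↦ ⟨h.1, h.2.1⟩, fun h ↦ ⟨h.1, h.2, fun h' ↦ ?_⟩⟩
  exact lt_irrefl _ (h.1 G (h' ⟨IsClosedSubgraph.rfl, hc⟩)).1

lemma isTubing_loopFree_iff (hc : G.toSimpleGraph.Connected) {T : Set (Graph α β)} :
    G.loopFree.IsTubing (loopFree '' T) ↔ G.IsTubing T := by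
  rw [isTubing_iff_of_connected hc, isTubing_iff_of_connected (connected_loopFree_iff.2 hc),
    Set.forall_mem_image, loopFree_injective.injOn.pairwise_image]
  refine and_congr (forall₂_congr fun t _ ↦ isTube_loopFree_iff) ?_
  constructor
  · exact fun h s hs t ht hne ↦ tubeCompatible_loopFree_iff.1 (h hs ht hne)
  · exact fun h s hs t ht hne ↦ tubeCompatible_loopFree_iff.2 (h hs ht hne)

lemma IsTube.loopFree_notMem_ghostTubes (ht : G.IsTube t) : t.loopFree ∉ G.ghostTubes := by
  rintro ⟨v, -, h⟩
  obtain ⟨⟨w, hw⟩, -⟩ := connected_iff_forall_cut.1 ht.2.1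
  have h1 : Sum.inl w ∈ V(t.loopFree) := inl_mem_loopFree.2 hw
  rw [h] at h1
  simp at h1

/-- The edges of `u` and its ordinary nodes form the required subgraph of `G`. The point is that a
ghost node of `u` occurs with one of its edges: otherwise, by connectedness, it would be all of `u`.
-/
lemma exists_loopFree_eq {u : Graph (α ⊕ α) β} (hu : G.loopFree.IsTube u)
    (hgh : u ∉ G.ghostTubes) : ∃ t : Graph α β, t.loopFree = u := by
  have hle : u ≤ G.loopFree := hu.1.le
  set t := (G.induce {v | Sum.inl v ∈ V(u)}).restrict E(u) with ht
  have hV : ∀ v, v ∈ V(t) ↔ Sum.inl v ∈ V(u) := by simp [ht]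
  have hl : ∀ e x y, t.IsLink e x y ↔
      e ∈ E(u) ∧ G.IsLink e x y ∧ Sum.inl x ∈ V(u) ∧ Sum.inl y ∈ V(u) := by
    simp [ht]
  have htG : t ≤ G := restrict_le.trans
    (induce_le fun v hv ↦ inl_mem_loopFree.1 (hle.vertexSet_mono hv))
  refine ⟨t, Compatible.ext ?_ ?_ (Compatible.of_le_le (loopFree_le_loopFree_iff.2 htG) hle)⟩
  · ext (v | v)
    · rw [inl_mem_loopFree, hV]
    · rw [inr_mem_loopFree]
      constructor
      · rintro ⟨e, he⟩
        obtain ⟨heu, heG, hv, -⟩ := (hl e v v).1 he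
        exact ((hle.isLink_iff heu).2 (loopFree_isLink_inl_inr.2 ⟨rfl, heG⟩)).right_mem
      · intro hv
        have hne : {Sum.inr v} ≠ V(u) := by
          intro h
          refine hgh ⟨v, inr_mem_loopFree.1 (hle.vertexSet_mono hv), ?_⟩
          rw [h]
          apply edgeSet_eq_empty.1
          rw [Set.eq_empty_iff_forall_notMem]
          intro e he
          obtain ⟨x, y, hxy⟩ := exists_isLink_of_mem_edgeSet he
          have hx := hxy.left_mem
          have hy := hxy.right_mem
          rw [← h, Set.mem_singleton_iff] at hx hy
          exact (hxy.mono hle).ne (hx.trans hy.symm)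
        obtain ⟨x, hx, y, hy, -, e, he⟩ := (connected_iff_forall_cut.1 hu.2.1).2 {Sum.inr v}
          (by simpa using hv) (Set.singleton_nonempty _) hne
        rw [Set.mem_singleton_iff] at hx
        subst hx
        have heG := he.mono hle
        rcases y with w | w
        · obtain ⟨rfl, heG⟩ := loopFree_isLink_inr_inl.1 heG
          exact ⟨e, (hl e w w).2 ⟨he.edge_mem, heG, hy, hy⟩⟩
        · exact absurd heG not_loopFree_isLink_inr_inr
  · ext e
    rw [edgeSet_loopFree]
    constructor
    · intro he
      obtain ⟨x, y, hxy⟩ := exists_isLink_of_mem_edgeSet he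
      exact ((hl e x y).1 hxy).1
    · intro he
      obtain ⟨x, y, hxy⟩ := exists_isLink_of_mem_edgeSet he
      have hx := hxy.left_mem
      have hy := hxy.right_mem
      rcases hxy.mono hle with ⟨a, b, -, hab, rfl, rfl⟩ | ⟨a, ha, ⟨rfl, rfl⟩ | ⟨rfl, rfl⟩⟩
      · exact ((hl e a b).2 ⟨he, hab, hx, hy⟩).edge_mem
      · exact ((hl e a a).2 ⟨he, ha, hx, hx⟩).edge_mem
      · exact ((hl e a a).2 ⟨he, ha, hy, hy⟩).edge_mem

lemma isTubing_loopFree_disjoint_iff (hc : G.toSimpleGraph.Connected)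
    (U : Set (Graph (α ⊕ α) β)) : (G.loopFree.IsTubing U ∧ Disjoint U G.ghostTubes) ↔
      ∃ T, G.IsTubing T ∧ U = loopFree '' T := by
  constructor
  · rintro ⟨hU, hd⟩
    have hT : loopFree '' (loopFree ⁻¹' U) = U := by
      refine Set.image_preimage_eq_of_subset fun u hu ↦ ?_
      exact exists_loopFree_eq (hU.1 u hu) (Set.disjoint_left.1 hd hu)
    exact ⟨loopFree ⁻¹' U, (isTubing_loopFree_iff hc).1 (hT.symm ▸ hU), hT.symm⟩
  · rintro ⟨T, hT, rfl⟩
    refine ⟨(isTubing_loopFree_iff hc).2 hT, Set.disjoint_left.2 ?_⟩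
    rintro _ ⟨t, ht, rfl⟩
    exact (hT.1 t ht).loopFree_notMem_ghostTubes

lemma isTube_of_mem_ghostTubes {g : Graph (α ⊕ α) β} (hg : g ∈ G.ghostTubes) :
    G.loopFree.IsTube g := by
  obtain ⟨v, ⟨e, he⟩, rfl⟩ := hg
  refine ⟨lt_of_le_of_ne (noEdge_le_iff.2 (by simpa using ⟨e, he⟩)) fun h ↦ ?_, ?_, ?_⟩
  · have h1 : Sum.inl v ∈ V(G.loopFree) := inl_mem_loopFree.2 he.vertex_mem
    rw [← h] at h1
    simp at h1
  · rw [connected_iff_forall_cut]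
    refine ⟨by simp, fun S hS hne hS' ↦ ?_⟩
    rcases Set.subset_singleton_iff_eq.1 hS with rfl | rfl
    · simp at hne
    · exact absurd rfl hS'
  · intro x hx y hy hxy
    simp only [vertexSet_noEdge, Set.mem_singleton_iff] at hx hy
    exact absurd (hx.trans hy.symm) hxy

lemma ncard_vertexSet_loopFree (hV : V(G).Finite) :
    V(G.loopFree).ncard = V(G).ncard + {v | ∃ e, G.IsLoopAt e v}.ncard := by
  have hfin : {v | ∃ e, G.IsLoopAt e v}.Finite := hV.subset fun v ⟨_, he⟩ ↦ he.vertex_mem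
  change (Sum.inl '' V(G) ∪ Sum.inr '' {v | ∃ e, G.IsLoopAt e v}).ncard = _
  rw [Set.ncard_union_eq ?_ (hV.image _) (hfin.image _),
    Set.ncard_image_of_injective _ Sum.inl_injective,
    Set.ncard_image_of_injective _ Sum.inr_injective]
  refine Set.disjoint_left.2 ?_
  rintro _ ⟨v, -, rfl⟩ ⟨w, -, h⟩
  simp at h

/-- Non-loop bundles are unchanged, and all loops at one node become a single bundle. -/
lemma bundles_loopFree :
    G.loopFree.bundles = G.bundles ∪ G.loopSet '' {v | ∃ e, G.IsLoopAt e v} := by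
  have key : ∀ v, {e | G.loopFree.IsLink e (Sum.inl v) (Sum.inr v)} = G.loopSet v := by
    intro v
    ext e
    simp [loopFree_isLink_inl_inr]
  have key2 : ∀ u v, u ≠ v →
      {e | G.loopFree.IsLink e (Sum.inl u) (Sum.inl v)} = {e | G.IsLink e u v} := by
    intro u v huv
    ext e
    simp [loopFree_isLink_inl_inl, huv]
  ext B
  constructor
  · rintro ⟨u | u, v | v, -, hadj, rfl⟩
    · obtain ⟨huv, hadj⟩ := loopFree_adj_inl_inl.1 hadj
      exact Or.inl ⟨u, v, huv, hadj, key2 u v huv⟩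
    · obtain ⟨rfl, he⟩ := loopFree_adj_inl_inr.1 hadj
      exact Or.inr ⟨u, he, (key u).symm⟩
    · obtain ⟨rfl, he⟩ := loopFree_adj_inr_inl.1 hadj
      refine Or.inr ⟨v, he, ?_⟩
      rw [← key v]
      ext e
      exact isLink_comm (G := G.loopFree)
    · exact absurd hadj not_loopFree_adj_inr_inr
  · rintro (⟨u, v, huv, hadj, rfl⟩ | ⟨v, he, rfl⟩)
    · exact ⟨Sum.inl u, Sum.inl v, by simpa using huv, loopFree_adj_inl_inl.2 ⟨huv, hadj⟩,
        (key2 u v huv).symm⟩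
    · exact ⟨Sum.inl v, Sum.inr v, by simp, loopFree_adj_inl_inr.2 ⟨rfl, he⟩, (key v).symm⟩

lemma ncard_bundles_loopFree (hV : V(G).Finite) (hE : E(G).Finite) :
    G.loopFree.bundles.ncard = G.bundles.ncard + {v | ∃ e, G.IsLoopAt e v}.ncard := by
  have hfin : {v | ∃ e, G.IsLoopAt e v}.Finite := hV.subset fun v ⟨_, he⟩ ↦ he.vertex_mem
  rw [bundles_loopFree, Set.ncard_union_eq ?_ (finite_bundles hE) (hfin.image _),
    Set.InjOn.ncard_image]
  · rintro v ⟨e, he⟩ w - h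
    have h1 : e ∈ G.loopSet w := h ▸ he
    exact IsLoopAt.eq_of_inc he (IsLoopAt.inc h1)
  · refine Set.disjoint_left.2 ?_
    rintro _ ⟨u, v, huv, ⟨e, he⟩, rfl⟩ ⟨w, -, h⟩
    have h1 : e ∈ G.loopSet w := h ▸ he
    exact huv ((IsLoopAt.eq_of_inc h1 he.inc_left).symm.trans (IsLoopAt.eq_of_inc h1 he.inc_right))

end LoopFree

end Graph

namespace Graph

lemma items_noEdge_singleton {α β : Type*} {H : Graph α β} [H.Loopless] [Fintype V(H)]
    [Fintype E(H)] (d : V(H)) : H.items (noEdge {(d : α)} β) = {Sum.inl d} := by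
  ext (v | e)
  · simp [Subtype.ext_iff]
  · simp

/-! ### Ghost nodes as the nodes with omitted singletons -/

section Ghost

variable {α β : Type*} {G : Graph α β} [Fintype V(G.loopFree)] [Fintype E(G.loopFree)]

variable (G) in
/-- The ghost nodes of the loop-free pseudograph. -/
def ghostNodes : Set V(G.loopFree) := {d | ∃ v, (d : α ⊕ α) = Sum.inr v}

lemma eq_inl_of_adj_ghostNode {d x : V(G.loopFree)} {v : α}
    (hd : (d : α ⊕ α) = Sum.inr v) (h : G.loopFree.toBundled.Adj d x) :
    (x : α ⊕ α) = Sum.inl v := by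
  rw [toBundled_adj, hd] at h
  obtain ⟨u | u, hu⟩ := x
  · obtain ⟨rfl, -⟩ := loopFree_adj_inr_inl.1 h
    rfl
  · exact absurd h not_loopFree_adj_inr_inr

/-- Ghost nodes are leaves up to multiplicity of edges, as `compat_of_tight` and
`not_isBounded_region` require of the nodes in `D`. -/
lemma eq_of_adj_ghostNode : ∀ d ∈ G.ghostNodes, ∀ x y, G.loopFree.toBundled.Adj d x →
    G.loopFree.toBundled.Adj d y → x = y := by
  rintro d ⟨v, hv⟩ x y hx hy
  exact Subtype.ext ((eq_inl_of_adj_ghostNode hv hx).trans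
    (eq_inl_of_adj_ghostNode hv hy).symm)

lemma mem_ghostTubes_iff {t : Graph (α ⊕ α) β} (ht : t ≤ G.loopFree) :
    t ∈ G.ghostTubes ↔ ∃ d ∈ G.ghostNodes, G.loopFree.items t = {Sum.inl d} := by
  constructor
  · rintro ⟨v, he, rfl⟩
    have hv : Sum.inr v ∈ V(G.loopFree) := inr_mem_loopFree.2 he
    exact ⟨⟨Sum.inr v, hv⟩, ⟨v, rfl⟩, items_noEdge_singleton ⟨Sum.inr v, hv⟩⟩
  · rintro ⟨⟨_, hd⟩, ⟨v, rfl⟩, h⟩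
    refine ⟨v, inr_mem_loopFree.1 hd, items_injOn ht ?_ ?_⟩
    · exact noEdge_le_iff.2 (by simpa using hd)
    · exact h.trans (items_noEdge_singleton _).symm

lemma items_mem_keptTubes_iff {t : Graph (α ⊕ α) β} (ht : t ≤ G.loopFree) :
    G.loopFree.items t ∈ G.loopFree.toBundled.keptTubes G.ghostNodes ↔
      G.loopFree.IsTube t ∧ t ∉ G.ghostTubes := by
  rw [isTube_iff ht, mem_ghostTubes_iff ht]
  refine and_congr_right fun _ ↦ ?_
  push Not
  rfl

lemma items_image_sdiff_ghostTubes :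
    G.loopFree.items '' ({t | G.loopFree.IsTube t} \ G.ghostTubes) =
      G.loopFree.toBundled.keptTubes G.ghostNodes := by
  ext u
  constructor
  · rintro ⟨t, ht, rfl⟩
    exact (items_mem_keptTubes_iff ht.1.1.le).2 ht
  · intro hu
    have h := items_ofItems hu.1.1
    refine ⟨G.loopFree.ofItems u, (items_mem_keptTubes_iff (ofItems_le u)).1 ?_, h⟩
    rwa [h]

lemma items_image_subset_keptTubes_iff {U : Set (Graph (α ⊕ α) β)}
    (hU : G.loopFree.IsTubing U) :
    G.loopFree.items '' U ⊆ G.loopFree.toBundled.keptTubes G.ghostNodes ↔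
      Disjoint U G.ghostTubes := by
  rw [Set.image_subset_iff, Set.disjoint_left]
  refine forall₂_congr fun t ht ↦ ?_
  rw [Set.mem_preimage, items_mem_keptTubes_iff (hU.1 t ht).1.le]
  exact and_iff_right (hU.1 t ht)

end Ghost

end Graph

/-! ### The hull realization and the cone -/

theorem corollary14 {α β : Type*} (G : Graph α β) (hV : V(G).Finite) (hE : E(G).Finite)
    (hconn : G.toSimpleGraph.Connected) (hloop : ∃ e v, G.IsLoopAt e v) :
    -- the points `f_T` are well defined, and their convex hull, which is cut out by the halfspaces
    -- of all the tubes, realizes the associahedron of the loop-free pseudograph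
    (∀ T, Maximal G.loopFree.IsTubing T → ∃! p, G.loopFree.IsVertexPoint T p) ∧
    G.loopFree.hullRealization = G.loopFree.region {t | G.loopFree.IsTube t} ∧
    G.loopFree.IsRealization G.loopFree.hullRealization
      (G.loopFree.tubingFace G.loopFree.hullRealization) ∧
    -- the halfspaces of the singleton tubes of the ghost nodes are among those halfspaces
    (∀ g ∈ G.ghostTubes, G.loopFree.IsTube g) ∧
    -- without them one gets a realization of the associahedron of `G`, an unbounded polyhedron
    G.IsRealization (G.loopFree.region ({t | G.loopFree.IsTube t} \ G.ghostTubes))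
      (fun T ↦ G.loopFree.tubingFace
        (G.loopFree.region ({t | G.loopFree.IsTube t} \ G.ghostTubes)) (Graph.loopFree '' T)) ∧
    ¬ Bornology.IsBounded (G.loopFree.region ({t | G.loopFree.IsTube t} \ G.ghostTubes)) ∧
    -- the tubings `loopFree '' T` are exactly those without singleton tubes of ghost nodes
    (∀ U, (G.loopFree.IsTubing U ∧ Disjoint U G.ghostTubes) ↔
      ∃ T, G.IsTubing T ∧ U = Graph.loopFree '' T) ∧
    -- and the face of `T` is cut down to the face of `loopFree '' T` by the removed halfspaces
    (∀ T, G.IsTubing T →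
      G.loopFree.tubingFace (G.loopFree.region ({t | G.loopFree.IsTube t} \ G.ghostTubes))
          (Graph.loopFree '' T) ∩
        {p | ∀ g ∈ G.ghostTubes, G.loopFree.tubeBound g ≤ G.loopFree.tubeSum g p} =
      G.loopFree.tubingFace G.loopFree.hullRealization (Graph.loopFree '' T)) := by
  classical
  have hc : G.loopFree.toSimpleGraph.Connected := Graph.connected_loopFree_iff.2 hconn
  have hfinV : V(G.loopFree).Finite := (hV.image _).union
    (Set.Finite.image _ (hV.subset fun v ⟨_, he⟩ ↦ Graph.IsLoopAt.vertex_mem he))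
  have hfinE : E(G.loopFree).Finite := hE
  let _ : Fintype V(G.loopFree) := hfinV.fintype
  let _ : Fintype E(G.loopFree) := hfinE.fintype
  let _ : Fintype G.loopFree.bundles := (Graph.finite_bundles hfinE).fintype
  have hbundle : Fintype.card G.loopFree.bundles = G.loopFree.bundles.ncard := by
    rw [← Nat.card_eq_fintype_card, Nat.card_coe_set_eq]
  obtain ⟨e, v, hev⟩ := hloop
  -- The loop provides a bundle, on which the estimate `9 ≤ c` depends.
  have : Nonempty G.loopFree.bundles :=
    ⟨⟨_, Graph.bundles_loopFree.ge (Or.inr ⟨v, ⟨e, hev⟩, rfl⟩)⟩⟩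
  have hull := Graph.hullRealization_eq hc
  have hregion : G.loopFree.region {t | G.loopFree.IsTube t} = G.loopFree.toBundled.region ∅ :=
    Graph.region_eq_region (fun t ht ↦ ht.1.le) Graph.items_image_isTube
  have hregion' : G.loopFree.region ({t | G.loopFree.IsTube t} \ G.ghostTubes) =
      G.loopFree.toBundled.region G.ghostNodes :=
    Graph.region_eq_region (fun t ht ↦ ht.1.1.le) Graph.items_image_sdiff_ghostTubes
  have hr := Graph.redundancy_add_ncard_bundles hfinE
  have hrG := Graph.redundancy_add_ncard_bundles hE
  have hcardV := Graph.ncard_vertexSet_loopFree hV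
  have hcardB := Graph.ncard_bundles_loopFree hV hE
  rw [Graph.edgeSet_loopFree] at hr
  refine ⟨fun T hT ↦ Graph.existsUnique_isVertexPoint hc hT, hull.trans hregion.symm, ?_,
    fun g hg ↦ Graph.isTube_of_mem_ghostTubes hg, ?_, ?_,
    Graph.isTubing_loopFree_disjoint_iff hconn, fun T hT ↦ ?_⟩
  · have h := Graph.isRealization_of_bijection (G := G.loopFree) hc hull (by simp) id
      (Set.injOn_id _) (fun T hT ↦ ?_) (fun U hU _ ↦ ⟨U, hU, Set.image_id _⟩) ?_
    · simpa only [Set.image_id] using h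
    · rw [Set.image_id]
      refine ⟨hT, ?_⟩
      rw [← Graph.items_image_isTube]
      exact Set.image_mono hT.1
    · rw [hbundle, Graph.edgeSet_loopFree]
      omega
  · refine Graph.isRealization_of_bijection hc hregion' Graph.eq_of_adj_ghostNode _
      Graph.loopFree_injective.injOn (fun T hT ↦ ?_) (fun U hU hU' ↦ ?_) ?_
    · obtain ⟨h1, h2⟩ := (Graph.isTubing_loopFree_disjoint_iff hconn _).2 ⟨T, hT, rfl⟩
      exact ⟨h1, (Graph.items_image_subset_keptTubes_iff h1).2 h2⟩
    · obtain ⟨T, hT, h⟩ := (Graph.isTubing_loopFree_disjoint_iff hconn U).1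
        ⟨hU, (Graph.items_image_subset_keptTubes_iff hU).1 hU'⟩
      exact ⟨T, hT, h.symm⟩
    -- The number of looped nodes enters both the nodes and the bundles of the loop-free graph and
    -- cancels.
    · rw [hbundle, Graph.edgeSet_loopFree]
      omega
  · rw [hregion']
    -- The unbounded direction goes from the ghost node of `v` to `v`.
    refine BundledGraph.not_isBounded_region (Graph.isPiece_univ hc) Graph.eq_of_adj_ghostNode
      ⟨⟨Sum.inr v, Graph.inr_mem_loopFree.2 ⟨e, hev⟩⟩, ⟨v, rfl⟩,
        ⟨Sum.inl v, Graph.inl_mem_loopFree.2 hev.vertex_mem⟩, ?_⟩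
    rw [Graph.toBundled_adj]
    exact Graph.loopFree_adj_inr_inl.2 ⟨rfl, e, hev⟩
  · rw [hull.trans hregion.symm]
    ext p
    constructor
    · rintro ⟨⟨⟨h1, h2, h3⟩, h4⟩, h5⟩
      refine ⟨⟨h1, h2, fun t ht ↦ ?_⟩, h4⟩
      by_cases hg : t ∈ G.ghostTubes
      · exact h5 t hg
      · exact h3 t ⟨ht, hg⟩
    · rintro ⟨⟨h1, h2, h3⟩, h4⟩
      exact ⟨⟨⟨h1, h2, fun t ht ↦ h3 t ht.1⟩, h4⟩,
        fun g hg ↦ h3 g (Graph.isTube_of_mem_ghostTubes hg)⟩
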